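/- Let $f:\mathbb{R}^n\times\mathbb{R}^q\to\mathbb{R}^n$ be $C^2$, $p\in\mathbb{R}^q$, $T>0$, $\rho$ irrational, and $\mathbb{S}=\mathbb{R}/\mathbb{Z}$. Let $F(t,x,p)$ be the (local) flow of $x'=f(x,p)$. Let $v:\mathbb{S}\times\mathbb{R}\to\mathbb{R}^n$ be $C^2$ with $$\partial_\tau v=Tf(v,p),\qquad v(\phi,\tau+1)=v(\phi+\rho,\tau),$$ and let $V$ solve $\partial_\tau V=T\partial_xf(v,p)V$, $V(\cdot,0)=I_n$. *Transversal stability.* Assume there is a continuous family of projections $q_{\mathrm{tg}}(\phi,\tau)$, $(\phi,\tau)\in\mathbb{S}\times\mathbb{R}$, of $\mathbb{R}^n$ onto $\mathrm{span}\{\partial_\tau v(\phi,\tau),\partial_\phi v(\phi,\tau)\}$ with $q_{\mathrm{tg}}(\phi,\tau+1)=q_{\mathrm{tg}}(\phi+\rho,\tau)$ and $q_{\mathrm{tg}}(\phi,\tau)V(\phi,\tau)=V(\phi,\tau)q_{\mathrm{tg}}(\phi,0)$, such that, with $q_{\mathrm{tr}}=I_n-q_{\mathrm{tg}}$, for each $\tau$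 the operator $\delta(\cdot)\mapsto V(\cdot-\rho,\tau+1)V^{-1}(\cdot-\rho,\tau)\delta(\cdot-\rho)-\delta(\cdot)$ is a bijection with bounded inverse on the space of continuous $\delta:\mathbb{S}\to\mathbb{R}^n$ with $q_{\mathrm{tr}}(\cdot,\tau)\delta=\delta$ (normal hyperbolicity), and such that $\|V(\phi,k)q_{\mathrm{tr}}(\phi,0)\|\le C_{\mathrm{tr}}e^{-k/\tau_{\mathrm{tr}}}$ for all $\phi$ and $k=0,1,2,\dots$, with constants $C_{\mathrm{tr}},\tau_{\mathrm{tr}}>0$. *Adjoint solutions.* Let $h=(h_1,h_2)$ be phase conditions with $h(v,p)=0$, whose derivative with respect to $v$ is $\delta_v\mapsto\int_{\mathbb{S}}\int_0^1\partial_vh\,\delta_v\,d\tau\,d\phi$ with a continuous kernel $\partial_vh(\phi,\tau)$, which have a derivative $\partial_ph$ with respect to $p$, and for which the $2\times2$ matrix $\int_{\mathbb{S}}\int_0^1\partial_vh\,[\partial_\tau v\ \ \partial_\phi v]\,d\tau\,d\phi$ is nonsingular. For given $(\eta_\rho,\eta_T)$ the adjoint conditions for $(\lambda_{\mathrm{de}},\lambda_{\mathrm{bc}},\lambda_{\mathrm{ps}},\eta_p)$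 are, for $\tau\in[0,1]$, $$-\partial_\tau\lambda_{\mathrm{de}}^{\mathsf T}-T\lambda_{\mathrm{de}}^{\mathsf T}\partial_xf(v,p)+\lambda_{\mathrm{ps}}^{\mathsf T}\partial_vh=0,\quad \lambda_{\mathrm{de}}(\phi,1)=\lambda_{\mathrm{bc}}(\phi),\quad \lambda_{\mathrm{de}}(\phi,0)=\lambda_{\mathrm{bc}}(\phi-\rho),$$ $$\int_{\mathbb{S}}\int_0^1\lambda_{\mathrm{de}}^{\mathsf T}f(v,p)\,d\tau\,d\phi=\eta_T,\qquad \int_{\mathbb{S}}\lambda_{\mathrm{bc}}^{\mathsf T}(\phi)\partial_\phi v(\phi+\rho,0)\,d\phi=-\eta_\rho,$$ $$-\int_{\mathbb{S}}\int_0^1\lambda_{\mathrm{de}}^{\mathsf T}T\partial_pf(v,p)\,d\tau\,d\phi+\eta_p^{\mathsf T}+\lambda_{\mathrm{ps}}^{\mathsf T}\partial_ph=0.$$ Let $\lambda_{\mathrm{de},T}$ and $\lambda_{\mathrm{de},\rho}$ be the continuous solutions $\lambda_{\mathrm{de}}$ for $(\eta_\rho,\eta_T)=(0,1)$ and $(1,0)$,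 extended to all $\tau$ by $\lambda_{\mathrm{de}}(\phi,\tau+1)=\lambda_{\mathrm{de}}(\phi+\rho,\tau)$; all angles $\phi$ below are lifted to $\mathbb{R}$. Then the following hold. 1. There are $\varepsilon_0,r,C>0$ such that for all $0<\varepsilon\le\varepsilon_0$, all continuous $\delta_{\mathrm{ode}}:[0,\infty)\to\mathbb{R}^n$ with $\|\delta_{\mathrm{ode}}\|\le\varepsilon$, all $(\phi_0,\sigma_0)$ and all $x_0$ with $\|x_0-v(\phi_0,\sigma_0)\|\le\varepsilon$: the problem $x'=Tf(x,p)+\delta_{\mathrm{ode}}(\tau)$, $x(0)=x_0$ has a solution on $[0,\infty)$, and for every such solution there are unique continuous $\varphi,\sigma:[0,\infty)\to\mathbb{R}$ with $|\varphi(0)-\phi_0|\le r$, $|\sigma(0)-\sigma_0|\le r$ such that $x_{\mathrm{tr}}(\tau):=x(\tau)-v(\varphi(\tau),\sigma(\tau))$ satisfies $\lambda_{\mathrm{de},T}^{\mathsf T}(\varphi,\sigma)x_{\mathrm{tr}}=\lambda_{\mathrm{de},\rho}^{\mathsf T}(\varphi,\sigma)x_{\mathrm{tr}}=0$ for all $\tau\ge0$;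 they are differentiable, and for all $\tau\ge0$ $$\|x_{\mathrm{tr}}\|\le C\varepsilon,\quad \bigl|\varphi'+\lambda_{\mathrm{de},\rho}^{\mathsf T}(\varphi,\sigma)\delta_{\mathrm{ode}}\bigr|\le C\varepsilon^2,\quad \bigl|\sigma'-1-\tfrac1T\lambda_{\mathrm{de},T}^{\mathsf T}(\varphi,\sigma)\delta_{\mathrm{ode}}\bigr|\le C\varepsilon^2.$$ 2. There are $d_0,C>0$ such that for all $(\phi_0,\sigma_0)$, all $\|\delta\|\le d_0$ and all $\tau\ge0$ the following flow values exist and $$\Bigl\|F(T\tau,v(\phi_0,\sigma_0)+\delta,p)-F\bigl(T\tau,v(\phi_0-\lambda_{\mathrm{de},\rho}^{\mathsf T}(\phi_0,\sigma_0)\delta,\ \sigma_0+\tfrac1T\lambda_{\mathrm{de},T}^{\mathsf T}(\phi_0,\sigma_0)\delta),p\bigr)\Bigr\|\le C\|\delta\|^2+Ce^{-\tau/\tau_{\mathrm{tr}}}.$$ 3. There are $d_0,r,C>0$ such that for all $(\phi_0,\sigma_0)$ and all $\|\delta\|\le d_0$ there is a unique pair $(\phi_*,\sigma_*)$ with $|\phi_*-\phi_0|\le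 r$, $|\sigma_*-\sigma_0|\le r$ (the asymptotic phases of $v(\phi_0,\sigma_0)+\delta$) for which $F(T\tau,v(\phi_0,\sigma_0)+\delta,p)$ exists for all $\tau\ge0$ and $F(T\tau,v(\phi_0,\sigma_0)+\delta,p)-F(T\tau,v(\phi_*,\sigma_*),p)\to0$ as $\tau\to\infty$; moreover $$\bigl|\phi_*-(\phi_0-\lambda_{\mathrm{de},\rho}^{\mathsf T}(\phi_0,\sigma_0)\delta)\bigr|\le C\|\delta\|^2,\qquad \bigl|\sigma_*-(\sigma_0+\tfrac1T\lambda_{\mathrm{de},T}^{\mathsf T}(\phi_0,\sigma_0)\delta)\bigr|\le C\|\delta\|^2.$$ -/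

import Mathlib

open Set Filter Topology

noncomputable section

/-- The Euclidean space `ℝⁿ`. -/
abbrev Vec (n : ℕ) : Type := EuclideanSpace ℝ (Fin n)

/-- `γ` solves `γ' = g(γ)` on the time interval between `0` and `t`, with `γ(0) = x₀`. -/
def IsTrajectory {n : ℕ} (g : Vec n → Vec n) (x₀ : Vec n) (t : ℝ) (γ : ℝ → Vec n) : Prop :=
  γ 0 = x₀ ∧ ∀ s ∈ uIcc 0 t, HasDerivWithinAt γ (g (γ s)) (uIcc 0 t) s

/-- The solution of `x' = g(x)` starting at `x₀` exists up to time `t`. -/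
def FlowDefined {n : ℕ} (g : Vec n → Vec n) (t : ℝ) (x₀ : Vec n) : Prop :=
  ∃ γ : ℝ → Vec n, IsTrajectory g x₀ t γ

open Classical in
/-- The (local) flow of `x' = g(x)`; its value is meaningful where `FlowDefined g t x₀` holds. -/
def flow {n : ℕ} (g : Vec n → Vec n) (t : ℝ) (x₀ : Vec n) : Vec n :=
  if H : FlowDefined g t x₀ then H.choose t else x₀

/-- The partial derivative in the first argument `φ`. -/
def dphi {n : ℕ} (v : ℝ → ℝ → Vec n) (φ τ : ℝ) : Vec n := deriv (fun s => v s τ) φ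

/-- The partial derivative in the second argument `τ`. -/
def dtau {n : ℕ} (v : ℝ → ℝ → Vec n) (φ τ : ℝ) : Vec n := deriv (fun s => v φ s) τ

/-- `v` solves the torus boundary-value problem `∂_τ v = T g(v)`, `v(φ, 1) = v(φ + ρ, 0)`.
Functions of `φ ∈ 𝕊 = ℝ/ℤ` are written as `1`-periodic functions on `ℝ`, and `v` is extended to all
`τ ∈ ℝ` by `v(φ, τ + 1) = v(φ + ρ, τ)`. -/
structure IsTorusSolution {n : ℕ} (g : Vec n → Vec n) (T ρ : ℝ) (v : ℝ → ℝ → Vec n) : Prop where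
  smooth : ContDiff ℝ 2 (Function.uncurry v)
  periodic : ∀ φ τ, v (φ + 1) τ = v φ τ
  ode : ∀ φ τ, HasDerivAt (fun s => v φ s) (T • g (v φ τ)) τ
  bc : ∀ φ τ, v φ (τ + 1) = v (φ + ρ) τ

/-- `V` solves the variational problem `∂_τ V = T ∂ₓg(v) V`, `V(·, 0) = I`. -/
structure IsVariationalSolution {n : ℕ} (g : Vec n → Vec n) (T : ℝ) (v : ℝ → ℝ → Vec n)
    (V : ℝ → ℝ → Vec n →L[ℝ] Vec n) : Prop where
  init : ∀ φ, V φ 0 = ContinuousLinearMap.id ℝ (Vec n)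
  ode : ∀ φ τ, HasDerivAt (fun s => V φ s) (T • (fderiv ℝ g (v φ τ) ∘L V φ τ)) τ

/-- The operator
`Γ_{ρ,τ} : δ ↦ V(· - ρ, τ + 1) V(· - ρ, τ)⁻¹ δ(· - ρ) - δ(·)`. -/
def gammaOp {n : ℕ} (V : ℝ → ℝ → Vec n →L[ℝ] Vec n) (ρ τ : ℝ) (d : ℝ → Vec n) : ℝ → Vec n :=
  fun φ => V (φ - ρ) (τ + 1) ((V (φ - ρ) τ).inverse (d (φ - ρ))) - d φ

/-- `d` is a continuous periodic perturbation with values in the kernel of the tangential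
projections at level `τ`, i.e. in the range of `q_tr(·, τ) = I - q_tg(·, τ)`. -/
def IsTransversal {n : ℕ} (qtg : ℝ → ℝ → Vec n →L[ℝ] Vec n) (τ : ℝ) (d : ℝ → Vec n) : Prop :=
  Continuous d ∧ (∀ φ, d (φ + 1) = d φ) ∧ ∀ φ, qtg φ τ (d φ) = 0

/-- Normal hyperbolicity of the torus, with variational solution `V` and tangential projections
`q_tg`: an invariant continuous family of projections onto the tangent spaces such that every
`Γ_{ρ,τ}` is a bijection with bounded inverse on the transversal perturbations. -/
structure IsNormallyHyperbolic {n : ℕ} (ρ : ℝ) (v : ℝ → ℝ → Vec n)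
    (V qtg : ℝ → ℝ → Vec n →L[ℝ] Vec n) : Prop where
  continuous : Continuous (Function.uncurry qtg)
  periodic : ∀ φ τ, qtg (φ + 1) τ = qtg φ τ
  idem : ∀ φ τ, qtg φ τ ∘L qtg φ τ = qtg φ τ
  range_eq : ∀ φ τ, LinearMap.range (qtg φ τ : Vec n →ₗ[ℝ] Vec n) =
    Submodule.span ℝ {dtau v φ τ, dphi v φ τ}
  shift : ∀ φ τ, qtg φ (τ + 1) = qtg (φ + ρ) τ
  invariant : ∀ φ τ, qtg φ τ ∘L V φ τ = V φ τ ∘L qtg φ 0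
  mapsTo : ∀ τ d, IsTransversal qtg τ d → IsTransversal qtg τ (gammaOp V ρ τ d)
  bijective : ∀ τ r, IsTransversal qtg τ r → ∃! d, IsTransversal qtg τ d ∧ gammaOp V ρ τ d = r
  bounded_inverse : ∀ τ, ∃ K : ℝ, ∀ d M, IsTransversal qtg τ d →
    (∀ φ, ‖gammaOp V ρ τ d φ‖ ≤ M) → ∀ φ, ‖d φ‖ ≤ K * M

/-- The torus is transversally stable with transversal time constant `τ_tr`:
it is normally hyperbolic and `‖V(·, k) q_tr(·, 0)‖ ≤ C_tr exp(-k / τ_tr)` for `k = 0, 1, 2, …`. -/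
def IsTransversallyStable {n : ℕ} (g : Vec n → Vec n) (T ρ : ℝ) (v : ℝ → ℝ → Vec n)
    (τtr : ℝ) : Prop :=
  0 < τtr ∧ ∃ V qtg : ℝ → ℝ → Vec n →L[ℝ] Vec n,
    IsVariationalSolution g T v V ∧ IsNormallyHyperbolic ρ v V qtg ∧
    ∃ Ctr > 0, ∀ (k : ℕ) (φ : ℝ),
      ‖V φ k ∘L (ContinuousLinearMap.id ℝ (Vec n) - qtg φ 0)‖ ≤ Ctr * Real.exp (-k / τtr)

/-- The pairing `∫_𝕊 ∫₀¹ a(φ, τ)ᵀ b(φ, τ) dτ dφ`. -/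
def pairing {n : ℕ} (a b : ℝ → ℝ → Vec n) : ℝ :=
  ∫ φ in (0 : ℝ)..1, ∫ τ in (0 : ℝ)..1, inner ℝ (a φ τ) (b φ τ)

/-- `h = (h₁, h₂)` is a pair of phase conditions satisfied by `(v, p)`, whose partial derivatives
at `(v, p)` are given by the kernels `∂ᵥh = Dv` and the vectors `∂ₚh = Dp`,
subject to the nondegeneracy condition on the two tangent directions. -/
structure IsPhaseCondition {n q : ℕ} (h : (ℝ → ℝ → Vec n) → Vec q → Fin 2 → ℝ)
    (v : ℝ → ℝ → Vec n) (p : Vec q) (Dv : Fin 2 → ℝ → ℝ → Vec n) (Dp : Fin 2 → Vec q) :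
    Prop where
  zero : ∀ i, h v p i = 0
  continuousOn : ∀ i, ContinuousOn (Function.uncurry (Dv i)) (univ ×ˢ Icc 0 1)
  periodic : ∀ i φ, ∀ τ ∈ Icc (0 : ℝ) 1, Dv i (φ + 1) τ = Dv i φ τ
  deriv_v : ∀ i (w : ℝ → ℝ → Vec n), ContDiff ℝ 1 (Function.uncurry w) →
    (∀ φ τ, w (φ + 1) τ = w φ τ) →
    HasDerivAt (fun s : ℝ => h (fun φ τ => v φ τ + s • w φ τ) p i) (pairing (Dv i) w) 0
  deriv_p : ∀ i, HasGradientAt (fun p' => h v p' i) (Dp i) p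
  nondegenerate : (Matrix.of fun i : Fin 2 =>
    ![pairing (Dv i) (dtau v), pairing (Dv i) (dphi v)]).det ≠ 0

/-- `(λ_de, λ_bc, λ_ps, η_p)` is a continuous solution of the adjoint conditions with the given
`η_ρ` and `η_T`; `λ_de` is extended to all `τ ∈ ℝ` by `λ_de(φ, τ + 1) = λ_de(φ + ρ, τ)`. -/
structure IsAdjointSolution {n q : ℕ} (f : Vec n → Vec q → Vec n) (p : Vec q) (T ρ : ℝ)
    (v : ℝ → ℝ → Vec n) (Dv : Fin 2 → ℝ → ℝ → Vec n) (Dp : Fin 2 → Vec q) (ηρ ηT : ℝ)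
    (lde : ℝ → ℝ → Vec n) (lbc : ℝ → Vec n) (lps : Fin 2 → ℝ) (ηp : Vec q) : Prop where
  continuous : Continuous (Function.uncurry lde)
  periodic : ∀ φ τ, lde (φ + 1) τ = lde φ τ
  shift : ∀ φ τ, lde φ (τ + 1) = lde (φ + ρ) τ
  var_v : ∀ φ, ∀ τ ∈ Icc (0 : ℝ) 1, HasDerivWithinAt (fun s => lde φ s)
    (-(T • ContinuousLinearMap.adjoint (fderiv ℝ (fun x => f x p) (v φ τ)) (lde φ τ))
      + ∑ i, lps i • Dv i φ τ) (Icc 0 1) τ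
  var_v1 : ∀ φ, lde φ 1 - lbc φ = 0
  var_v0 : ∀ φ, -lde φ 0 + lbc (φ - ρ) = 0
  var_T : -pairing lde (fun φ τ => f (v φ τ) p) + ηT = 0
  var_ρ : (∫ φ in (0 : ℝ)..1, inner ℝ (lbc φ) (dphi v (φ + ρ) 0)) + ηρ = 0
  var_p : ∀ w : Vec q, -pairing lde (fun φ τ => T • fderiv ℝ (fun p' => f (v φ τ) p') p w)
    + inner ℝ ηp w + ∑ i, lps i * inner ℝ (Dp i) w = 0

/-- `lde` is the `λ_de`-component of a continuous solution of the adjoint conditions. -/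
def IsAdjointFunction {n q : ℕ} (f : Vec n → Vec q → Vec n) (p : Vec q) (T ρ : ℝ)
    (v : ℝ → ℝ → Vec n) (Dv : Fin 2 → ℝ → ℝ → Vec n) (Dp : Fin 2 → Vec q) (ηρ ηT : ℝ)
    (lde : ℝ → ℝ → Vec n) : Prop :=
  ∃ (lbc : ℝ → Vec n) (lps : Fin 2 → ℝ) (ηp : Vec q),
    IsAdjointSolution f p T ρ v Dv Dp ηρ ηT lde lbc lps ηp

/-- `x` solves `x' = T g(x) + δ_ode(τ)` for all `τ ≥ 0`, with `x(0) = x₀`. -/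
def IsPerturbedTrajectory {n : ℕ} (g : Vec n → Vec n) (T : ℝ) (dode : ℝ → Vec n)
    (x₀ : Vec n) (x : ℝ → Vec n) : Prop :=
  x 0 = x₀ ∧ ∀ τ ∈ Ici (0 : ℝ), HasDerivWithinAt x (T • g (x τ) + dode τ) (Ici 0) τ

/-- `x(τ) = v(φ(τ), σ(τ)) + x_tr(τ)` for `τ ≥ 0`, where `φ`, `σ` are continuous and `x_tr(τ)` is
annihilated by `λ_{de,T}` and `λ_{de,ρ}` at `(φ(τ), σ(τ))`. -/
def IsPhaseDecomposition {n : ℕ} (v lT lρ : ℝ → ℝ → Vec n) (x : ℝ → Vec n) (φ σ : ℝ → ℝ) :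
    Prop :=
  ContinuousOn φ (Ici 0) ∧ ContinuousOn σ (Ici 0) ∧ ∀ τ ∈ Ici (0 : ℝ),
    inner ℝ (lT (φ τ) (σ τ)) (x τ - v (φ τ) (σ τ)) = 0 ∧
    inner ℝ (lρ (φ τ) (σ τ)) (x τ - v (φ τ) (σ τ)) = 0

/-- `(φ, σ)` are asymptotic phases of the point `x`: the trajectory of `x` exists for all forward
times and converges to the trajectory of `v(φ, σ)` on the torus. -/
def IsAsymptoticPhase {n : ℕ} (g : Vec n → Vec n) (T : ℝ) (v : ℝ → ℝ → Vec n) (x : Vec n)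
    (φ σ : ℝ) : Prop :=
  (∀ τ ≥ 0, FlowDefined g (T * τ) x) ∧
    Tendsto (fun τ => flow g (T * τ) x - flow g (T * τ) (v φ σ)) atTop (𝓝 0)

end

/-!
The two adjoint solutions assemble into operators `Λ b : ℝⁿ → ℝ²`, `Λ b y = (-λ_ρᵀ y, λ_Tᵀ y / T)`,
at the points `b = (φ, τ)`. Pairing them with a variational solution gives a quantity that is
constant in time, up to the phase conditions. For the tangent vectors `∂v` this quantity is also
invariant under the irrational rotation by `ρ`, hence constant on the torus; the phase multipliers
`λ_ps` therefore vanish and `Λ` is dual to `∂v`. As the transversal vectors decay along the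
variational flow, which leaves `Λ` invariant, they are exactly the kernels of `Λ`.

A phase of a point `x` near the torus is a solution `b` of `Λ b (x - v b) = 0`, and it is locally
unique because `Λ b` is a left inverse of the derivative of `v`. Running the perturbed equation for
`m` units of time from a point with phase `b` contracts the distance to the torus up to the size of
the perturbation, while the phase moves with unit speed in `τ` up to the size of the perturbation
and the square of the distance. Iterating this step keeps the trajectory near the torus for all
times, and the phases converge if the perturbation vanishes.

The adjoint solutions are only continuous, but `Λ` is Lipschitz, and `b ↦ Λ b y` is differentiable
for `y` in the kernel: the increments are integrals, over all positive times, of increments of the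
linearized vector field applied to a decaying solution. Hence the phase equation can be
differentiated in time.
-/

theorem exists_pos_le_one_mul_le {h₁ h₂ : ℝ} (hh₁ : 0 < h₁) (hh₂ : 0 < h₂) (c₁ c₂ : ℝ) :
    ∃ d > 0, d ≤ 1 ∧ c₁ * d ≤ h₁ ∧ c₂ * d ≤ h₂ := by
  have small : ∀ {h : ℝ}, 0 < h → ∀ c : ℝ, ∀ᶠ d in 𝓝[>] (0 : ℝ), c * d ≤ h := fun hh c => by
    have tends : Tendsto (fun d : ℝ => c * d) (𝓝[>] 0) (𝓝 0) :=
      ((continuous_const_mul c).tendsto' 0 0 (mul_zero c)).mono_left nhdsWithin_le_nhds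
    exact tends.eventually (ge_mem_nhds hh)
  obtain ⟨d, hd, h1, h2, h3⟩ := (eventually_mem_nhdsWithin.and
    ((small one_pos 1).and ((small hh₁ c₁).and (small hh₂ c₂)))).exists
  exact ⟨d, hd, by simpa using h1, h2, h3⟩

theorem exp_neg_div_le_one {s τ : ℝ} (hs : 0 ≤ s) (hτ : 0 < τ) : Real.exp (-s / τ) ≤ 1 := by
  rw [Real.exp_le_one_iff, neg_div, neg_nonpos]
  positivity

theorem exp_neg_div_lt_one {s τ : ℝ} (hs : 0 < s) (hτ : 0 < τ) : Real.exp (-s / τ) < 1 := by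
  rw [Real.exp_lt_one_iff, neg_div, neg_lt_zero]
  positivity

theorem exists_nat_mul_exp_neg_div_le_one (c : ℝ) {τ : ℝ} (hτ : 0 < τ) :
    ∃ m : ℕ, 0 < m ∧ c * Real.exp (-m / τ) ≤ 1 := by
  have tends : Tendsto (fun m : ℕ => c * Real.exp (-m / τ)) atTop (𝓝 (c * 0)) :=
    ((Real.tendsto_exp_atBot.comp ((tendsto_neg_atTop_atBot.comp
      tendsto_natCast_atTop_atTop).atBot_div_const hτ))).const_mul c
  rw [mul_zero] at tends
  obtain ⟨m, hle, hpos⟩ := ((tends.eventually (ge_mem_nhds one_pos)).and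
    (eventually_gt_atTop 0)).exists
  exact ⟨m, hpos, hle⟩

theorem floor_div_mul_le {t m : ℝ} (ht : 0 ≤ t) (hm : 0 < m) : ⌊t / m⌋₊ * m ≤ t := by
  rw [← le_div_iff₀ hm]
  exact Nat.floor_le (by positivity)

theorem lt_floor_div_mul_add (t : ℝ) {m : ℝ} (hm : 0 < m) : t < ⌊t / m⌋₊ * m + m := by
  have := Nat.lt_floor_add_one (t / m)
  rwa [div_lt_iff₀ hm, add_one_mul] at this

theorem exp_neg_div_pow_floor_le {t m τ : ℝ} (hm : 0 < m) (hτ : 0 < τ) :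
    Real.exp (-m / τ) ^ ⌊t / m⌋₊ ≤ Real.exp (-t / τ) / Real.exp (-m / τ) := by
  have := (lt_floor_div_mul_add t hm).le
  rw [← Real.exp_nat_mul, ← Real.exp_sub, Real.exp_le_exp, mul_div_assoc', ← sub_div]
  gcongr
  linarith

theorem exists_geometric_approx_of_almost_translation {E : Type*} [NormedAddCommGroup E]
    [CompleteSpace E] {p : ℕ → E} {e : E} {c q : ℝ} (hq : q < 1)
    (hp : ∀ k, ‖p (k + 1) - (p k + e)‖ ≤ c * q ^ k) :
    ∃ b, ∀ k, ‖p k - (b + k • e)‖ ≤ c * q ^ k / (1 - q) := by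
  have hdist : ∀ k, dist (p k - k • e) (p (k + 1) - (k + 1) • e) ≤ c * q ^ k := fun k => by
    have translate : p (k + 1) - (k + 1) • e - (p k - k • e) = p (k + 1) - (p k + e) := by
      rw [succ_nsmul]
      abel
    rw [dist_comm, dist_eq_norm, translate]
    exact hp k
  obtain ⟨b, hb⟩ := cauchySeq_tendsto_of_complete (cauchySeq_of_le_geometric _ _ hq hdist)
  refine ⟨b, fun k => ?_⟩
  have := dist_le_of_le_geometric_of_tendsto _ _ hq hdist hb k
  rwa [dist_eq_norm, sub_sub, add_comm] at this

theorem exists_seq_of_contracting_step {α : Type*} {P : ℕ → α → Prop} {u : ℕ → α → ℝ}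
    {R : ℕ → α → α → Prop} {θ c d : ℝ} (hθ₀ : 0 ≤ θ) (hθ₁ : θ < 1) (hc : 0 ≤ c)
    (step : ∀ k b, P k b → u k b ≤ d → ∃ b', P (k + 1) b' ∧ u (k + 1) b' ≤ θ * u k b + c ∧ R k b b')
    {b₀ : α} (hP : P 0 b₀) (hu₀ : 0 ≤ u 0 b₀) (hu : u 0 b₀ + c / (1 - θ) ≤ d) :
    ∃ p : ℕ → α, p 0 = b₀ ∧ ∀ k, P k (p k) ∧ u k (p k) ≤ θ ^ k * u 0 b₀ + c / (1 - θ) ∧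
      R k (p k) (p (k + 1)) := by
  have hθ : 0 < 1 - θ := sub_pos.2 hθ₁
  set B := c / (1 - θ) with hB
  have hBθ : θ * B + c = B := by rw [hB]; field_simp; ring
  have in_region : ∀ k, θ ^ k * u 0 b₀ + B ≤ d := fun k => by
    have := mul_le_of_le_one_left hu₀ (pow_le_one₀ (n := k) hθ₀ hθ₁.le)
    linarith
  choose! next next_P next_u next_R using step
  let p : ℕ → α := fun k => Nat.rec b₀ next k
  have invariant : ∀ k, P k (p k) ∧ u k (p k) ≤ θ ^ k * u 0 b₀ + B := by
    intro k
    induction k with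
    | zero => exact ⟨hP, by
      rw [pow_zero, one_mul]
      exact le_add_of_nonneg_right (div_nonneg hc hθ.le)⟩
    | succ k ih =>
      have hd := ih.2.trans (in_region k)
      refine ⟨next_P k _ ih.1 hd, (next_u k _ ih.1 hd).trans ?_⟩
      calc θ * u k (p k) + c ≤ θ * (θ ^ k * u 0 b₀ + B) + c := by gcongr; exact ih.2
        _ = θ ^ (k + 1) * u 0 b₀ + (θ * B + c) := by ring
        _ = θ ^ (k + 1) * u 0 b₀ + B := by rw [hBθ]
  exact ⟨p, rfl, fun k => ⟨(invariant k).1, (invariant k).2,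
    next_R k _ (invariant k).1 ((invariant k).2.trans (in_region k))⟩⟩

theorem exists_fixedPoint_mem_closedBall {E : Type*} [NormedAddCommGroup E] [CompleteSpace E]
    {H : E → E} {a : E} {R : ℝ} (hR : 0 ≤ R)
    (contracts : ∀ b ∈ Metric.closedBall a R, ∀ b' ∈ Metric.closedBall a R,
      ‖H b' - H b‖ ≤ 1 / 2 * ‖b' - b‖) (ha : ‖H a - a‖ ≤ R / 2) :
    ∃ b ∈ Metric.closedBall a R, H b = b := by
  have haR : a ∈ Metric.closedBall a R := Metric.mem_closedBall_self hR
  have hmaps : MapsTo H (Metric.closedBall a R) (Metric.closedBall a R) := by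
    intro b hb
    have := contracts a haR b hb
    rw [mem_closedBall_iff_norm] at hb ⊢
    linarith [norm_sub_le_norm_sub_add_norm_sub (H b) (H a) a]
  have hcontr : ContractingWith (1 / 2 : NNReal) (hmaps.restrict H _ _) := by
    refine ⟨by rw [← NNReal.coe_lt_coe]; push_cast; norm_num, ?_⟩
    refine LipschitzWith.of_dist_le_mul fun b b' => ?_
    rw [Subtype.dist_eq, Subtype.dist_eq, dist_eq_norm, dist_eq_norm]
    simpa using contracts b' b'.2 b b.2
  obtain ⟨b, hb, hfix, -⟩ := hcontr.exists_fixedPoint' Metric.isClosed_closedBall.isComplete hmaps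
    haR (edist_ne_top _ _)
  exact ⟨b, hb, hfix⟩

theorem exists_hasDerivWithinAt_of_sub_apply {E : Type*} [NormedAddCommGroup E] [NormedSpace ℝ E]
    [CompleteSpace E] {D : E →L[ℝ] E} (hD : ‖D‖ < 1) {b : ℝ → E} {w : E} {s : Set ℝ} {t : ℝ}
    (ht : t ∈ s) (h : HasDerivWithinAt (fun r => b r - D (b r)) w s t) :
    ∃ b', HasDerivWithinAt b b' s t ∧ b' = w + D b' := by
  set u := Units.oneSub D hD
  set B : E →L[ℝ] E := ↑u⁻¹
  have left_inv : ∀ y, B (y - D y) = y := fun y =>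
    congrArg (fun L : E →L[ℝ] E => L y) u.inv_mul
  have right_inv : B w - D (B w) = w := congrArg (fun L : E →L[ℝ] E => L w) u.mul_inv
  refine ⟨B w, ?_, sub_eq_iff_eq_add.1 right_inv⟩
  exact (B.hasFDerivAt.comp_hasDerivWithinAt t h).congr_of_mem (fun r _ => (left_inv _).symm) ht

section NormedSpace

variable {X : Type*} [NormedAddCommGroup X] [NormedSpace ℝ X]

theorem norm_le_exp_mul_of_norm_deriv_le {u u' : ℝ → X} {κ δ ε S : ℝ} (hκ : 0 < κ) (hδ : 0 ≤ δ)
    (hε : 0 ≤ ε) (hu : ∀ s ≥ 0, HasDerivWithinAt u (u' s) (Ici 0) s) (h0 : ‖u 0‖ ≤ δ)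
    (bound : ∀ s ∈ Ico 0 S, ‖u' s‖ ≤ κ * ‖u s‖ + ε) :
    ∀ s ∈ Icc 0 S, ‖u s‖ ≤ Real.exp (κ * S) * (1 + 1 / κ) * (δ + ε) := by
  intro s hs
  have gronwall : ‖u s‖ ≤ gronwallBound δ κ ε (s - 0) :=
    norm_le_gronwallBound_of_norm_deriv_right_le
      (fun t ht => (hu t ht.1).continuousWithinAt.mono Icc_subset_Ici_self)
      (fun t ht => (hu t ht.1).mono (Ici_subset_Ici.2 ht.1)) h0 bound s hs
  have hexp : Real.exp (κ * s) ≤ Real.exp (κ * S) := by gcongr; exact hs.2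
  calc ‖u s‖ ≤ δ * Real.exp (κ * s) + ε / κ * (Real.exp (κ * s) - 1) := by
        simpa only [gronwallBound_of_K_ne_0 hκ.ne', sub_zero] using gronwall
    _ ≤ δ * Real.exp (κ * S) + ε / κ * Real.exp (κ * S) := by gcongr; linarith
    _ ≤ δ * Real.exp (κ * S) + ε / κ * Real.exp (κ * S)
        + (ε * Real.exp (κ * S) + δ / κ * Real.exp (κ * S)) :=
      le_add_of_nonneg_right (by positivity)
    _ = Real.exp (κ * S) * (1 + 1 / κ) * (δ + ε) := by ring

/-- `x` is an `ε`-approximate solution of `x' = T g(x)` on `[0, ∞)`; it abstracts from the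
particular perturbation in `x' = T g(x) + δ_ode` and is invariant under time shifts. -/
def IsApproxSolution (g : X → X) (T ε : ℝ) (x : ℝ → X) : Prop :=
  ∀ t ≥ 0, ∃ y, ‖y‖ ≤ ε ∧ HasDerivWithinAt x (T • g (x t) + y) (Ici 0) t

theorem IsApproxSolution.nonneg {g : X → X} {T ε : ℝ} {x : ℝ → X} (hx : IsApproxSolution g T ε x) :
    0 ≤ ε :=
  let ⟨y, hy, _⟩ := hx 0 le_rfl
  (norm_nonneg y).trans hy

theorem IsApproxSolution.mono {g : X → X} {T ε ε' : ℝ} {x : ℝ → X} (hx : IsApproxSolution g T ε x)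
    (h : ε ≤ ε') : IsApproxSolution g T ε' x := fun t ht =>
  let ⟨y, hy, hd⟩ := hx t ht
  ⟨y, hy.trans h, hd⟩

theorem IsApproxSolution.shift {g : X → X} {T ε t : ℝ} {x : ℝ → X} (hx : IsApproxSolution g T ε x)
    (ht : 0 ≤ t) : IsApproxSolution g T ε fun s => x (t + s) := fun s hs => by
  obtain ⟨y, hy, hd⟩ := hx (t + s) (add_nonneg ht hs)
  have hadd : HasDerivWithinAt (fun s => t + s) 1 (Ici 0) s :=
    ((hasDerivAt_id s).const_add t).hasDerivWithinAt
  have hcomp := HasDerivWithinAt.scomp s hd hadd fun r hr => add_nonneg ht hr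
  rw [one_smul] at hcomp
  exact ⟨y, hy, hcomp⟩

end NormedSpace

section PhaseCoframe

variable {E X : Type*} [NormedAddCommGroup E] [NormedSpace ℝ E] [NormedAddCommGroup X]
  [NormedSpace ℝ X]

/-- `b` is a phase of the point `x` with respect to the coframe `Λ` along the parametrized manifold
`v`: the offset `x - v b` from the manifold is annihilated by `Λ b`. -/
def IsPhase (v : E → X) (Λ : E → X →L[ℝ] E) (x : X) (b : E) : Prop :=
  Λ b (x - v b) = 0

/-- The simplified Newton step for the phases of `x`, which are its fixed points. -/
def phaseMap (v : E → X) (Λ : E → X →L[ℝ] E) (x : X) (b : E) : E :=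
  b + Λ b (x - v b)

/-- A coframe `Λ` along a parametrized manifold `v`: the operators `Λ b` are left inverses of the
derivative of `v` at `b`, with one constant `K` for all Lipschitz and remainder estimates. -/
structure PhaseCoframe (v : E → X) (Λ : E → X →L[ℝ] E) (K : ℝ) : Prop where
  one_le : 1 ≤ K
  manifold_lip : ∀ b b', ‖v b' - v b‖ ≤ K * ‖b' - b‖
  norm_le : ∀ b, ‖Λ b‖ ≤ K
  tangent : ∀ b b', ‖Λ b (v b' - v b) - (b' - b)‖ ≤ K * ‖b' - b‖ ^ 2
  lip : ∀ b b', ‖Λ b' - Λ b‖ ≤ K * ‖b' - b‖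

variable {v : E → X} {Λ : E → X →L[ℝ] E} {K : ℝ}

theorem IsPhase.phaseMap_eq {x : X} {b : E} (hb : IsPhase v Λ x b) : phaseMap v Λ x b = b := by
  rw [phaseMap, show Λ b (x - v b) = 0 from hb, add_zero]

namespace PhaseCoframe

theorem pos (F : PhaseCoframe v Λ K) : 0 < K := zero_lt_one.trans_le F.one_le

theorem norm_apply_le (F : PhaseCoframe v Λ K) (b : E) (y : X) : ‖Λ b y‖ ≤ K * ‖y‖ :=
  (Λ b).le_of_opNorm_le (F.norm_le b) y

theorem norm_apply_sub_apply_le (F : PhaseCoframe v Λ K) (b b' : E) (y : X) :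
    ‖Λ b' y - Λ b y‖ ≤ K * ‖b' - b‖ * ‖y‖ :=
  (Λ b' - Λ b).le_of_opNorm_le (F.lip b b') y

theorem norm_sub_manifold_le (F : PhaseCoframe v Λ K) (x : X) (a b : E) :
    ‖x - v b‖ ≤ ‖x - v a‖ + K * ‖b - a‖ := by
  rw [← sub_sub_sub_cancel_right x (v b) (v a)]
  exact (norm_sub_le _ _).trans (add_le_add_right (F.manifold_lip a b) _)

theorem norm_phaseMap_sub_le (F : PhaseCoframe v Λ K) (x : X) (b b' : E) :
    ‖phaseMap v Λ x b' - phaseMap v Λ x b‖ ≤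
      K * ‖b' - b‖ * ‖x - v b'‖ + K * ‖b' - b‖ ^ 2 := by
  have split : phaseMap v Λ x b' - phaseMap v Λ x b =
      (Λ b' (x - v b') - Λ b (x - v b')) - (Λ b (v b' - v b) - (b' - b)) := by
    simp only [phaseMap, map_sub]
    abel
  rw [split]
  exact (norm_sub_le _ _).trans
    (add_le_add (F.norm_apply_sub_apply_le b b' _) (F.tangent b b'))

theorem norm_phaseMap_sub_le_half (F : PhaseCoframe v Λ K) {x : X} {a b b' : E}
    (hx : ‖x - v a‖ ≤ 1 / (16 * K ^ 3)) (hb : ‖b - a‖ ≤ 1 / (8 * K ^ 2))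
    (hb' : ‖b' - a‖ ≤ 1 / (8 * K ^ 2)) :
    ‖phaseMap v Λ x b' - phaseMap v Λ x b‖ ≤ 1 / 2 * ‖b' - b‖ := by
  have hK := F.pos
  have hinv : 1 / K ≤ 1 := (div_le_one hK).2 F.one_le
  have hinv_sq : (1 / K) ^ 2 ≤ 1 := pow_le_one₀ (by positivity) hinv
  have offset_small : K * ‖x - v b'‖ ≤ 3 / 16 :=
    calc K * ‖x - v b'‖ ≤ K * (1 / (16 * K ^ 3) + K * (1 / (8 * K ^ 2))) := by
          gcongr
          exact (F.norm_sub_manifold_le x a b').trans (by gcongr)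
      _ = (1 / K) ^ 2 / 16 + 1 / 8 := by field_simp
      _ ≤ 3 / 16 := by linarith
  have phases_close : K * ‖b' - b‖ ≤ 1 / 4 :=
    calc K * ‖b' - b‖ ≤ K * (1 / (8 * K ^ 2) + 1 / (8 * K ^ 2)) := by
          rw [← sub_sub_sub_cancel_right b' b a]
          gcongr
          exact (norm_sub_le _ _).trans (add_le_add hb' hb)
      _ = 1 / K / 4 := by field_simp; norm_num
      _ ≤ 1 / 4 := by linarith
  calc ‖phaseMap v Λ x b' - phaseMap v Λ x b‖
      ≤ (K * ‖x - v b'‖ + K * ‖b' - b‖) * ‖b' - b‖ :=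
        (F.norm_phaseMap_sub_le x b b').trans_eq (by ring)
    _ ≤ (3 / 16 + 1 / 4) * ‖b' - b‖ := by gcongr
    _ ≤ 1 / 2 * ‖b' - b‖ := by gcongr; norm_num

theorem exists_isPhase [CompleteSpace E] (F : PhaseCoframe v Λ K) {a : E} {x : X}
    (hx : ‖x - v a‖ ≤ 1 / (16 * K ^ 3)) :
    ∃ b, IsPhase v Λ x b ∧ ‖b - a‖ ≤ 2 * ‖Λ a (x - v a)‖ := by
  have hK := F.pos
  have hstep : phaseMap v Λ x a - a = Λ a (x - v a) := add_sub_cancel_left _ _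
  have hradius : K * (1 / (16 * K ^ 3)) = 1 / (8 * K ^ 2) / 2 := by field_simp; norm_num
  have contracts : ∀ b ∈ Metric.closedBall a (1 / (8 * K ^ 2)),
      ∀ b' ∈ Metric.closedBall a (1 / (8 * K ^ 2)),
      ‖phaseMap v Λ x b' - phaseMap v Λ x b‖ ≤ 1 / 2 * ‖b' - b‖ := fun b hb b' hb' =>
    F.norm_phaseMap_sub_le_half hx (mem_closedBall_iff_norm.1 hb) (mem_closedBall_iff_norm.1 hb')
  obtain ⟨b, hb, hfix⟩ := exists_fixedPoint_mem_closedBall (by positivity) contracts <| by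
    rw [hstep, ← hradius]
    exact (F.norm_apply_le a _).trans (by gcongr)
  have hba := contracts a (Metric.mem_closedBall_self (by positivity)) b hb
  rw [hfix] at hba
  refine ⟨b, by simpa [phaseMap, IsPhase] using hfix, ?_⟩
  have := norm_le_norm_add_norm_sub (Λ a (x - v a)) (b - a)
  rw [← hstep, sub_sub_sub_cancel_right, norm_sub_rev _ b, hstep] at this
  linarith

theorem two_mul_norm_apply_le (F : PhaseCoframe v Λ K) (a : E) (y : X) :
    2 * ‖Λ a y‖ ≤ 2 * K * ‖y‖ := by
  rw [mul_assoc]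
  gcongr
  exact F.norm_apply_le a y

theorem norm_sub_sub_apply_le (F : PhaseCoframe v Λ K) {a b : E} {x : X} (hb : IsPhase v Λ x b)
    (hba : ‖b - a‖ ≤ 2 * ‖Λ a (x - v a)‖) :
    ‖b - a - Λ a (x - v a)‖ ≤ 6 * K ^ 3 * ‖x - v a‖ ^ 2 := by
  have hK := F.pos
  have hab : ‖a - b‖ ≤ 2 * K * ‖x - v a‖ :=
    norm_sub_rev a b ▸ hba.trans (F.two_mul_norm_apply_le a _)
  have newton : b - a - Λ a (x - v a) = -(phaseMap v Λ x a - phaseMap v Λ x b) := by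
    rw [hb.phaseMap_eq, phaseMap]
    abel
  rw [newton, norm_neg]
  calc ‖phaseMap v Λ x a - phaseMap v Λ x b‖
      ≤ K * ‖a - b‖ * ‖x - v a‖ + K * ‖a - b‖ ^ 2 := F.norm_phaseMap_sub_le x b a
    _ ≤ K * (2 * K * ‖x - v a‖) * ‖x - v a‖ + K * (2 * K * ‖x - v a‖) ^ 2 := by gcongr
    _ = (2 * K ^ 2 + 4 * K ^ 3) * ‖x - v a‖ ^ 2 := by ring
    _ ≤ 6 * K ^ 3 * ‖x - v a‖ ^ 2 := by
      gcongr
      linarith [pow_le_pow_right₀ F.one_le (show 2 ≤ 3 by norm_num)]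

theorem norm_sub_phase_le (F : PhaseCoframe v Λ K) {a b : E} {x : X}
    (hba : ‖b - a‖ ≤ 2 * ‖Λ a (x - v a)‖) : ‖x - v b‖ ≤ (1 + 2 * K ^ 2) * ‖x - v a‖ := by
  have hK := F.pos
  calc ‖x - v b‖ ≤ ‖x - v a‖ + K * (2 * K * ‖x - v a‖) :=
        (F.norm_sub_manifold_le x a b).trans
          (by gcongr; exact hba.trans (F.two_mul_norm_apply_le a _))
    _ = (1 + 2 * K ^ 2) * ‖x - v a‖ := by ring

theorem mul_le_one_fourth (F : PhaseCoframe v Λ K) {u : ℝ} (hu : u ≤ 1 / (4 * K)) :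
    K * u ≤ 1 / 4 := by
  have hK := F.pos
  calc K * u ≤ K * (1 / (4 * K)) := by gcongr
    _ = 1 / 4 := by field_simp

theorem norm_phase_sub_le (F : PhaseCoframe v Λ K) {x x' : X} {b b' : E} (hb : IsPhase v Λ x b)
    (hb' : IsPhase v Λ x' b') (hbb : ‖b' - b‖ ≤ 1 / (4 * K)) (hx : ‖x - v b‖ ≤ 1 / (4 * K)) :
    ‖b' - b‖ ≤ 2 * K * ‖x' - x‖ := by
  have hx_small := F.mul_le_one_fourth hx
  have hb_small := F.mul_le_one_fourth hbb
  have split : b' - b = Λ b' (x' - x) - (phaseMap v Λ x b - phaseMap v Λ x b') := by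
    rw [hb.phaseMap_eq, phaseMap]
    have : Λ b' (x' - v b') = 0 := hb'
    rw [← sub_sub_sub_cancel_right x' x (v b'), map_sub, this]
    abel
  have : ‖b' - b‖ ≤ K * ‖x' - x‖ + ‖b' - b‖ / 2 := calc
    ‖b' - b‖ = ‖Λ b' (x' - x) - (phaseMap v Λ x b - phaseMap v Λ x b')‖ := by rw [← split]
    _ ≤ K * ‖x' - x‖ + (K * ‖b - b'‖ * ‖x - v b‖ + K * ‖b - b'‖ ^ 2) :=
      (norm_sub_le _ _).trans
        (add_le_add (F.norm_apply_le _ _) (F.norm_phaseMap_sub_le x b' b))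
    _ = K * ‖x' - x‖ + (K * ‖x - v b‖ + K * ‖b' - b‖) * ‖b' - b‖ := by
      rw [norm_sub_rev b b']; ring
    _ ≤ K * ‖x' - x‖ + (1 / 4 + 1 / 4) * ‖b' - b‖ := by gcongr
    _ = K * ‖x' - x‖ + ‖b' - b‖ / 2 := by ring
  linarith

theorem norm_sub_le_of_norm_sub_le (F : PhaseCoframe v Λ K) {b b' : E}
    (hbb : ‖b' - b‖ ≤ 1 / (4 * K)) : ‖b' - b‖ ≤ 2 * K * ‖v b' - v b‖ := by
  have hK := F.pos
  have hzero : ∀ c, IsPhase v Λ (v c) c := fun c => by simp [IsPhase]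
  exact F.norm_phase_sub_le (hzero b) (hzero b') hbb
    (by rw [sub_self, norm_zero]; positivity)

theorem eqOn_of_isPhase_of_continuousOn (F : PhaseCoframe v Λ K) {x : ℝ → X} {b c : ℝ → E}
    (hb : ContinuousOn b (Ici 0)) (hc : ContinuousOn c (Ici 0))
    (hxb : ∀ t ≥ 0, IsPhase v Λ (x t) (b t)) (hxc : ∀ t ≥ 0, IsPhase v Λ (x t) (c t))
    (near : ∀ t ≥ 0, ‖x t - v (b t)‖ ≤ 1 / (4 * K)) (h0 : ‖c 0 - b 0‖ ≤ 1 / (4 * K)) :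
    EqOn c b (Ici 0) := by
  have hK := F.pos
  have gap : ∀ t ≥ 0, ‖c t - b t‖ ≤ 1 / (4 * K) → ‖c t - b t‖ = 0 := fun t ht h => by
    have := F.norm_phase_sub_le (hxb t ht) (hxc t ht) h (near t ht)
    rw [sub_self, norm_zero, mul_zero] at this
    exact le_antisymm this (norm_nonneg _)
  intro t ht
  by_contra hne
  have hpos : 0 < ‖c t - b t‖ := norm_pos_iff.2 (sub_ne_zero.2 hne)
  have hcont : ContinuousOn (fun s => ‖c s - b s‖) (Icc 0 t) :=
    (hc.sub hb).norm.mono Icc_subset_Ici_self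
  have hmem : min ‖c t - b t‖ (1 / (4 * K)) ∈ Icc ‖c 0 - b 0‖ ‖c t - b t‖ := by
    rw [gap 0 le_rfl h0]
    exact ⟨by positivity, min_le_left _ _⟩
  obtain ⟨s, hs, hs'⟩ := intermediate_value_Icc (mem_Ici.1 ht) hcont hmem
  have hmin : 0 < min ‖c t - b t‖ (1 / (4 * K)) := by positivity
  exact hmin.ne' (hs'.symm.trans (gap s hs.1 (hs'.le.trans (min_le_right _ _))))

theorem norm_sub_le_of_forall_lt (F : PhaseCoframe v Λ K) {b c : ℝ → E} {η J : ℝ}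
    (hη : η ≤ 1 / (64 * K ^ 3)) (hJ : J ≤ 1 / (16 * K)) (near : ∀ t ≥ 0, ‖b t - c t‖ ≤ 2 * K * η)
    (jump : ∀ t ≥ 0, ∀ t' ≥ t, t' < t + 1 → ‖c t' - c t‖ ≤ (t' - t) + J) {t t' : ℝ} (ht : 0 ≤ t)
    (htt' : t ≤ t') (hlt : t' < t + 1 / (8 * K)) : ‖b t' - b t‖ ≤ 1 / (4 * K) := by
  have hK := F.pos
  have hη_jump : 2 * K * η ≤ 1 / (32 * K) :=
    calc 2 * K * η ≤ 2 * K * (1 / (64 * K ^ 3)) := by gcongr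
      _ = 1 / K * (1 / (32 * K)) := by field_simp; norm_num
      _ ≤ 1 / (32 * K) :=
        mul_le_of_le_one_left (by positivity) ((div_le_one hK).2 F.one_le)
  have hwindow : 1 / (8 * K) ≤ 1 := by
    rw [div_le_one (by positivity)]
    linarith [F.one_le]
  have hsum : 1 / (8 * K) + 1 / (16 * K) + 2 * (1 / (32 * K)) = 1 / (4 * K) := by
    field_simp; norm_num
  have through_c : b t' - b t = (b t' - c t') + (c t' - c t) - (b t - c t) := by abel
  have hnorm : ‖b t' - b t‖ ≤ ‖b t' - c t'‖ + ‖c t' - c t‖ + ‖b t - c t‖ := by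
    rw [through_c]
    exact (norm_sub_le _ _).trans (by gcongr; exact norm_add_le _ _)
  linarith [jump t ht t' htt' (by linarith), near t ht, near t' (ht.trans htt')]

theorem exists_locally_lipschitz_phases [CompleteSpace E] (F : PhaseCoframe v Λ K) {x : ℝ → X}
    {c : ℝ → E} {η J : ℝ} (hη : η ≤ 1 / (64 * K ^ 3)) (hJ : J ≤ 1 / (16 * K))
    (near : ∀ t ≥ 0, ‖x t - v (c t)‖ ≤ η)
    (jump : ∀ t ≥ 0, ∀ t' ≥ t, t' < t + 1 → ‖c t' - c t‖ ≤ (t' - t) + J) :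
    ∃ b : ℝ → E, (∀ t ≥ 0, IsPhase v Λ (x t) (b t) ∧ ‖b t - c t‖ ≤ 2 * K * η ∧
      ‖x t - v (b t)‖ ≤ (1 + 2 * K ^ 2) * η) ∧
      ∀ t ≥ 0, ∀ᶠ t' in 𝓝[Ici 0] t, ‖b t' - b t‖ ≤ 2 * K * ‖x t' - x t‖ := by
  have hK := F.pos
  have phase_exists : ∀ t ≥ 0, ∃ b, IsPhase v Λ (x t) b ∧
      ‖b - c t‖ ≤ 2 * ‖Λ (c t) (x t - v (c t))‖ := fun t ht =>
    F.exists_isPhase ((near t ht).trans (hη.trans (by gcongr; norm_num)))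
  choose! b hb hbc using phase_exists
  have hbc' : ∀ t ≥ 0, ‖b t - c t‖ ≤ 2 * K * η := fun t ht =>
    (hbc t ht).trans ((F.two_mul_norm_apply_le _ _).trans (by gcongr; exact near t ht))
  have hxb : ∀ t ≥ 0, ‖x t - v (b t)‖ ≤ (1 + 2 * K ^ 2) * η := fun t ht =>
    (F.norm_sub_phase_le (hbc t ht)).trans (by gcongr; exact near t ht)
  refine ⟨b, fun t ht => ⟨hb t ht, hbc' t ht, hxb t ht⟩, fun t ht => ?_⟩
  have hη_near : (1 + 2 * K ^ 2) * η ≤ 1 / (4 * K) :=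
    calc (1 + 2 * K ^ 2) * η ≤ (1 * K ^ 2 + 2 * K ^ 2) * (1 / (64 * K ^ 3)) := by
          have hη₀ : 0 ≤ η := (norm_nonneg _).trans (near t ht)
          gcongr
          linarith [one_le_pow₀ F.one_le (n := 2)]
      _ = 3 / 16 * (1 / (4 * K)) := by field_simp; norm_num
      _ ≤ 1 / (4 * K) := mul_le_of_le_one_left (by positivity) (by norm_num)
  have heventually : ∀ᶠ t' in 𝓝[Ici 0] t,
      t' ∈ Ici (0 : ℝ) ∩ Ioo (t - 1 / (8 * K)) (t + 1 / (8 * K)) :=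
    inter_mem self_mem_nhdsWithin (mem_nhdsWithin_of_mem_nhds
      (Ioo_mem_nhds (sub_lt_self t (by positivity)) (lt_add_of_pos_right t (by positivity))))
  filter_upwards [heventually] with t' ht'
  refine F.norm_phase_sub_le (hb t ht) (hb t' ht'.1) ?_ ((hxb t ht).trans hη_near)
  rcases le_total t t' with h | h
  · exact F.norm_sub_le_of_forall_lt hη hJ hbc' jump ht h ht'.2.2
  · exact norm_sub_rev (b t) _ ▸
      F.norm_sub_le_of_forall_lt hη hJ hbc' jump ht'.1 h (sub_lt_iff_lt_add.1 ht'.2.1)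

theorem norm_fderiv_apply_le (F : PhaseCoframe v Λ K) {b : E} {y : X} {D : E →L[ℝ] E}
    (hD : HasFDerivAt (fun b' => Λ b' y) D b) : ‖D‖ ≤ K * ‖y‖ := by
  have hK := F.pos
  refine hD.le_of_lip' (by positivity) (Eventually.of_forall fun b' => ?_)
  exact (F.norm_apply_sub_apply_le b b' y).trans_eq (mul_right_comm _ _ _)

theorem sub_apply_eq_of_isPhase {x x' : X} {b b' : E} (hb : IsPhase v Λ x b)
    (hb' : IsPhase v Λ x' b') (w : X) (D : E →L[ℝ] E) (r : ℝ) :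
    (b' - D b') - (b - D b) - r • Λ b w =
      (Λ b' (x - v b) - Λ b (x - v b) - D (b' - b)) + (Λ b' (x' - x) - Λ b (x' - x))
        + (Λ b' (v b - v b') - (b - b')) + Λ b (x' - x - r • w) := by
  have hb : Λ b (x - v b) = 0 := hb
  have hb' : Λ b' (x' - x) + Λ b' (x - v b) + Λ b' (v b - v b') = 0 := by
    rw [← map_add, ← map_add, sub_add_sub_cancel, sub_add_sub_cancel]
    exact hb'
  rw [hb, map_sub (Λ b) _ (r • w), map_smul, map_sub D]
  linear_combination (norm := module) -hb'

theorem hasDerivWithinAt_phase_sub_apply (F : PhaseCoframe v Λ K) {s : Set ℝ} {x : ℝ → X}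
    {b : ℝ → E} {t : ℝ} {w : X} {D : E →L[ℝ] E} (ht : t ∈ s)
    (hb : ∀ t ∈ s, IsPhase v Λ (x t) (b t))
    (hlip : ∀ᶠ t' in 𝓝[s] t, ‖b t' - b t‖ ≤ 2 * K * ‖x t' - x t‖)
    (hx : HasDerivWithinAt x w s t)
    (hD : HasFDerivAt (fun b' => Λ b' (x t - v (b t))) D (b t)) :
    HasDerivWithinAt (fun t' => b t' - D (b t')) (Λ (b t) w) s t := by
  have hx_zero : Tendsto (fun t' => ‖x t' - x t‖) (𝓝[s] t) (𝓝 0) :=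
    tendsto_iff_norm_sub_tendsto_zero.1 hx.continuousWithinAt
  have hb_zero : Tendsto (fun t' => ‖b t' - b t‖) (𝓝[s] t) (𝓝 0) :=
    squeeze_zero' (Eventually.of_forall fun _ => norm_nonneg _) hlip
      (by simpa using hx_zero.const_mul (2 * K))
  have hb_isBigO : (fun t' => b t' - b t) =O[𝓝[s] t] fun t' => t' - t :=
    (Asymptotics.IsBigO.of_bound (2 * K) hlip).trans hx.hasFDerivWithinAt.isBigO_sub
  have isLittleO_of_le : ∀ (w : ℝ → E) (q : ℝ → ℝ), (∀ t', ‖w t'‖ ≤ K * ‖b t' - b t‖ * q t') →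
      Tendsto q (𝓝[s] t) (𝓝 0) → w =o[𝓝[s] t] fun t' => t' - t := fun w q hw hq => by
    have hmul : (fun t' => ‖b t' - b t‖ * q t') =o[𝓝[s] t] fun t' => (t' - t) * (1 : ℝ) :=
      hb_isBigO.norm_left.mul_isLittleO ((Asymptotics.isLittleO_one_iff ℝ).2 hq)
    simp only [mul_one] at hmul
    refine (Asymptotics.IsBigO.of_bound K (Eventually.of_forall fun t' => ?_)).trans_isLittleO hmul
    calc ‖w t'‖ ≤ K * (‖b t' - b t‖ * q t') := (hw t').trans_eq (mul_assoc _ _ _)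
      _ ≤ K * ‖‖b t' - b t‖ * q t'‖ := mul_le_mul_of_nonneg_left (le_abs_self _) F.pos.le
  have coframe_change : (fun t' => Λ (b t') (x t - v (b t)) - Λ (b t) (x t - v (b t))
      - D (b t' - b t)) =o[𝓝[s] t] fun t' => t' - t :=
    (hD.isLittleO.comp_tendsto (tendsto_iff_norm_sub_tendsto_zero.2 hb_zero)).trans_isBigO hb_isBigO
  have cross_term := isLittleO_of_le (fun t' => Λ (b t') (x t' - x t) - Λ (b t) (x t' - x t))
    (fun t' => ‖x t' - x t‖) (fun t' => F.norm_apply_sub_apply_le _ _ _) hx_zero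
  have tangent_defect := isLittleO_of_le (fun t' => Λ (b t') (v (b t) - v (b t')) - (b t - b t'))
    (fun t' => ‖b t' - b t‖) (fun t' => by
      rw [mul_assoc, ← pow_two, norm_sub_rev (b t')]
      exact F.tangent (b t') (b t)) hb_zero
  have velocity_defect : (fun t' => Λ (b t) (x t' - x t - (t' - t) • w)) =o[𝓝[s] t]
      fun t' => t' - t :=
    ((Λ (b t)).isBigO_comp _ _).trans_isLittleO (hasDerivWithinAt_iff_isLittleO.1 hx)
  rw [hasDerivWithinAt_iff_isLittleO]
  refine (((coframe_change.add cross_term).add tangent_defect).add velocity_defect).congr'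
    ?_ EventuallyEq.rfl
  filter_upwards [self_mem_nhdsWithin] with t' ht'
  exact (sub_apply_eq_of_isPhase (hb t ht) (hb t' ht') w D (t' - t)).symm

end PhaseCoframe

end PhaseCoframe

/-- The phase coframe of a torus of solutions of `x' = T g(x)`, the second coordinate of the phase
being time: `A` is the linearization of `g` along the torus, and the kernels of the coframe consist
of the initial values of solutions of the variational equation that decay with time constant
`τtr`. -/
structure AttractingTorus {X : Type*} [NormedAddCommGroup X] [NormedSpace ℝ X] (g : X → X)
    (T τtr : ℝ) (v : ℝ × ℝ → X) (A : ℝ × ℝ → X →L[ℝ] X) (Λ : ℝ × ℝ → X →L[ℝ] ℝ × ℝ) (K : ℝ) : Prop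
    extends PhaseCoframe v Λ K where
  T_pos : 0 < T
  τ_pos : 0 < τtr
  ode : ∀ (b : ℝ × ℝ) (s : ℝ),
    HasDerivAt (fun s : ℝ => v (b + (0, s))) (T • g (v (b + (0, s)))) s
  coframe_field : ∀ b, T • Λ b (g (v b)) = (0, 1)
  g_lip : ∀ x y, ‖g x - g y‖ ≤ K * ‖x - y‖
  g_taylor : ∀ b x, ‖g x - g (v b) - A b (x - v b)‖ ≤ K * ‖x - v b‖ ^ 2
  A_norm : ∀ b, ‖A b‖ ≤ K
  transversal : ∀ b y₀, Λ b y₀ = 0 → ∃ y : ℝ → X, y 0 = y₀ ∧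
    (∀ s : ℝ, HasDerivAt y (T • A (b + (0, s)) (y s)) s) ∧
    ∀ s ≥ 0, Λ (b + (0, s)) (y s) = 0 ∧ ‖y s‖ ≤ K * Real.exp (-s / τtr) * ‖y₀‖
  differentiable : ∀ b y₀, Λ b y₀ = 0 → ∃ D : ℝ × ℝ →L[ℝ] ℝ × ℝ,
    HasFDerivAt (fun b' => Λ b' y₀) D b ∧ D (0, 1) = -(T • Λ b (A b y₀))

namespace AttractingTorus

section

variable {X : Type*} [NormedAddCommGroup X] [NormedSpace ℝ X] {g : X → X} {T τtr : ℝ}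
  {v : ℝ × ℝ → X} {A : ℝ × ℝ → X →L[ℝ] X} {Λ : ℝ × ℝ → X →L[ℝ] ℝ × ℝ} {K : ℝ}

theorem norm_smul_le_mul (F : AttractingTorus g T τtr v A Λ K) {y : X} {c : ℝ}
    (hy : ‖y‖ ≤ K * c) : ‖T • y‖ ≤ T * K * c := by
  rw [norm_smul, Real.norm_of_nonneg F.T_pos.le, mul_assoc]
  exact mul_le_mul_of_nonneg_left hy F.T_pos.le

theorem hasDerivWithinAt_sub_manifold (F : AttractingTorus g T τtr v A Λ K) {x : ℝ → X}
    {s : ℝ} {y : X} (hx : HasDerivWithinAt x (T • g (x s) + y) (Ici 0) s) (a : ℝ × ℝ) :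
    HasDerivWithinAt (fun s => x s - v (a + (0, s)))
      (T • (g (x s) - g (v (a + (0, s)))) + y) (Ici 0) s := by
  rw [smul_sub, sub_add_eq_add_sub]
  exact hx.sub (F.ode a s).hasDerivWithinAt

theorem exists_window_bound (F : AttractingTorus g T τtr v A Λ K) (S : ℝ) :
    ∃ G > 0, ∀ (x : ℝ → X) (ε : ℝ) (a : ℝ × ℝ), IsApproxSolution g T ε x → ∀ s ∈ Icc 0 S,
      ‖x s - v (a + (0, s))‖ ≤ G * (‖x 0 - v a‖ + ε) := by
  have hκ : 0 < T * K := mul_pos F.T_pos F.pos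
  refine ⟨Real.exp (T * K * S) * (1 + 1 / (T * K)), by positivity, fun x ε a hx => ?_⟩
  have hε := hx.nonneg
  choose! y hy hd using hx
  refine norm_le_exp_mul_of_norm_deriv_le hκ (norm_nonneg _) hε
    (fun s hs => F.hasDerivWithinAt_sub_manifold (hd s hs) a)
    (by rw [Prod.mk_zero_zero, add_zero]) fun s hs => ?_
  exact (norm_add_le _ _).trans (add_le_add (F.norm_smul_le_mul (F.g_lip _ _)) (hy s hs.1))

theorem exists_linearization_bound (F : AttractingTorus g T τtr v A Λ K) (S : ℝ) :
    ∃ W > 0, ∀ (x : ℝ → X) (ε : ℝ) (a : ℝ × ℝ) (y : ℝ → X), IsApproxSolution g T ε x → ε ≤ 1 →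
      y 0 = x 0 - v a → (∀ s, HasDerivAt y (T • A (a + (0, s)) (y s)) s) → ∀ s ∈ Icc 0 S,
      ‖x s - v (a + (0, s)) - y s‖ ≤ W * (ε + ‖x 0 - v a‖ ^ 2) := by
  have hκ : 0 < T * K := mul_pos F.T_pos F.pos
  obtain ⟨G, hG, window⟩ := F.exists_window_bound S
  refine ⟨Real.exp (T * K * S) * (1 + 1 / (T * K)) * (T * K * (2 * G ^ 2) + 1), by positivity,
    fun x ε a y hx hε₁ hy₀ hy s hs => ?_⟩
  have hε := hx.nonneg
  have window_sq : ∀ s ∈ Icc 0 S,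
      ‖x s - v (a + (0, s))‖ ^ 2 ≤ 2 * G ^ 2 * (ε + ‖x 0 - v a‖ ^ 2) := fun s hs =>
    calc ‖x s - v (a + (0, s))‖ ^ 2 ≤ (G * (‖x 0 - v a‖ + ε)) ^ 2 := by
          gcongr; exact window x ε a hx s hs
      _ = G ^ 2 * (‖x 0 - v a‖ + ε) ^ 2 := mul_pow _ _ _
      _ ≤ G ^ 2 * (2 * (‖x 0 - v a‖ ^ 2 + ε ^ 2)) := by gcongr; exact add_sq_le
      _ ≤ G ^ 2 * (2 * (‖x 0 - v a‖ ^ 2 + ε)) := by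
          gcongr; exact pow_le_of_le_one hε hε₁ two_ne_zero
      _ = 2 * G ^ 2 * (ε + ‖x 0 - v a‖ ^ 2) := by ring
  choose! δ hδ hd using hx
  have split : ∀ s, T • (g (x s) - g (v (a + (0, s)))) + δ s - T • A (a + (0, s)) (y s) =
      T • A (a + (0, s)) (x s - v (a + (0, s)) - y s) +
        (T • (g (x s) - g (v (a + (0, s))) - A (a + (0, s)) (x s - v (a + (0, s)))) + δ s) :=
    fun s => by rw [map_sub _ _ (y s)]; module
  have gronwall := norm_le_exp_mul_of_norm_deriv_le hκ le_rfl
    (show 0 ≤ T * K * (2 * G ^ 2 * (ε + ‖x 0 - v a‖ ^ 2)) + ε by positivity)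
    (fun s hs => (F.hasDerivWithinAt_sub_manifold (hd s hs) a).sub (hy s).hasDerivWithinAt)
    (by rw [Pi.sub_apply, Prod.mk_zero_zero, add_zero, hy₀, sub_self, norm_zero])
    (fun s hs => ?_) s hs
  · refine gronwall.trans ?_
    rw [zero_add, mul_assoc _ (T * K * (2 * G ^ 2) + 1)]
    gcongr
    nlinarith [sq_nonneg ‖x 0 - v a‖]
  · rw [split]
    refine (norm_add_le _ _).trans (add_le_add
      (F.norm_smul_le_mul ((A _).le_of_opNorm_le (F.A_norm _) _))
      ((norm_add_le _ _).trans (add_le_add (F.norm_smul_le_mul ?_) (hδ s hs.1))))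
    exact (F.g_taylor _ _).trans
      (mul_le_mul_of_nonneg_left (window_sq s ⟨hs.1, hs.2.le⟩) F.pos.le)

theorem exists_rebased_phase (F : AttractingTorus g T τtr v A Λ K) {S : ℝ} (hS : 0 ≤ S) :
    ∃ h > 0, ∃ W > 0, ∀ (x : ℝ → X) (ε : ℝ) (a : ℝ × ℝ), IsApproxSolution g T ε x → ε ≤ 1 →
      IsPhase v Λ (x 0) a → ‖x 0 - v a‖ + ε ≤ h → ∃ a', IsPhase v Λ (x S) a' ∧
        ‖x S - v a'‖ ≤ (1 + 2 * K ^ 2) *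
          (K * Real.exp (-S / τtr) * ‖x 0 - v a‖ + W * (ε + ‖x 0 - v a‖ ^ 2)) ∧
        ‖a' - (a + (0, S))‖ ≤ 2 * K * (W * (ε + ‖x 0 - v a‖ ^ 2)) := by
  have hK := F.pos
  obtain ⟨G, hG, window⟩ := F.exists_window_bound S
  obtain ⟨W, hW, linearization⟩ := F.exists_linearization_bound S
  refine ⟨1 / (16 * K ^ 3) / G, by positivity, W, hW, fun x ε a hx hε₁ ha hz => ?_⟩
  have hSS : S ∈ Icc 0 S := ⟨hS, le_rfl⟩
  obtain ⟨y, hy₀, hy, hy_decay⟩ := F.transversal a _ ha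
  obtain ⟨hy_phase, hy_norm⟩ := hy_decay S hS
  have hxy := linearization x ε a y hx hε₁ hy₀ hy S hSS
  obtain ⟨a', ha', ha'_near⟩ := F.exists_isPhase (a := a + (0, S)) (x := x S) <|
    (window x ε a hx S hSS).trans ((le_div_iff₀' hG).1 hz)
  refine ⟨a', ha', (F.norm_sub_phase_le ha'_near).trans ?_, ha'_near.trans ?_⟩
  · gcongr
    rw [← add_sub_cancel (y S) (x S - v (a + (0, S)))]
    exact (norm_add_le _ _).trans (add_le_add hy_norm hxy)
  · rw [← sub_zero (Λ _ _), ← hy_phase, ← map_sub]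
    exact (F.two_mul_norm_apply_le _ _).trans (by gcongr)

/-- The decay over the time `m` is used for one half of its exponent only, so that the other half
absorbs all constants. -/
theorem exists_contracting_step (F : AttractingTorus g T τtr v A Λ K) :
    ∃ m : ℕ, 0 < m ∧ ∃ d > 0, ∃ C > 0, ∀ (x : ℝ → X) (ε : ℝ) (a : ℝ × ℝ),
      IsApproxSolution g T ε x → ε ≤ d → IsPhase v Λ (x 0) a → ‖x 0 - v a‖ ≤ d →
      ∃ a', IsPhase v Λ (x m) a' ∧
        ‖x m - v a'‖ ≤ Real.exp (-m / (2 * τtr)) * ‖x 0 - v a‖ + C * ε ∧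
        ‖a' - (a + (0, (m : ℝ)))‖ ≤ C * (ε + ‖x 0 - v a‖ ^ 2) := by
  have hK := F.pos
  set K₁ := 1 + 2 * K ^ 2
  obtain ⟨m, hm, absorb⟩ :=
    exists_nat_mul_exp_neg_div_le_one (2 * K₁ * K) (mul_pos two_pos F.τ_pos)
  set θ := Real.exp (-m / (2 * τtr)) with hθ
  have hθ_pos : 0 < θ := Real.exp_pos _
  have hθ_sq : Real.exp (-(m : ℝ) / τtr) = θ ^ 2 := by
    rw [hθ, ← Real.exp_nat_mul]
    congr 1
    push_cast
    ring
  obtain ⟨h, hh, W, hW, rebased⟩ := F.exists_rebased_phase m.cast_nonneg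
  obtain ⟨d, hd, hd₁, hd_h, hWd⟩ := exists_pos_le_one_mul_le hh (half_pos hθ_pos) 2 (K₁ * W)
  refine ⟨m, hm, d, hd, (K₁ + 2 * K) * W, by positivity, fun x ε a hx hεd ha had => ?_⟩
  have hε := hx.nonneg
  obtain ⟨a', ha', ha'_norm, ha'_near⟩ := rebased x ε a hx (hεd.trans hd₁) ha (by linarith)
  refine ⟨a', ha', ha'_norm.trans ?_, ha'_near.trans ?_⟩
  · have quadratic : K₁ * W * ‖x 0 - v a‖ ^ 2 ≤ θ / 2 * ‖x 0 - v a‖ :=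
      calc K₁ * W * ‖x 0 - v a‖ ^ 2 ≤ K₁ * W * (d * ‖x 0 - v a‖) := by
            rw [pow_two]; gcongr
        _ = K₁ * W * d * ‖x 0 - v a‖ := (mul_assoc _ _ _).symm
        _ ≤ θ / 2 * ‖x 0 - v a‖ := by gcongr
    rw [hθ_sq]
    calc K₁ * (K * θ ^ 2 * ‖x 0 - v a‖ + W * (ε + ‖x 0 - v a‖ ^ 2))
        = 2 * K₁ * K * θ * (θ / 2 * ‖x 0 - v a‖) + K₁ * W * ‖x 0 - v a‖ ^ 2 + K₁ * W * ε := by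
          ring
      _ ≤ 1 * (θ / 2 * ‖x 0 - v a‖) + θ / 2 * ‖x 0 - v a‖ + (K₁ + 2 * K) * W * ε := by
          gcongr; linarith
      _ = θ * ‖x 0 - v a‖ + (K₁ + 2 * K) * W * ε := by ring
  · rw [← mul_assoc]
    gcongr
    linarith [show 0 < K₁ by positivity]

end

end AttractingTorus

/-- The sequence `p` of phases at the times `k * m`, continued in between by the motion with unit
speed on the torus. -/
noncomputable def interpolatedPhase (m : ℕ) (p : ℕ → ℝ × ℝ) (t : ℝ) : ℝ × ℝ :=
  p ⌊t / m⌋₊ + (0, t - ⌊t / m⌋₊ * m)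

theorem interpolatedPhase_zero (m : ℕ) (p : ℕ → ℝ × ℝ) : interpolatedPhase m p 0 = p 0 := by
  simp [interpolatedPhase, Prod.mk_zero_zero]

theorem interpolatedPhase_sub_add (m : ℕ) (p : ℕ → ℝ × ℝ) (b : ℝ × ℝ) (t : ℝ) :
    interpolatedPhase m p t - (b + (0, t)) =
      p ⌊t / m⌋₊ - (b + ⌊t / m⌋₊ • ((0 : ℝ), (m : ℝ))) := by
  ext <;> simp [interpolatedPhase]
  ring

theorem norm_interpolatedPhase_sub_le {m : ℕ} (hm : 0 < m) {p : ℕ → ℝ × ℝ} {J : ℝ}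
    (hp : ∀ k, ‖p (k + 1) - (p k + (0, (m : ℝ)))‖ ≤ J) {t t' : ℝ} (ht : 0 ≤ t) (htt' : t ≤ t')
    (hlt : t' < t + 1) :
    ‖interpolatedPhase m p t' - interpolatedPhase m p t‖ ≤ (t' - t) + J := by
  have hm_one : (1 : ℝ) ≤ m := by exact_mod_cast hm
  have hm_pos : (0 : ℝ) < m := zero_lt_one.trans_le hm_one
  have drift : ‖((0 : ℝ), t' - t)‖ = t' - t := by
    rw [Prod.norm_mk, norm_zero, Real.norm_of_nonneg (sub_nonneg.2 htt'),
      max_eq_right (sub_nonneg.2 htt')]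
  have floor_le : ⌊t / m⌋₊ ≤ ⌊t' / m⌋₊ := Nat.floor_mono (by gcongr)
  have floor_lt : ⌊t' / m⌋₊ < ⌊t / m⌋₊ + 2 := by
    rw [Nat.floor_lt (div_nonneg (ht.trans htt') hm_pos.le), div_lt_iff₀ hm_pos]
    push_cast
    linarith [lt_floor_div_mul_add t hm_pos]
  rcases (show ⌊t' / m⌋₊ = ⌊t / m⌋₊ ∨ ⌊t' / m⌋₊ = ⌊t / m⌋₊ + 1 by omega) with same | next
  · have : interpolatedPhase m p t' - interpolatedPhase m p t = (0, t' - t) := by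
      simp only [interpolatedPhase, same]
      ext <;> simp
    rw [this, drift]
    exact le_add_of_nonneg_right ((norm_nonneg _).trans (hp 0))
  · have : interpolatedPhase m p t' - interpolatedPhase m p t =
        (0, t' - t) + (p (⌊t / m⌋₊ + 1) - (p ⌊t / m⌋₊ + (0, (m : ℝ)))) := by
      simp only [interpolatedPhase, next]
      ext <;> simp
      ring
    rw [this]
    exact (norm_add_le _ _).trans (add_le_add drift.le (hp _))

/-- `x` solves the forced equation `x' = T g(x) + dode` on `[0, ∞)`. -/
def IsForcedSolution {X : Type*} [NormedAddCommGroup X] [NormedSpace ℝ X] (g : X → X) (T : ℝ)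
    (dode x : ℝ → X) : Prop :=
  ∀ τ ∈ Ici (0 : ℝ), HasDerivWithinAt x (T • g (x τ) + dode τ) (Ici 0) τ

theorem IsForcedSolution.isApproxSolution {X : Type*} [NormedAddCommGroup X] [NormedSpace ℝ X]
    {g : X → X} {T ε : ℝ} {dode x : ℝ → X} (hx : IsForcedSolution g T dode x)
    (hdode : ∀ τ ≥ 0, ‖dode τ‖ ≤ ε) : IsApproxSolution g T ε x :=
  fun t ht => ⟨dode t, hdode t ht, hx t ht⟩

namespace AttractingTorus

section

variable {X : Type*} [NormedAddCommGroup X] [NormedSpace ℝ X] {g : X → X} {T τtr : ℝ}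
  {v : ℝ × ℝ → X} {A : ℝ × ℝ → X →L[ℝ] X} {Λ : ℝ × ℝ → X →L[ℝ] ℝ × ℝ} {K : ℝ}

theorem exists_phase_sequence (F : AttractingTorus g T τtr v A Λ K) :
    ∃ m : ℕ, 0 < m ∧ ∃ d > 0, d ≤ 1 ∧ ∃ C > 0, ∀ (x : ℝ → X) (ε : ℝ) (a : ℝ × ℝ),
      IsApproxSolution g T ε x → ε ≤ d → IsPhase v Λ (x 0) a → ‖x 0 - v a‖ ≤ d →
      ∃ p : ℕ → ℝ × ℝ, p 0 = a ∧ ∀ k : ℕ,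
        ‖x (k * m) - v (p k)‖ ≤ Real.exp (-m / (2 * τtr)) ^ k * ‖x 0 - v a‖ + C * ε ∧
        ‖p (k + 1) - (p k + (0, (m : ℝ)))‖ ≤
          C * (ε + (Real.exp (-m / (2 * τtr)) ^ k * ‖x 0 - v a‖) ^ 2) := by
  obtain ⟨m, hm, d₀, hd₀, C₀, hC₀, contracting⟩ := F.exists_contracting_step
  set θ := Real.exp (-m / (2 * τtr))
  have hθ_pos : 0 < θ := Real.exp_pos _
  have hθ_lt : θ < 1 :=
    exp_neg_div_lt_one (Nat.cast_pos.2 hm) (mul_pos two_pos F.τ_pos)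
  set B := C₀ / (1 - θ) with hB
  have hB_pos : 0 < B := div_pos hC₀ (sub_pos.2 hθ_lt)
  obtain ⟨d, hd, hd_one, hd_half, hd_B⟩ :=
    exists_pos_le_one_mul_le (half_pos hd₀) (half_pos hd₀) 1 B
  refine ⟨m, hm, d, hd, hd_one, B + C₀ * (2 + 2 * B ^ 2), by positivity,
    fun x ε a hx hεd ha had => ?_⟩
  have hε := hx.nonneg
  have hBε : C₀ * ε / (1 - θ) = B * ε := by rw [hB]; ring
  obtain ⟨p, hp₀, hp⟩ := exists_seq_of_contracting_step (c := C₀ * ε) (d := d₀) (b₀ := a)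
    (P := fun k b => IsPhase v Λ (x (k * m)) b) (u := fun k b => ‖x (k * m) - v b‖)
    (R := fun k b b' => ‖b' - (b + (0, (m : ℝ)))‖ ≤ C₀ * (ε + ‖x (k * m) - v b‖ ^ 2))
    hθ_pos.le hθ_lt (by positivity) (fun k b hb hbd => by
      obtain ⟨b', hb', hstep, hnear⟩ := contracting (fun s => x (k * m + s)) ε b
        (hx.shift (by positivity)) (by linarith) (by simpa using hb) (by simpa using hbd)
      exact ⟨b', by simpa [add_one_mul] using hb', by simpa [add_one_mul] using hstep,
        by simpa using hnear⟩)
    (by simpa using ha) (norm_nonneg _) (by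
      rw [hBε, Nat.cast_zero, zero_mul]
      linarith [mul_le_mul_of_nonneg_left hεd hB_pos.le])
  simp only [Nat.cast_zero, zero_mul, hBε] at hp
  refine ⟨p, hp₀, fun k => ⟨(hp k).2.1.trans ?_, (hp k).2.2.trans ?_⟩⟩
  · gcongr
    exact le_add_of_nonneg_right (by positivity)
  · have hε_sq : ε ^ 2 ≤ ε := pow_le_of_le_one hε (hεd.trans hd_one) two_ne_zero
    calc C₀ * (ε + ‖x (k * m) - v (p k)‖ ^ 2)
        ≤ C₀ * (ε + (θ ^ k * ‖x 0 - v a‖ + B * ε) ^ 2) := by gcongr; exact (hp k).2.1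
      _ ≤ C₀ * (ε + 2 * ((θ ^ k * ‖x 0 - v a‖) ^ 2 + (B * ε) ^ 2)) := by gcongr; exact add_sq_le
      _ = C₀ * (ε + 2 * (θ ^ k * ‖x 0 - v a‖) ^ 2 + 2 * B ^ 2 * ε ^ 2) := by ring
      _ ≤ C₀ * (ε + 2 * (θ ^ k * ‖x 0 - v a‖) ^ 2 + 2 * B ^ 2 * ε)
          + (B * ε + C₀ * ε + (B + 2 * C₀ * B ^ 2) * (θ ^ k * ‖x 0 - v a‖) ^ 2) := by
        refine le_add_of_le_of_nonneg ?_ (by positivity)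
        gcongr
      _ = _ := by ring

theorem exists_interpolatedPhase_bound (F : AttractingTorus g T τtr v A Λ K) {m : ℕ}
    (hm : 0 < m) : ∃ G > 0, ∀ (x : ℝ → X) (ε : ℝ) (p : ℕ → ℝ × ℝ), IsApproxSolution g T ε x →
      ∀ t ≥ 0, ‖x t - v (interpolatedPhase m p t)‖ ≤
        G * (‖x (⌊t / m⌋₊ * m) - v (p ⌊t / m⌋₊)‖ + ε) := by
  have hm_pos : (0 : ℝ) < m := Nat.cast_pos.2 hm
  obtain ⟨G, hG, window⟩ := F.exists_window_bound m
  refine ⟨G, hG, fun x ε p hx t ht => ?_⟩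
  have hwindow := window (fun s => x (⌊t / m⌋₊ * m + s)) ε (p ⌊t / m⌋₊)
    (hx.shift (by positivity)) (t - ⌊t / m⌋₊ * m)
    ⟨sub_nonneg.2 (floor_div_mul_le ht hm_pos),
      (sub_lt_iff_lt_add'.2 (lt_floor_div_mul_add t hm_pos)).le⟩
  simpa only [add_sub_cancel, add_zero, interpolatedPhase] using hwindow

theorem exists_limit_phase_of_isPhase (F : AttractingTorus g T τtr v A Λ K) :
    ∃ m : ℕ, 0 < m ∧ ∃ d > 0, ∃ S > 0, ∀ (x : ℝ → X) (a : ℝ × ℝ), IsApproxSolution g T 0 x →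
      IsPhase v Λ (x 0) a → ‖x 0 - v a‖ ≤ d → ∃ (p : ℕ → ℝ × ℝ) (b : ℝ × ℝ),
        ‖b - a‖ ≤ S * ‖x 0 - v a‖ ^ 2 ∧ ∀ k : ℕ,
        ‖x (k * m) - v (p k)‖ ≤ Real.exp (-m / (2 * τtr)) ^ k * ‖x 0 - v a‖ ∧
        ‖p k - (b + k • (0, (m : ℝ)))‖ ≤
          S * (Real.exp (-m / (2 * τtr)) ^ k * ‖x 0 - v a‖) := by
  obtain ⟨m, hm, d, hd, hd_one, C, hC, sequence⟩ := F.exists_phase_sequence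
  set θ := Real.exp (-m / (2 * τtr))
  have hθ_pos : 0 < θ := Real.exp_pos _
  have hθ_lt : θ < 1 := exp_neg_div_lt_one (Nat.cast_pos.2 hm) (mul_pos two_pos F.τ_pos)
  have hθ_sq : θ ^ 2 < 1 := pow_lt_one₀ hθ_pos.le hθ_lt two_ne_zero
  set S := C / (1 - θ ^ 2) with hS
  refine ⟨m, hm, d, hd, S, div_pos hC (sub_pos.2 hθ_sq), fun x a hx ha had => ?_⟩
  set z := ‖x 0 - v a‖
  have hz_nonneg : 0 ≤ z := norm_nonneg _
  obtain ⟨p, hp₀, hp⟩ := sequence x 0 a hx hd.le ha had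
  simp only [mul_zero, add_zero, zero_add] at hp
  obtain ⟨b, hb⟩ := exists_geometric_approx_of_almost_translation hθ_sq (c := C * z ^ 2)
    (e := ((0 : ℝ), (m : ℝ))) fun k => (hp k).2.trans_eq (by ring)
  refine ⟨p, b, ?_, fun k => ⟨(hp k).1, ?_⟩⟩
  · have initial := hb 0
    rw [zero_smul, add_zero, pow_zero, hp₀, norm_sub_rev] at initial
    exact initial.trans_eq (by rw [hS]; ring)
  · calc ‖p k - (b + k • (0, (m : ℝ)))‖ ≤ S * (θ ^ k * z) ^ 2 :=
          (hb k).trans_eq (by rw [hS]; ring)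
      _ ≤ S * (θ ^ k * z) := by
        gcongr
        exact pow_le_of_le_one (by positivity) (mul_le_one₀ (pow_le_one₀ hθ_pos.le hθ_lt.le)
          hz_nonneg (had.trans hd_one)) two_ne_zero

theorem exists_asymptotic_phase_of_isPhase (F : AttractingTorus g T τtr v A Λ K) :
    ∃ d > 0, ∃ C > 0, ∀ (x : ℝ → X) (a : ℝ × ℝ), IsApproxSolution g T 0 x →
      IsPhase v Λ (x 0) a → ‖x 0 - v a‖ ≤ d → ∃ b, ‖b - a‖ ≤ C * ‖x 0 - v a‖ ^ 2 ∧
        ∀ t ≥ 0, ‖x t - v (b + (0, t))‖ ≤ C * Real.exp (-t / (2 * τtr)) * ‖x 0 - v a‖ := by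
  have hK := F.pos
  obtain ⟨m, hm, d, hd, S, hS, limit⟩ := F.exists_limit_phase_of_isPhase
  obtain ⟨G, hG, interpolated⟩ := F.exists_interpolatedPhase_bound hm
  set θ := Real.exp (-m / (2 * τtr))
  refine ⟨d, hd, S + (G + K * S) / θ, by positivity, fun x a hx ha had => ?_⟩
  set z := ‖x 0 - v a‖
  obtain ⟨p, b, hba, hp⟩ := limit x a hx ha had
  refine ⟨b, ?_, fun t ht => ?_⟩
  · exact hba.trans (by gcongr; exact le_add_of_nonneg_right (by positivity))
  · set k := ⌊t / m⌋₊
    have phase_error : ‖interpolatedPhase m p t - (b + (0, t))‖ ≤ S * (θ ^ k * z) := by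
      rw [interpolatedPhase_sub_add]
      exact (hp k).2
    calc ‖x t - v (b + (0, t))‖
        ≤ ‖x t - v (interpolatedPhase m p t)‖ + K * ‖b + (0, t) - interpolatedPhase m p t‖ :=
          F.norm_sub_manifold_le _ _ _
      _ ≤ G * (θ ^ k * z) + K * (S * (θ ^ k * z)) := by
        gcongr
        · exact (interpolated x 0 p hx t ht).trans (by rw [add_zero]; gcongr; exact (hp k).1)
        · rwa [norm_sub_rev]
      _ = (G + K * S) * θ ^ k * z := by ring
      _ ≤ (G + K * S) * (Real.exp (-t / (2 * τtr)) / θ) * z := by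
        gcongr
        exact exp_neg_div_pow_floor_le (Nat.cast_pos.2 hm) (mul_pos two_pos F.τ_pos)
      _ = (G + K * S) / θ * Real.exp (-t / (2 * τtr)) * z := by ring
      _ ≤ (S + (G + K * S) / θ) * Real.exp (-t / (2 * τtr)) * z := by
        gcongr
        exact le_add_of_nonneg_left hS.le

theorem exists_asymptotic_phase (F : AttractingTorus g T τtr v A Λ K) :
    ∃ d > 0, ∃ C ≥ 1, ∀ (x : ℝ → X) (a : ℝ × ℝ), IsApproxSolution g T 0 x → ‖x 0 - v a‖ ≤ d →
      ∃ b, ‖b - a - Λ a (x 0 - v a)‖ ≤ C * ‖x 0 - v a‖ ^ 2 ∧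
        ∀ t ≥ 0, ‖x t - v (b + (0, t))‖ ≤ C * Real.exp (-t / (2 * τtr)) * ‖x 0 - v a‖ := by
  have hK := F.pos
  obtain ⟨d₀, hd₀, C, hC, asymptotic⟩ := F.exists_asymptotic_phase_of_isPhase
  set K₁ := 1 + 2 * K ^ 2
  have hK₁ : 0 < K₁ := by positivity
  obtain ⟨d, hd, -, hd_phase, hd_d₀⟩ :=
    exists_pos_le_one_mul_le (show 0 < 1 / (16 * K ^ 3) by positivity) hd₀ 1 K₁
  refine ⟨d, hd, 1 + 6 * K ^ 3 + C * K₁ ^ 2 + C * K₁, ?_, fun x a hx had => ?_⟩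
  · linarith [show 0 ≤ 6 * K ^ 3 + C * K₁ ^ 2 + C * K₁ by positivity]
  obtain ⟨a₀, ha₀, ha₀_near⟩ := F.exists_isPhase (had.trans ((one_mul d).symm.trans_le hd_phase))
  have hxa₀ := F.norm_sub_phase_le ha₀_near
  obtain ⟨b, hb, decay⟩ := asymptotic x a₀ hx ha₀
    (hxa₀.trans ((mul_le_mul_of_nonneg_left had hK₁.le).trans hd_d₀))
  refine ⟨b, ?_, fun t ht => (decay t ht).trans ?_⟩
  · have split : b - a - Λ a (x 0 - v a) = (b - a₀) + (a₀ - a - Λ a (x 0 - v a)) := by abel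
    rw [split]
    calc ‖b - a₀ + (a₀ - a - Λ a (x 0 - v a))‖
        ≤ C * (K₁ * ‖x 0 - v a‖) ^ 2 + 6 * K ^ 3 * ‖x 0 - v a‖ ^ 2 :=
          (norm_add_le _ _).trans
            (add_le_add (hb.trans (by gcongr)) (F.norm_sub_sub_apply_le ha₀ ha₀_near))
      _ = (6 * K ^ 3 + C * K₁ ^ 2) * ‖x 0 - v a‖ ^ 2 := by ring
      _ ≤ _ := mul_le_mul_of_nonneg_right (by linarith [show 0 < C * K₁ by positivity])
        (sq_nonneg _)
  · calc C * Real.exp (-t / (2 * τtr)) * ‖x 0 - v a₀‖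
        ≤ C * Real.exp (-t / (2 * τtr)) * (K₁ * ‖x 0 - v a‖) := by gcongr
      _ = C * K₁ * Real.exp (-t / (2 * τtr)) * ‖x 0 - v a‖ := by ring
      _ ≤ _ := by
        gcongr
        exact le_add_of_nonneg_left (by positivity)

theorem eq_of_tendsto_sub (F : AttractingTorus g T τtr v A Λ K) {b b' : ℝ × ℝ}
    (hbb : ‖b' - b‖ ≤ 1 / (4 * K))
    (h : Tendsto (fun t : ℝ => v (b' + (0, t)) - v (b + (0, t))) atTop (𝓝 0)) : b' = b := by
  have lower_bound : ∀ t : ℝ, ‖b' - b‖ ≤ 2 * K * ‖v (b' + (0, t)) - v (b + (0, t))‖ := fun t => by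
    have := F.norm_sub_le_of_norm_sub_le (b := b + (0, t)) (b' := b' + (0, t))
    rw [add_sub_add_right_eq_sub] at this
    exact this hbb
  have hlim : Tendsto (fun t : ℝ => 2 * K * ‖v (b' + (0, t)) - v (b + (0, t))‖) atTop (𝓝 0) := by
    simpa using h.norm.const_mul (2 * K)
  exact sub_eq_zero.1 (norm_le_zero_iff.1 (ge_of_tendsto' hlim lower_bound))

theorem exists_approximate_phase_curve_of_isPhase (F : AttractingTorus g T τtr v A Λ K) :
    ∃ d > 0, ∃ C > 0, ∀ (x : ℝ → X) (ε : ℝ) (a : ℝ × ℝ), IsApproxSolution g T ε x →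
      ε ≤ d → IsPhase v Λ (x 0) a → ‖x 0 - v a‖ ≤ ε → ∃ c : ℝ → ℝ × ℝ, c 0 = a ∧
      (∀ t ≥ 0, ‖x t - v (c t)‖ ≤ C * ε) ∧
      ∀ t ≥ 0, ∀ t' ≥ t, t' < t + 1 → ‖c t' - c t‖ ≤ (t' - t) + C * ε := by
  obtain ⟨m, hm, d, hd, hd_one, C, hC, sequence⟩ := F.exists_phase_sequence
  obtain ⟨G, hG, interpolated⟩ := F.exists_interpolatedPhase_bound hm
  set θ := Real.exp (-m / (2 * τtr))
  have hθ_le : ∀ k, θ ^ k ≤ 1 := fun k => pow_le_one₀ (Real.exp_pos _).le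
    (exp_neg_div_le_one m.cast_nonneg (mul_pos two_pos F.τ_pos))
  refine ⟨d, hd, G * (C + 2) + 2 * C, by positivity, fun x ε a hx hεd ha hxa => ?_⟩
  have hε := hx.nonneg
  obtain ⟨p, hp₀, hp⟩ := sequence x ε a hx hεd ha (hxa.trans hεd)
  have decay : ∀ k, θ ^ k * ‖x 0 - v a‖ ≤ ε := fun k =>
    (mul_le_of_le_one_left (norm_nonneg _) (hθ_le k)).trans hxa
  refine ⟨interpolatedPhase m p, (interpolatedPhase_zero m p).trans hp₀, fun t ht => ?_,
    fun t ht t' htt' hlt => ?_⟩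
  · calc ‖x t - v (interpolatedPhase m p t)‖ ≤ G * (ε + C * ε + ε) :=
          (interpolated x ε p hx t ht).trans (by
            gcongr
            exact (hp _).1.trans (add_le_add_left (decay _) _))
      _ = G * (C + 2) * ε := by ring
      _ ≤ _ := by
        gcongr
        exact le_add_of_nonneg_right (by positivity)
  · refine norm_interpolatedPhase_sub_le hm (fun k => (hp k).2.trans ?_) ht htt' hlt
    calc C * (ε + (θ ^ k * ‖x 0 - v a‖) ^ 2) ≤ C * (ε + ε ^ 2) := by
          gcongr C * (ε + ?_ ^ 2); exact decay k
      _ ≤ C * (ε + ε) := by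
        gcongr
        exact pow_le_of_le_one hε (hεd.trans hd_one) two_ne_zero
      _ = 2 * C * ε := by ring
      _ ≤ _ := by
        gcongr
        exact le_add_of_nonneg_left (by positivity)

theorem exists_approximate_phase_curve (F : AttractingTorus g T τtr v A Λ K) :
    ∃ d > 0, ∃ C > 0, ∀ (x : ℝ → X) (ε : ℝ) (a : ℝ × ℝ), IsApproxSolution g T ε x →
      ε ≤ d → ‖x 0 - v a‖ ≤ ε → ∃ c : ℝ → ℝ × ℝ, ‖c 0 - a‖ ≤ C * ε ∧
      (∀ t ≥ 0, ‖x t - v (c t)‖ ≤ C * ε) ∧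
      ∀ t ≥ 0, ∀ t' ≥ t, t' < t + 1 → ‖c t' - c t‖ ≤ (t' - t) + C * ε := by
  have hK := F.pos
  obtain ⟨d₀, hd₀, C, hC, curve⟩ := F.exists_approximate_phase_curve_of_isPhase
  set K₁ := 1 + 2 * K ^ 2
  have hK₁ : 1 ≤ K₁ := le_add_of_nonneg_right (by positivity)
  have hK₁_pos : 0 < K₁ := zero_lt_one.trans_le hK₁
  obtain ⟨d, hd, -, hd_phase, hd_d₀⟩ :=
    exists_pos_le_one_mul_le (show 0 < 1 / (16 * K ^ 3) by positivity) hd₀ 1 K₁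
  refine ⟨d, hd, 2 * K + C * K₁, by positivity, fun x ε a hx hεd hxa => ?_⟩
  have hε := hx.nonneg
  obtain ⟨a₀, ha₀, ha₀_near⟩ := F.exists_isPhase (hxa.trans (hεd.trans (one_mul d ▸ hd_phase)))
  obtain ⟨c, hc₀, hxc, jump⟩ := curve x (K₁ * ε) a₀
    (hx.mono (le_mul_of_one_le_left hε hK₁))
    ((mul_le_mul_of_nonneg_left hεd hK₁_pos.le).trans hd_d₀) ha₀
    ((F.norm_sub_phase_le ha₀_near).trans (by gcongr))
  have constant : C * (K₁ * ε) ≤ (2 * K + C * K₁) * ε := by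
    rw [← mul_assoc]
    gcongr
    exact le_add_of_nonneg_left (by positivity)
  refine ⟨c, ?_, fun t ht => (hxc t ht).trans constant, fun t ht t' htt' hlt =>
    (jump t ht t' htt' hlt).trans (by gcongr)⟩
  calc ‖c 0 - a‖ ≤ 2 * K * ‖x 0 - v a‖ := hc₀ ▸ ha₀_near.trans (F.two_mul_norm_apply_le _ _)
    _ ≤ (2 * K + C * K₁) * ε := by
      gcongr
      exact le_add_of_nonneg_right (by positivity)

theorem exists_phase_curve (F : AttractingTorus g T τtr v A Λ K) :
    ∃ d > 0, ∃ C > 0, ∀ (x : ℝ → X) (ε : ℝ) (a : ℝ × ℝ), IsApproxSolution g T ε x →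
      ε ≤ d → ‖x 0 - v a‖ ≤ ε → ∃ b : ℝ → ℝ × ℝ, ‖b 0 - a‖ ≤ C * ε ∧
      (∀ t ≥ 0, IsPhase v Λ (x t) (b t) ∧ ‖x t - v (b t)‖ ≤ C * ε) ∧
      ∀ t ≥ 0, ∀ᶠ t' in 𝓝[Ici 0] t, ‖b t' - b t‖ ≤ 2 * K * ‖x t' - x t‖ := by
  have hK := F.pos
  obtain ⟨d₀, hd₀, C, hC, curve⟩ := F.exists_approximate_phase_curve
  obtain ⟨d, hd, -, hd_d₀, hd_C⟩ :=
    exists_pos_le_one_mul_le hd₀ (show 0 < 1 / (64 * K ^ 3) by positivity) 1 C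
  have hsmall : 1 / (64 * K ^ 3) ≤ 1 / (16 * K) :=
    one_div_le_one_div_of_le (by positivity)
      (mul_le_mul (by norm_num) (le_self_pow₀ F.one_le three_ne_zero) hK.le (by norm_num))
  refine ⟨d, hd, (1 + 2 * K) * C + (1 + 2 * K ^ 2) * C, by positivity,
    fun x ε a hx hεd hxa => ?_⟩
  have hε := hx.nonneg
  obtain ⟨c, hca, hxc, jump⟩ := curve x ε a hx (hεd.trans (one_mul d ▸ hd_d₀)) hxa
  have hη : C * ε ≤ 1 / (64 * K ^ 3) := (mul_le_mul_of_nonneg_left hεd hC.le).trans hd_C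
  obtain ⟨b, hb, hlip⟩ := F.exists_locally_lipschitz_phases hη (hη.trans hsmall) hxc jump
  refine ⟨b, ?_, fun t ht => ⟨(hb t ht).1, (hb t ht).2.2.trans ?_⟩, hlip⟩
  · rw [← sub_add_sub_cancel (b 0) (c 0) a]
    refine (norm_add_le _ _).trans ((add_le_add (hb 0 le_rfl).2.1 hca).trans ?_)
    linarith [show 0 ≤ (1 + 2 * K ^ 2) * C * ε by positivity]
  · rw [← mul_assoc]
    gcongr
    exact le_add_of_nonneg_left (by positivity)

theorem velocity_sub_eq (F : AttractingTorus g T τtr v A Λ K) {x w : X} {b b' : ℝ × ℝ}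
    {D : ℝ × ℝ →L[ℝ] ℝ × ℝ} (hD : D (0, 1) = -(T • Λ b (A b (x - v b))))
    (hb' : b' = Λ b (T • g x + w) + D b') :
    b' - (0, 1) - Λ b w =
      Λ b (T • (g x - g (v b) - A b (x - v b))) + D (b' - (0, 1)) := by
  have hfield := F.coframe_field b
  simp only [map_sub, map_add, map_smul, smul_sub, hfield, hD] at hb' ⊢
  linear_combination (norm := module) hb'

theorem norm_velocity_sub_le (F : AttractingTorus g T τtr v A Λ K) {x w : X} {b b' : ℝ × ℝ}
    {D : ℝ × ℝ →L[ℝ] ℝ × ℝ} {c ε : ℝ} (hc : 0 ≤ c) (hε : 0 ≤ ε) (hε_one : ε ≤ 1)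
    (hx : ‖x - v b‖ ≤ c * ε) (hcε : K * (c * ε) ≤ 1 / 2) (hw : ‖w‖ ≤ ε)
    (hD_norm : ‖D‖ ≤ K * ‖x - v b‖) (hD : D (0, 1) = -(T • Λ b (A b (x - v b))))
    (hb' : b' = Λ b (T • g x + w) + D b') :
    ‖b' - (0, 1) - Λ b w‖ ≤
      (T * K ^ 2 * c ^ 2 + 2 * K * c * (T * K ^ 2 * c ^ 2 + K)) * ε ^ 2 := by
  have hK := F.pos
  have hT := F.T_pos
  set R := g x - g (v b) - A b (x - v b)
  set e := b' - (0, 1)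
  have velocity : e - Λ b w = Λ b (T • R) + D e := F.velocity_sub_eq hD hb'
  have taylor : ‖Λ b (T • R)‖ ≤ T * K ^ 2 * c ^ 2 * ε ^ 2 :=
    calc ‖Λ b (T • R)‖ ≤ K * (T * K * (c * ε) ^ 2) :=
          (F.norm_apply_le _ _).trans
            (by gcongr; exact F.norm_smul_le_mul ((F.g_taylor b x).trans (by gcongr)))
      _ = T * K ^ 2 * c ^ 2 * ε ^ 2 := by ring
  have hDe : ‖D e‖ ≤ K * (c * ε) * ‖e‖ := (D.le_of_opNorm_le hD_norm e).trans (by gcongr)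
  have he : ‖e‖ ≤ 2 * (T * K ^ 2 * c ^ 2 + K) * ε := by
    have : ‖e‖ ≤ K * ε + (T * K ^ 2 * c ^ 2 * ε + 1 / 2 * ‖e‖) :=
      calc ‖e‖ = ‖Λ b w + (Λ b (T • R) + D e)‖ := by rw [← velocity, add_sub_cancel]
        _ ≤ K * ε + (T * K ^ 2 * c ^ 2 * ε ^ 2 + K * (c * ε) * ‖e‖) :=
          (norm_add_le _ _).trans (add_le_add ((F.norm_apply_le _ _).trans (by gcongr))
            ((norm_add_le _ _).trans (add_le_add taylor hDe)))
        _ ≤ K * ε + (T * K ^ 2 * c ^ 2 * ε + 1 / 2 * ‖e‖) := by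
          gcongr
          exact pow_le_of_le_one hε hε_one two_ne_zero
    linarith
  calc ‖e - Λ b w‖ ≤ T * K ^ 2 * c ^ 2 * ε ^ 2
        + K * (c * ε) * (2 * (T * K ^ 2 * c ^ 2 + K) * ε) := by
        rw [velocity]
        exact (norm_add_le _ _).trans (add_le_add taylor (hDe.trans (by gcongr)))
    _ = _ := by ring

theorem exists_hasDerivWithinAt_phase (F : AttractingTorus g T τtr v A Λ K) {x : ℝ → X}
    {b : ℝ → ℝ × ℝ} {t : ℝ} {w : X} (ht : t ∈ Ici (0 : ℝ))
    (hb : ∀ t ∈ Ici (0 : ℝ), IsPhase v Λ (x t) (b t))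
    (hlip : ∀ᶠ t' in 𝓝[Ici 0] t, ‖b t' - b t‖ ≤ 2 * K * ‖x t' - x t‖)
    (hx : HasDerivWithinAt x w (Ici 0) t) (near : ‖x t - v (b t)‖ ≤ 1 / (4 * K)) :
    ∃ (b' : ℝ × ℝ) (D : ℝ × ℝ →L[ℝ] ℝ × ℝ), HasDerivWithinAt b b' (Ici 0) t ∧
      b' = Λ (b t) w + D b' ∧ D (0, 1) = -(T • Λ (b t) (A (b t) (x t - v (b t)))) ∧
      ‖D‖ ≤ K * ‖x t - v (b t)‖ := by
  obtain ⟨D, hD, hD_time⟩ := F.differentiable (b t) _ (hb t ht)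
  have hD_norm := F.norm_fderiv_apply_le hD
  have hD_lt : ‖D‖ < 1 := by linarith [F.mul_le_one_fourth near]
  obtain ⟨b', hb', velocity⟩ := exists_hasDerivWithinAt_of_sub_apply hD_lt ht
    (F.hasDerivWithinAt_phase_sub_apply ht hb hlip hx hD)
  exact ⟨b', D, hb', velocity, hD_time, hD_norm⟩

theorem exists_phase_dynamics (F : AttractingTorus g T τtr v A Λ K) :
    ∃ d > 0, ∃ r > 0, ∃ C > 0, ∀ (dode x : ℝ → X) (ε : ℝ) (a : ℝ × ℝ),
      IsForcedSolution g T dode x → ε ≤ d → (∀ τ ≥ 0, ‖dode τ‖ ≤ ε) →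
      ‖x 0 - v a‖ ≤ ε → ∃ b : ℝ → ℝ × ℝ, ContinuousOn b (Ici 0) ∧
      (∀ t ≥ 0, IsPhase v Λ (x t) (b t) ∧ ‖x t - v (b t)‖ ≤ C * ε) ∧ ‖b 0 - a‖ ≤ r ∧
      (∀ t ≥ 0, ∃ b' : ℝ × ℝ, HasDerivWithinAt b b' (Ici 0) t ∧
        ‖b' - (0, 1) - Λ (b t) (dode t)‖ ≤ C * ε ^ 2) ∧
      ∀ c : ℝ → ℝ × ℝ, ContinuousOn c (Ici 0) → (∀ t ≥ 0, IsPhase v Λ (x t) (c t)) →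
        ‖c 0 - a‖ ≤ r → EqOn c b (Ici 0) := by
  have hK := F.pos
  have hT := F.T_pos
  obtain ⟨d₀, hd₀, C, hC, curve⟩ := F.exists_phase_curve
  set C₁ := T * K ^ 2 * C ^ 2 + 2 * K * C * (T * K ^ 2 * C ^ 2 + K)
  set r := 1 / (8 * K) with hr
  have hr_pos : 0 < r := by positivity
  have hr_add : r + r = 1 / (4 * K) := by rw [hr]; field_simp; norm_num
  obtain ⟨d, hd, hd_one, hd_d₀, hd_r⟩ := exists_pos_le_one_mul_le hd₀ hr_pos 1 C
  refine ⟨d, hd, r, hr_pos, C + C₁, by positivity, fun dode x ε a hx hεd hdode hxa => ?_⟩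
  have hε : 0 ≤ ε := (norm_nonneg _).trans hxa
  have hεr : C * ε ≤ r := (mul_le_mul_of_nonneg_left hεd hC.le).trans hd_r
  obtain ⟨b, hba, hb, hlip⟩ := curve x ε a (hx.isApproxSolution hdode)
    (hεd.trans (one_mul d ▸ hd_d₀)) hxa
  have near : ∀ t ≥ 0, ‖x t - v (b t)‖ ≤ 1 / (4 * K) := fun t ht =>
    (hb t ht).2.trans (by linarith)
  have dynamics : ∀ t ≥ 0, ∃ b' : ℝ × ℝ, HasDerivWithinAt b b' (Ici 0) t ∧
      ‖b' - (0, 1) - Λ (b t) (dode t)‖ ≤ C₁ * ε ^ 2 := fun t ht => by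
    obtain ⟨b', D, hb', velocity, hD, hD_norm⟩ := F.exists_hasDerivWithinAt_phase ht
      (fun t ht => (hb t ht).1) (hlip t ht) (hx t ht) (near t ht)
    refine ⟨b', hb', F.norm_velocity_sub_le hC.le hε (hεd.trans hd_one) (hb t ht).2 ?_ (hdode t ht)
      hD_norm hD velocity⟩
    linarith [F.mul_le_one_fourth (u := C * ε) (by linarith)]
  have hb_cont : ContinuousOn b (Ici 0) := fun t ht => by
    obtain ⟨b', hb', -⟩ := dynamics t ht
    exact hb'.continuousWithinAt
  refine ⟨b, hb_cont, fun t ht => ⟨(hb t ht).1, (hb t ht).2.trans ?_⟩, hba.trans hεr,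
    fun t ht => ?_, fun c hc hxc hca => ?_⟩
  · gcongr
    exact le_add_of_nonneg_right (by positivity)
  · obtain ⟨b', hb', velocity⟩ := dynamics t ht
    exact ⟨b', hb', velocity.trans (by gcongr; exact le_add_of_nonneg_left hC.le)⟩
  · refine F.eqOn_of_isPhase_of_continuousOn hb_cont hc (fun t ht => (hb t ht).1) hxc near ?_
    rw [← sub_sub_sub_cancel_right _ _ a]
    linarith [norm_sub_le (c 0 - a) (b 0 - a)]

end

end AttractingTorus

section ForcedSolution

variable {X : Type*} [NormedAddCommGroup X] [NormedSpace ℝ X] {g : X → X} {T : ℝ} {dode : ℝ → X}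

theorem lipschitzOnWith_smul_add {L : NNReal} {s : Set X} (hg : LipschitzOnWith L g s) (T : ℝ)
    (c : X) : LipschitzOnWith (‖T‖₊ * L) (fun z => T • g z + c) s := by
  refine LipschitzOnWith.of_dist_le_mul fun z hz w hw => ?_
  rw [dist_add_right, dist_smul₀, NNReal.coe_mul, mul_assoc, coe_nnnorm]
  gcongr
  exact hg.dist_le_mul z hz w hw

theorem eqOn_Icc_of_forced_ode (hg : LocallyLipschitz g) {N : ℝ} {x y : ℝ → X}
    (hx : ∀ τ ∈ Icc 0 N, HasDerivWithinAt x (T • g (x τ) + dode τ) (Icc 0 N) τ)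
    (hy : ∀ τ ∈ Icc 0 N, HasDerivWithinAt y (T • g (y τ) + dode τ) (Icc 0 N) τ)
    (initial : x 0 = y 0) : EqOn x y (Icc 0 N) := by
  have hx_cont : ContinuousOn x (Icc 0 N) := fun τ hτ => (hx τ hτ).continuousWithinAt
  have hy_cont : ContinuousOn y (Icc 0 N) := fun τ hτ => (hy τ hτ).continuousWithinAt
  obtain ⟨L, hL⟩ := hg.locallyLipschitzOn.exists_lipschitzOnWith_of_compact
    ((isCompact_Icc.image_of_continuousOn hx_cont).union
      (isCompact_Icc.image_of_continuousOn hy_cont))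
  have right_deriv : ∀ z : ℝ → X, (∀ τ ∈ Icc 0 N, HasDerivWithinAt z (T • g (z τ) + dode τ)
      (Icc 0 N) τ) → ∀ τ ∈ Ico 0 N, HasDerivWithinAt z (T • g (z τ) + dode τ) (Ici τ) τ :=
    fun z hz τ hτ => (hz τ ⟨hτ.1, hτ.2.le⟩).mono_of_mem_nhdsWithin
      (mem_of_superset (Icc_mem_nhdsGE hτ.2) (Icc_subset_Icc_left hτ.1))
  exact ODE_solution_unique_of_mem_Icc_right (v := fun τ z => T • g z + dode τ)
    (s := fun _ => x '' Icc 0 N ∪ y '' Icc 0 N) (fun t _ => lipschitzOnWith_smul_add hL T _)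
    hx_cont (right_deriv x hx) (fun t ht => .inl (mem_image_of_mem _ ⟨ht.1, ht.2.le⟩))
    hy_cont (right_deriv y hy) (fun t ht => .inr (mem_image_of_mem _ ⟨ht.1, ht.2.le⟩)) initial

namespace IsForcedSolution

theorem eqOn (hg : LocallyLipschitz g) {x y : ℝ → X} (hx : IsForcedSolution g T dode x)
    (hy : IsForcedSolution g T dode y) (initial : x 0 = y 0) : EqOn x y (Ici 0) := fun _ ht =>
  eqOn_Icc_of_forced_ode hg (fun τ hτ => (hx τ hτ.1).mono Icc_subset_Ici_self)
    (fun τ hτ => (hy τ hτ.1).mono Icc_subset_Ici_self) initial (right_mem_Icc.2 ht)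

theorem congr {g' : X → X} {x : ℝ → X} (hx : IsForcedSolution g T dode x)
    (h : ∀ t ≥ 0, g (x t) = g' (x t)) : IsForcedSolution g' T dode x := fun t ht => by
  rw [← h t ht]
  exact hx t ht

end IsForcedSolution

theorem exists_forced_solution_Icc [CompleteSpace X] {L : NNReal} (hg : LipschitzWith L g)
    {B ε : ℝ} (hB : ∀ x, ‖g x‖ ≤ B) (hdode : ContinuousOn dode (Ici 0))
    (hdode_le : ∀ τ ≥ 0, ‖dode τ‖ ≤ ε) (x₀ : X) {N : ℝ} (hN : 0 ≤ N) :
    ∃ x : ℝ → X, x 0 = x₀ ∧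
      ∀ t ∈ Icc 0 N, HasDerivWithinAt x (T • g (x t) + dode t) (Icc 0 N) t := by
  set M : NNReal := ‖T‖₊ * B.toNNReal + ε.toNNReal with hM
  have picard : IsPicardLindelof (fun t z => T • g z + dode t)
      (⟨0, le_rfl, hN⟩ : Icc (0 : ℝ) N) x₀ (M * N.toNNReal) 0 M (‖T‖₊ * L) := by
    refine ⟨fun _ _ => lipschitzOnWith_smul_add hg.lipschitzOnWith T _,
      fun _ _ => continuousOn_const.add (hdode.mono Icc_subset_Ici_self),
      fun t ht z _ => ?_, by simp [hN]⟩
    refine (norm_add_le _ _).trans ?_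
    rw [norm_smul, hM]
    push_cast
    gcongr
    · exact (hB z).trans (Real.le_coe_toNNReal B)
    · exact (hdode_le t ht.1).trans (Real.le_coe_toNNReal ε)
  exact picard.exists_eq_forall_mem_Icc_hasDerivWithinAt₀

theorem exists_isForcedSolution [CompleteSpace X] {L : NNReal} (hg : LipschitzWith L g)
    {B ε : ℝ} (hB : ∀ x, ‖g x‖ ≤ B) (hdode : ContinuousOn dode (Ici 0))
    (hdode_le : ∀ τ ≥ 0, ‖dode τ‖ ≤ ε) (x₀ : X) :
    ∃ x, x 0 = x₀ ∧ IsForcedSolution g T dode x := by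
  choose α initial hα using fun N : ℕ =>
    exists_forced_solution_Icc (T := T) hg hB hdode hdode_le x₀ (Nat.cast_nonneg N)
  have agree : ∀ M N : ℕ, M ≤ N → EqOn (α M) (α N) (Icc 0 M) := fun M N hMN => by
    have hMN' : (M : ℝ) ≤ N := by exact_mod_cast hMN
    refine eqOn_Icc_of_forced_ode hg.locallyLipschitz (hα M) (fun τ hτ => ?_)
      (by rw [initial, initial])
    exact (hα N τ ⟨hτ.1, hτ.2.trans hMN'⟩).mono (Icc_subset_Icc_right hMN')
  refine ⟨fun t => α (⌊t⌋₊ + 1) t, initial _, fun t (ht : 0 ≤ t) => ?_⟩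
  have t_lt : t < (⌊t⌋₊ + 1 : ℕ) := by push_cast; exact Nat.lt_floor_add_one t
  have near : ∀ᶠ s in 𝓝[Ici 0] t, s ∈ Ico (0 : ℝ) (⌊t⌋₊ + 1 : ℕ) :=
    inter_mem self_mem_nhdsWithin (mem_nhdsWithin_of_mem_nhds (Iio_mem_nhds t_lt))
  refine ((hα (⌊t⌋₊ + 1) t ⟨ht, t_lt.le⟩).mono_of_mem_nhdsWithin
    (mem_of_superset near Ico_subset_Icc_self)).congr_of_eventuallyEq ?_ rfl
  filter_upwards [near] with s ⟨hs, s_lt⟩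
  refine agree _ _ (Nat.succ_le_of_lt ((Nat.floor_lt hs).2 s_lt)) ⟨hs, ?_⟩
  push_cast
  exact (Nat.lt_floor_add_one s).le

end ForcedSolution

section Flow

variable {n : ℕ} {g : Vec n → Vec n}

theorem flow_eq_of_isTrajectory (hg : LocallyLipschitz g) {t : ℝ} (ht : 0 ≤ t) {x₀ : Vec n}
    {γ : ℝ → Vec n} (hγ : IsTrajectory g x₀ t γ) : flow g t x₀ = γ t := by
  have defined : FlowDefined g t x₀ := ⟨γ, hγ⟩
  rw [flow, dif_pos defined]
  have forced : ∀ γ, IsTrajectory g x₀ t γ →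
      ∀ s ∈ Icc 0 t, HasDerivWithinAt γ ((1 : ℝ) • g (γ s) + 0) (Icc 0 t) s := by
    intro γ hγ s hs
    have := hγ.2 s (by rwa [uIcc_of_le ht])
    rwa [uIcc_of_le ht, ← one_smul ℝ (g (γ s)), ← add_zero ((1 : ℝ) • g (γ s))] at this
  exact eqOn_Icc_of_forced_ode (dode := fun _ => 0) hg (forced _ defined.choose_spec)
    (forced _ hγ) (defined.choose_spec.1.trans hγ.1.symm) (right_mem_Icc.2 ht)

theorem IsForcedSolution.isTrajectory {T τ : ℝ} (hT : 0 < T) (hτ : 0 ≤ τ) {x : ℝ → Vec n}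
    (hx : IsForcedSolution g T (fun _ => 0) x) :
    IsTrajectory g (x 0) (T * τ) (fun s => x (s / T)) := by
  refine ⟨by simp, fun s hs => ?_⟩
  rw [uIcc_of_le (by positivity)] at hs ⊢
  have scaling : HasDerivWithinAt (fun s : ℝ => s / T) (1 / T) (Icc 0 (T * τ)) s :=
    ((hasDerivAt_id s).div_const T).hasDerivWithinAt
  have := HasDerivWithinAt.scomp s (hx (s / T) (div_nonneg hs.1 hT.le)) scaling
    (fun r hr => div_nonneg hr.1 hT.le)
  rwa [add_zero, smul_smul, one_div, inv_mul_cancel₀ hT.ne', one_smul] at this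

theorem IsForcedSolution.flow_eq (hg : LocallyLipschitz g) {T τ : ℝ} (hT : 0 < T) (hτ : 0 ≤ τ)
    {x : ℝ → Vec n} (hx : IsForcedSolution g T (fun _ => 0) x) :
    FlowDefined g (T * τ) (x 0) ∧ flow g (T * τ) (x 0) = x τ := by
  have trajectory := hx.isTrajectory hT hτ
  refine ⟨⟨_, trajectory⟩, (flow_eq_of_isTrajectory hg (by positivity) trajectory).trans ?_⟩
  rw [mul_div_cancel_left₀ _ hT.ne']

end Flow

namespace AttractingTorus

section

variable {n : ℕ} {g gt : Vec n → Vec n} {T τtr K B : ℝ} {v : ℝ × ℝ → Vec n}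
    {A : ℝ × ℝ → Vec n →L[ℝ] Vec n} {Λ : ℝ × ℝ → Vec n →L[ℝ] ℝ × ℝ}

theorem lipschitzWith (F : AttractingTorus gt T τtr v A Λ K) : LipschitzWith K.toNNReal gt :=
  LipschitzWith.of_dist_le' fun x y => by simpa only [dist_eq_norm] using F.g_lip x y

theorem flow_manifold (F : AttractingTorus gt T τtr v A Λ K) (hg : LocallyLipschitz g)
    (agree : ∀ b x, ‖x - v b‖ ≤ 1 → gt x = g x) (b : ℝ × ℝ) {τ : ℝ} (hτ : 0 ≤ τ) :
    FlowDefined g (T * τ) (v b) ∧ flow g (T * τ) (v b) = v (b + (0, τ)) := by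
  have solution : IsForcedSolution gt T (fun _ => 0) (fun s => v (b + (0, s))) := fun s _ => by
    rw [add_zero]
    exact (F.ode b s).hasDerivWithinAt
  simpa [Prod.mk_zero_zero] using
    (solution.congr fun t _ => agree (b + (0, t)) _ (by simp)).flow_eq hg F.T_pos hτ

theorem exists_flow_asymptotics (F : AttractingTorus gt T τtr v A Λ K)
    (hg : LocallyLipschitz g) (hB : ∀ x, ‖gt x‖ ≤ B)
    (agree : ∀ b x, ‖x - v b‖ ≤ 1 → gt x = g x) :
    ∃ d₀ > 0, ∃ C ≥ 1, ∀ (a : ℝ × ℝ) (d : Vec n), ‖d‖ ≤ d₀ → ∃ b,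
      ‖b - (a + Λ a d)‖ ≤ C * ‖d‖ ^ 2 ∧ ∀ τ ≥ 0, FlowDefined g (T * τ) (v a + d) ∧
      ‖flow g (T * τ) (v a + d) - v (b + (0, τ))‖ ≤ C * Real.exp (-τ / (2 * τtr)) * ‖d‖ := by
  have hτtr := F.τ_pos
  obtain ⟨d₁, hd₁, C, hC, asymptotic_phase⟩ := F.exists_asymptotic_phase
  obtain ⟨d₀, hd₀, -, hd₀_d₁, hCd₀⟩ := exists_pos_le_one_mul_le hd₁ one_pos 1 C
  refine ⟨d₀, hd₀, C, hC, fun a d hd => ?_⟩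
  obtain ⟨x, initial, hx⟩ := exists_isForcedSolution (T := T) F.lipschitzWith hB
    (dode := fun _ => 0) (ε := 0) continuousOn_const (by simp) (v a + d)
  have hd_eq : x 0 - v a = d := by rw [initial, add_sub_cancel_left]
  obtain ⟨b, hb, decay⟩ := asymptotic_phase x a (hx.isApproxSolution (by simp))
    (by rw [hd_eq]; linarith)
  rw [hd_eq] at hb decay
  have near : ∀ s ≥ 0, ‖x s - v (b + (0, s))‖ ≤ 1 := fun s hs =>
    calc ‖x s - v (b + (0, s))‖ ≤ C * Real.exp (-s / (2 * τtr)) * ‖d‖ := decay s hs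
      _ ≤ C * 1 * d₀ := by
        gcongr
        exact exp_neg_div_le_one hs (by positivity)
      _ ≤ 1 := by rwa [mul_one]
  refine ⟨b, by rwa [← sub_sub], fun τ hτ => ?_⟩
  have flow_eq := (hx.congr fun s hs => agree _ _ (near s hs)).flow_eq hg F.T_pos hτ
  rw [initial] at flow_eq
  exact ⟨flow_eq.1, flow_eq.2 ▸ decay τ hτ⟩

theorem exists_forced_phase_dynamics (F : AttractingTorus gt T τtr v A Λ K)
    (hg : LocallyLipschitz g) (hB : ∀ x, ‖gt x‖ ≤ B)
    (agree : ∀ b x, ‖x - v b‖ ≤ 1 → gt x = g x) :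
    ∃ d > 0, ∃ r > 0, ∃ C > 0, ∀ ε ≤ d, ∀ dode : ℝ → Vec n, ContinuousOn dode (Ici 0) →
      (∀ τ ≥ 0, ‖dode τ‖ ≤ ε) → ∀ (a : ℝ × ℝ) (x₀ : Vec n), ‖x₀ - v a‖ ≤ ε →
      (∃ x, IsPerturbedTrajectory g T dode x₀ x) ∧
      ∀ x, IsPerturbedTrajectory g T dode x₀ x → ∃ b : ℝ → ℝ × ℝ, ContinuousOn b (Ici 0) ∧
        (∀ t ≥ 0, IsPhase v Λ (x t) (b t) ∧ ‖x t - v (b t)‖ ≤ C * ε) ∧ ‖b 0 - a‖ ≤ r ∧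
        (∀ t ≥ 0, ∃ b' : ℝ × ℝ, HasDerivWithinAt b b' (Ici 0) t ∧
          ‖b' - (0, 1) - Λ (b t) (dode t)‖ ≤ C * ε ^ 2) ∧
        ∀ c : ℝ → ℝ × ℝ, ContinuousOn c (Ici 0) → (∀ t ≥ 0, IsPhase v Λ (x t) (c t)) →
          ‖c 0 - a‖ ≤ r → EqOn c b (Ici 0) := by
  obtain ⟨d₁, hd₁, r, hr, C, hC, dynamics⟩ := F.exists_phase_dynamics
  obtain ⟨d, hd, -, hd_d₁, hCd⟩ := exists_pos_le_one_mul_le hd₁ one_pos 1 C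
  refine ⟨d, hd, r, hr, C, hC, fun ε hε dode hdode hdode_le a x₀ hx₀ => ?_⟩
  have hε_d₁ : ε ≤ d₁ := by linarith
  obtain ⟨y, y_initial, hy⟩ := exists_isForcedSolution (T := T) F.lipschitzWith hB hdode hdode_le x₀
  obtain ⟨b, -, hb, -⟩ := dynamics dode y ε a hy hε_d₁ hdode_le (by rwa [y_initial])
  have fields_eq : ∀ t ≥ 0, gt (y t) = g (y t) := fun t ht =>
    agree (b t) (y t) ((hb t ht).2.trans ((mul_le_mul_of_nonneg_left hε hC.le).trans hCd))
  have hy_g := hy.congr fields_eq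
  refine ⟨⟨y, y_initial, hy_g⟩, fun x ⟨initial, hx⟩ => ?_⟩
  have hxy : EqOn x y (Ici 0) := IsForcedSolution.eqOn hg hx hy_g (initial.trans y_initial.symm)
  refine dynamics dode x ε a (IsForcedSolution.congr hx fun t ht => ?_) hε_d₁ hdode_le
    (by rwa [initial])
  rw [hxy ht, fields_eq t ht]

theorem exists_flow_comparison (F : AttractingTorus gt T τtr v A Λ K)
    (hg : LocallyLipschitz g) (hB : ∀ x, ‖gt x‖ ≤ B)
    (agree : ∀ b x, ‖x - v b‖ ≤ 1 → gt x = g x) :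
    ∃ d₀ > 0, ∃ C > 0, ∀ (a : ℝ × ℝ) (d : Vec n), ‖d‖ ≤ d₀ → ∀ τ ≥ 0,
      FlowDefined g (T * τ) (v a + d) ∧ FlowDefined g (T * τ) (v (a + Λ a d)) ∧
      ‖flow g (T * τ) (v a + d) - flow g (T * τ) (v (a + Λ a d))‖
        ≤ C * ‖d‖ ^ 2 + C * Real.exp (-τ / τtr) := by
  have hK := F.pos
  obtain ⟨d₀, hd₀, C, hC, asymptotics⟩ := F.exists_flow_asymptotics hg hB agree
  refine ⟨d₀, hd₀, C + K * C, by positivity, fun a d hd τ hτ => ?_⟩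
  obtain ⟨b, hb, decay⟩ := asymptotics a d hd
  have on_torus := F.flow_manifold hg agree (a + Λ a d) hτ
  refine ⟨(decay τ hτ).1, on_torus.1, ?_⟩
  rw [on_torus.2]
  have phase_error : ‖v (b + (0, τ)) - v (a + Λ a d + (0, τ))‖ ≤ K * (C * ‖d‖ ^ 2) := by
    refine (F.manifold_lip _ _).trans ?_
    rw [add_sub_add_right_eq_sub]
    gcongr
  have exp_eq_sq : Real.exp (-τ / τtr) = Real.exp (-τ / (2 * τtr)) ^ 2 := by
    have hτtr := F.τ_pos
    rw [← Real.exp_nat_mul]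
    congr 1
    push_cast
    field_simp
  have young : Real.exp (-τ / (2 * τtr)) * ‖d‖ ≤ ‖d‖ ^ 2 + Real.exp (-τ / τtr) := by
    rw [exp_eq_sq]
    nlinarith [sq_nonneg (Real.exp (-τ / (2 * τtr)) - ‖d‖),
      sq_nonneg (Real.exp (-τ / (2 * τtr)) + ‖d‖)]
  calc _ ≤ ‖flow g (T * τ) (v a + d) - v (b + (0, τ))‖
        + ‖v (b + (0, τ)) - v (a + Λ a d + (0, τ))‖ := norm_sub_le_norm_sub_add_norm_sub _ _ _
    _ ≤ C * (‖d‖ ^ 2 + Real.exp (-τ / τtr)) + K * (C * ‖d‖ ^ 2) := by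
      refine add_le_add ((decay τ hτ).2.trans ?_) phase_error
      rw [mul_assoc]
      gcongr
    _ ≤ _ := by
      have : 0 ≤ K * C * Real.exp (-τ / τtr) := by positivity
      linarith

theorem tendsto_flow_sub_flow_iff (F : AttractingTorus gt T τtr v A Λ K)
    (hg : LocallyLipschitz g) (agree : ∀ b x, ‖x - v b‖ ≤ 1 → gt x = g x) (x : Vec n)
    (c : ℝ × ℝ) :
    Tendsto (fun τ => flow g (T * τ) x - flow g (T * τ) (v c)) atTop (𝓝 0) ↔
      Tendsto (fun τ => flow g (T * τ) x - v (c + (0, τ))) atTop (𝓝 0) := by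
  refine tendsto_congr' ?_
  filter_upwards [eventually_ge_atTop 0] with τ hτ
  rw [(F.flow_manifold hg agree c hτ).2]

theorem exists_unique_asymptotic_phase (F : AttractingTorus gt T τtr v A Λ K)
    (hg : LocallyLipschitz g) (hB : ∀ x, ‖gt x‖ ≤ B)
    (agree : ∀ b x, ‖x - v b‖ ≤ 1 → gt x = g x) :
    ∃ d₀ > 0, ∃ r > 0, ∃ C > 0, ∀ (a : ℝ × ℝ) (d : Vec n), ‖d‖ ≤ d₀ → ∃ b,
      ((∀ τ ≥ 0, FlowDefined g (T * τ) (v a + d)) ∧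
        Tendsto (fun τ => flow g (T * τ) (v a + d) - flow g (T * τ) (v b)) atTop (𝓝 0)) ∧
      ‖b - a‖ ≤ r ∧ ‖b - (a + Λ a d)‖ ≤ C * ‖d‖ ^ 2 ∧
      ∀ c, Tendsto (fun τ => flow g (T * τ) (v a + d) - flow g (T * τ) (v c)) atTop (𝓝 0) →
        ‖c - a‖ ≤ r → c = b := by
  have hτtr := F.τ_pos
  have hK := F.pos
  obtain ⟨d₁, hd₁, C, hC, asymptotics⟩ := F.exists_flow_asymptotics hg hB agree
  set r := 1 / (8 * K) with hr
  have hr_pos : 0 < r := by positivity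
  have hr_add : r + r = 1 / (4 * K) := by rw [hr]; field_simp; norm_num
  obtain ⟨d₀, hd₀, hd₀_one, hd₀_d₁, hd₀_r⟩ := exists_pos_le_one_mul_le hd₁ hr_pos 1 (K + C)
  refine ⟨d₀, hd₀, r, hr_pos, C, by positivity, fun a d hd => ?_⟩
  obtain ⟨b, hb, decay⟩ := asymptotics a d (by linarith)
  have near : ‖b - a‖ ≤ r :=
    calc ‖b - a‖ = ‖(b - (a + Λ a d)) + Λ a d‖ := by congr 1; abel
      _ ≤ C * ‖d‖ ^ 2 + K * ‖d‖ := norm_add_le_of_le hb (F.norm_apply_le a d)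
      _ ≤ C * ‖d‖ + K * ‖d‖ := by
        gcongr
        exact pow_le_of_le_one (norm_nonneg _) (hd.trans hd₀_one) two_ne_zero
      _ = (K + C) * ‖d‖ := by ring
      _ ≤ r := (mul_le_mul_of_nonneg_left hd (by positivity)).trans hd₀_r
  have convergence : Tendsto (fun τ => flow g (T * τ) (v a + d) - v (b + (0, τ))) atTop (𝓝 0) := by
    have exp_tendsto : Tendsto (fun τ => Real.exp (-τ / (2 * τtr))) atTop (𝓝 0) :=
      Real.tendsto_exp_atBot.comp (tendsto_neg_atTop_atBot.atBot_div_const (by positivity))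
    refine squeeze_zero_norm' ?_ (by simpa using (exp_tendsto.const_mul C).mul_const ‖d‖)
    filter_upwards [eventually_ge_atTop 0] with τ hτ using (decay τ hτ).2
  refine ⟨b, ⟨fun τ hτ => (decay τ hτ).1, (F.tendsto_flow_sub_flow_iff hg agree _ b).2 convergence⟩,
    near, hb, fun c hc hca => F.eq_of_tendsto_sub ?_ ?_⟩
  · rw [← sub_sub_sub_cancel_right c b a, ← hr_add]
    exact (norm_sub_le _ _).trans (add_le_add hca near)
  · have := convergence.sub ((F.tendsto_flow_sub_flow_iff hg agree _ c).1 hc)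
    rw [sub_zero] at this
    exact this.congr fun τ => sub_sub_sub_cancel_left _ _ _

end

section Coordinates

variable {n : ℕ} {g gt : Vec n → Vec n} {T τtr K B : ℝ} {v lT lρ : ℝ → ℝ → Vec n}
    {A : ℝ × ℝ → Vec n →L[ℝ] Vec n} {Λ : ℝ × ℝ → Vec n →L[ℝ] ℝ × ℝ}

theorem norm_sub_le_iff {c c' : ℝ × ℝ} {r : ℝ} :
    ‖c - c'‖ ≤ r ↔ |c.1 - c'.1| ≤ r ∧ |c.2 - c'.2| ≤ r := by
  rw [Prod.norm_def, max_le_iff]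
  rfl

theorem isPhase_iff (hT : T ≠ 0)
    (hΛ : ∀ b y, Λ b y = (-inner ℝ (lρ b.1 b.2) y, inner ℝ (lT b.1 b.2) y / T)) {x : Vec n}
    {b : ℝ × ℝ} :
    IsPhase (fun b => v b.1 b.2) Λ x b ↔ inner ℝ (lT b.1 b.2) (x - v b.1 b.2) = 0 ∧
      inner ℝ (lρ b.1 b.2) (x - v b.1 b.2) = 0 := by
  rw [IsPhase, hΛ, Prod.mk_eq_zero, neg_eq_zero, div_eq_zero_iff, or_iff_left hT, and_comm]

theorem perturbed_phase_dynamics (F : AttractingTorus gt T τtr (fun b => v b.1 b.2) A Λ K)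
    (hg : LocallyLipschitz g) (hB : ∀ x, ‖gt x‖ ≤ B)
    (agree : ∀ (b : ℝ × ℝ) x, ‖x - v b.1 b.2‖ ≤ 1 → gt x = g x)
    (hΛ : ∀ b y, Λ b y = (-inner ℝ (lρ b.1 b.2) y, inner ℝ (lT b.1 b.2) y / T)) :
    ∃ ε₀ > 0, ∃ r > 0, ∃ C > 0, ∀ ε : ℝ, ε ≤ ε₀ →
      ∀ dode : ℝ → Vec n, ContinuousOn dode (Ici 0) → (∀ τ ≥ 0, ‖dode τ‖ ≤ ε) →
      ∀ (φ₀ σ₀ : ℝ) (x₀ : Vec n), ‖x₀ - v φ₀ σ₀‖ ≤ ε →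
        (∃ x, IsPerturbedTrajectory g T dode x₀ x) ∧
        ∀ x, IsPerturbedTrajectory g T dode x₀ x →
          ∃ φ σ : ℝ → ℝ,
            IsPhaseDecomposition v lT lρ x φ σ ∧ |φ 0 - φ₀| ≤ r ∧ |σ 0 - σ₀| ≤ r ∧
            DifferentiableOn ℝ φ (Ici 0) ∧ DifferentiableOn ℝ σ (Ici 0) ∧
            (∀ τ ≥ 0,
              ‖x τ - v (φ τ) (σ τ)‖ ≤ C * ε ∧
              |derivWithin φ (Ici 0) τ - -inner ℝ (lρ (φ τ) (σ τ)) (dode τ)| ≤ C * ε ^ 2 ∧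
              |derivWithin σ (Ici 0) τ - (1 + inner ℝ (lT (φ τ) (σ τ)) (dode τ) / T)|
                ≤ C * ε ^ 2) ∧
            ∀ φ' σ' : ℝ → ℝ, IsPhaseDecomposition v lT lρ x φ' σ' →
              |φ' 0 - φ₀| ≤ r → |σ' 0 - σ₀| ≤ r → EqOn φ' φ (Ici 0) ∧ EqOn σ' σ (Ici 0) := by
  obtain ⟨d, hd, r, hr, C, hC, dynamics⟩ := F.exists_forced_phase_dynamics hg hB agree
  refine ⟨d, hd, r, hr, C, hC, fun ε hε dode hdode hdode_le φ₀ σ₀ x₀ hx₀ => ?_⟩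
  obtain ⟨exists_solution, phases⟩ := dynamics ε hε dode hdode hdode_le (φ₀, σ₀) x₀ hx₀
  refine ⟨exists_solution, fun x hx => ?_⟩
  obtain ⟨b, b_cont, hb, hb₀, velocity, unique⟩ := phases x hx
  choose! b' hb' velocity using velocity
  have fst_deriv : ∀ t ≥ 0, HasDerivWithinAt (fun t => (b t).1) (b' t).1 (Ici 0) t := fun t ht =>
    (ContinuousLinearMap.fst ℝ ℝ ℝ).hasFDerivAt.comp_hasDerivWithinAt t (hb' t ht)
  have snd_deriv : ∀ t ≥ 0, HasDerivWithinAt (fun t => (b t).2) (b' t).2 (Ici 0) t := fun t ht =>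
    (ContinuousLinearMap.snd ℝ ℝ ℝ).hasFDerivAt.comp_hasDerivWithinAt t (hb' t ht)
  have phase_iff := fun t (b : ℝ × ℝ) =>
    isPhase_iff (v := v) (x := x t) (b := b) F.T_pos.ne' hΛ
  refine ⟨fun t => (b t).1, fun t => (b t).2, ⟨b_cont.fst, b_cont.snd, fun t ht =>
    (phase_iff t _).1 (hb t ht).1⟩, (norm_sub_le_iff.1 hb₀).1, (norm_sub_le_iff.1 hb₀).2,
    fun t ht => (fst_deriv t ht).differentiableWithinAt,
    fun t ht => (snd_deriv t ht).differentiableWithinAt,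
    fun t ht => ⟨(hb t ht).2, ?_⟩, fun φ' σ' decomposition hφ hσ => ?_⟩
  · have unique_diff : UniqueDiffWithinAt ℝ (Ici (0 : ℝ)) t := uniqueDiffOn_Ici 0 t ht
    rw [(fst_deriv t ht).derivWithin unique_diff, (snd_deriv t ht).derivWithin unique_diff]
    simpa [hΛ, sub_sub] using norm_sub_le_iff.1 (velocity t ht)
  · have := unique (fun t => (φ' t, σ' t)) (decomposition.1.prodMk decomposition.2.1)
      (fun t ht => (phase_iff t _).2 (decomposition.2.2 t ht)) (norm_sub_le_iff.2 ⟨hφ, hσ⟩)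
    exact ⟨fun t ht => congrArg Prod.fst (this ht), fun t ht => congrArg Prod.snd (this ht)⟩

theorem mk_add_apply_eq
    (hΛ : ∀ b y, Λ b y = (-inner ℝ (lρ b.1 b.2) y, inner ℝ (lT b.1 b.2) y / T)) (φ σ : ℝ)
    (d : Vec n) :
    (φ, σ) + Λ (φ, σ) d = (φ - inner ℝ (lρ φ σ) d, σ + inner ℝ (lT φ σ) d / T) := by
  rw [hΛ]
  simp [sub_eq_add_neg]

theorem flow_comparison (F : AttractingTorus gt T τtr (fun b => v b.1 b.2) A Λ K)
    (hg : LocallyLipschitz g) (hB : ∀ x, ‖gt x‖ ≤ B)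
    (agree : ∀ (b : ℝ × ℝ) x, ‖x - v b.1 b.2‖ ≤ 1 → gt x = g x)
    (hΛ : ∀ b y, Λ b y = (-inner ℝ (lρ b.1 b.2) y, inner ℝ (lT b.1 b.2) y / T)) :
    ∃ d₀ > 0, ∃ C > 0, ∀ (φ₀ σ₀ : ℝ) (d : Vec n), ‖d‖ ≤ d₀ → ∀ τ ≥ 0,
      FlowDefined g (T * τ) (v φ₀ σ₀ + d) ∧
      FlowDefined g (T * τ)
        (v (φ₀ - inner ℝ (lρ φ₀ σ₀) d) (σ₀ + inner ℝ (lT φ₀ σ₀) d / T)) ∧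
      ‖flow g (T * τ) (v φ₀ σ₀ + d) -
        flow g (T * τ)
          (v (φ₀ - inner ℝ (lρ φ₀ σ₀) d) (σ₀ + inner ℝ (lT φ₀ σ₀) d / T))‖
        ≤ C * ‖d‖ ^ 2 + C * Real.exp (-τ / τtr) := by
  obtain ⟨d₀, hd₀, C, hC, comparison⟩ := F.exists_flow_comparison hg hB agree
  refine ⟨d₀, hd₀, C, hC, fun φ₀ σ₀ d hd τ hτ => ?_⟩
  simpa only [mk_add_apply_eq hΛ] using comparison (φ₀, σ₀) d hd τ hτ

theorem asymptotic_phase_linearization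
    (F : AttractingTorus gt T τtr (fun b => v b.1 b.2) A Λ K)
    (hg : LocallyLipschitz g) (hB : ∀ x, ‖gt x‖ ≤ B)
    (agree : ∀ (b : ℝ × ℝ) x, ‖x - v b.1 b.2‖ ≤ 1 → gt x = g x)
    (hΛ : ∀ b y, Λ b y = (-inner ℝ (lρ b.1 b.2) y, inner ℝ (lT b.1 b.2) y / T)) :
    ∃ d₀ > 0, ∃ r > 0, ∃ C > 0, ∀ (φ₀ σ₀ : ℝ) (d : Vec n), ‖d‖ ≤ d₀ →
      ∃ φs σs : ℝ, IsAsymptoticPhase g T v (v φ₀ σ₀ + d) φs σs ∧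
        |φs - φ₀| ≤ r ∧ |σs - σ₀| ≤ r ∧
        |φs - (φ₀ - inner ℝ (lρ φ₀ σ₀) d)| ≤ C * ‖d‖ ^ 2 ∧
        |σs - (σ₀ + inner ℝ (lT φ₀ σ₀) d / T)| ≤ C * ‖d‖ ^ 2 ∧
        ∀ φ' σ' : ℝ, IsAsymptoticPhase g T v (v φ₀ σ₀ + d) φ' σ' →
          |φ' - φ₀| ≤ r → |σ' - σ₀| ≤ r → φ' = φs ∧ σ' = σs := by
  obtain ⟨d₀, hd₀, r, hr, C, hC, phases⟩ := F.exists_unique_asymptotic_phase hg hB agree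
  refine ⟨d₀, hd₀, r, hr, C, hC, fun φ₀ σ₀ d hd => ?_⟩
  obtain ⟨b, hb, near, linearization, unique⟩ := phases (φ₀, σ₀) d hd
  rw [mk_add_apply_eq hΛ, norm_sub_le_iff] at linearization
  rw [norm_sub_le_iff] at near
  refine ⟨b.1, b.2, hb, near.1, near.2, linearization.1, linearization.2, ?_⟩
  intro φ' σ' asymptotic hφ hσ
  exact Prod.ext_iff.1 (unique (φ', σ') asymptotic.2 (norm_sub_le_iff.2 ⟨hφ, hσ⟩))

end Coordinates

end AttractingTorus

/-- Functions on the torus with rotation number `ρ`, written on the universal cover `ℝ × ℝ` with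
coordinates (angle, time): a unit of time can be traded for a rotation of the angle by `ρ`. -/
structure TorusPeriodic {F : Type*} (ρ : ℝ) (w : ℝ × ℝ → F) : Prop where
  angle : ∀ b, w (b + (1, 0)) = w b
  time : ∀ b, w (b + (0, 1)) = w (b + (ρ, 0))

namespace TorusPeriodic

section

variable {F : Type*} {ρ : ℝ} {w : ℝ × ℝ → F}

theorem comp {G : Type*} (h : TorusPeriodic ρ w) (k : F → G) :
    TorusPeriodic ρ (fun b => k (w b)) :=
  ⟨fun b => congrArg k (h.angle b), fun b => congrArg k (h.time b)⟩

theorem add_intCast_angle (h : TorusPeriodic ρ w) (b : ℝ × ℝ) (k : ℤ) :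
    w (b + ((k : ℝ), 0)) = w b := by
  have periodic : Function.Periodic (fun φ : ℝ => w (b + (φ, 0))) 1 := fun φ => by
    convert h.angle (b + (φ, 0)) using 2
    ext <;> simp [add_assoc]
  simpa [Prod.mk_zero_zero] using periodic.int_mul_eq k

theorem add_intCast_time (h : TorusPeriodic ρ w) (b : ℝ × ℝ) (k : ℤ) :
    w (b + (0, (k : ℝ))) = w (b + (k * ρ, 0)) := by
  have periodic : Function.Periodic (fun s : ℝ => w (b + (k * ρ - s * ρ, s))) 1 := fun s => by
    convert h.time (b + (k * ρ - (s + 1) * ρ, s)) using 2 <;> ext <;> simp <;> ring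
  simpa using periodic.int_mul_eq k

theorem exists_mem_unitSquare (h : TorusPeriodic ρ w) (b : ℝ × ℝ) :
    ∃ c ∈ Icc (0 : ℝ) 1 ×ˢ Icc (0 : ℝ) 1, w c = w b := by
  set φ := b.1 + ⌊b.2⌋ * ρ
  refine ⟨(Int.fract φ, Int.fract b.2), ⟨⟨Int.fract_nonneg _, (Int.fract_lt_one _).le⟩,
    ⟨Int.fract_nonneg _, (Int.fract_lt_one _).le⟩⟩, ?_⟩
  calc w (Int.fract φ, Int.fract b.2)
      = w ((Int.fract φ, Int.fract b.2) + ((⌊φ⌋ : ℝ), 0)) := (h.add_intCast_angle _ _).symm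
    _ = w ((b.1, Int.fract b.2) + (⌊b.2⌋ * ρ, 0)) := by simp [Int.fract_add_floor, φ]
    _ = w ((b.1, Int.fract b.2) + (0, (⌊b.2⌋ : ℝ))) := (h.add_intCast_time _ _).symm
    _ = w b := by simp [Int.fract_add_floor]

end

section

variable {F : Type*} [NormedAddCommGroup F] {ρ : ℝ} {w : ℝ × ℝ → F}

theorem exists_norm_le (h : TorusPeriodic ρ w) (hw : Continuous w) :
    ∃ C ≥ 0, ∀ b, ‖w b‖ ≤ C := by
  obtain ⟨C, hC⟩ := (isCompact_Icc.prod isCompact_Icc).exists_bound_of_continuousOn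
    (hw.continuousOn (s := Icc (0 : ℝ) 1 ×ˢ Icc (0 : ℝ) 1))
  have bound : ∀ b, ‖w b‖ ≤ C := fun b => by
    obtain ⟨c, hc, hcb⟩ := h.exists_mem_unitSquare b
    exact hcb ▸ hC c hc
  exact ⟨C, (norm_nonneg _).trans (bound 0), bound⟩

variable [NormedSpace ℝ F]

theorem fderiv (h : TorusPeriodic ρ w) : TorusPeriodic ρ (fderiv ℝ w) where
  angle b := by rw [← fderiv_comp_add_right, funext h.angle]
  time b := by rw [← fderiv_comp_add_right, ← fderiv_comp_add_right, funext h.time]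

theorem exists_lipschitz (h : TorusPeriodic ρ w) (hw : ContDiff ℝ 1 w) :
    ∃ C ≥ 0, ∀ b b', ‖w b' - w b‖ ≤ C * ‖b' - b‖ := by
  obtain ⟨C, hC, bound⟩ := h.fderiv.exists_norm_le (hw.continuous_fderiv one_ne_zero)
  exact ⟨C, hC, fun b b' => convex_univ.norm_image_sub_le_of_norm_fderiv_le
    (fun x _ => hw.differentiable one_ne_zero x) (fun x _ => bound x) (mem_univ b) (mem_univ b')⟩

end

end TorusPeriodic

theorem norm_taylor_le_of_lipschitz_fderiv {E G : Type*} [NormedAddCommGroup E] [NormedSpace ℝ E]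
    [NormedAddCommGroup G] [NormedSpace ℝ G] {w : E → G} (hw : Differentiable ℝ w) {C : ℝ}
    (hC : 0 ≤ C) (hlip : ∀ b b', ‖fderiv ℝ w b' - fderiv ℝ w b‖ ≤ C * ‖b' - b‖) (b b' : E) :
    ‖w b' - w b - fderiv ℝ w b (b' - b)‖ ≤ C * ‖b' - b‖ ^ 2 := by
  have fderiv_bound : ∀ x ∈ segment ℝ b b', ‖fderiv ℝ w x - fderiv ℝ w b‖ ≤ C * ‖b' - b‖ :=
    fun x hx => (hlip b x).trans (by gcongr; simpa using norm_sub_le_of_mem_segment hx)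
  refine ((convex_segment b b').norm_image_sub_le_of_norm_hasFDerivWithin_le' (𝕜 := ℝ)
    (fun x _ => (hw x).hasFDerivAt.hasFDerivWithinAt) fderiv_bound (left_mem_segment ℝ b b')
    (right_mem_segment ℝ b b')).trans_eq ?_
  rw [mul_assoc, sq]

theorem eq_const_of_irrational_periods {F : Type*} [TopologicalSpace F] [T2Space F] {m : ℝ → F}
    (hm : Continuous m) {ρ : ℝ} (hρ : Irrational ρ) (one_periodic : Function.Periodic m 1)
    (ρ_periodic : Function.Periodic m ρ) (φ : ℝ) : m φ = m 0 := by
  have dense : Dense (AddSubgroup.closure {ρ, 1} : Set ℝ) := by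
    rwa [dense_addSubgroupClosure_pair_iff, div_one]
  have periodic : ∀ x ∈ AddSubgroup.closure {ρ, (1 : ℝ)}, Function.Periodic m x := fun x hx => by
    induction hx using AddSubgroup.closure_induction with
    | mem x hx => rcases hx with rfl | rfl <;> assumption
    | zero => simp [Function.Periodic]
    | add x y _ _ hx hy => exact hx.add_period hy
    | neg x _ hx => exact hx.neg
  exact congrFun (hm.ext_on dense continuous_const fun x hx => (periodic x hx).eq) φ

section Line

variable {F : Type*} [NormedAddCommGroup F] [NormedSpace ℝ F] {w : ℝ × ℝ → F}
  {w' : ℝ × ℝ →L[ℝ] F} {b : ℝ × ℝ} {s : ℝ}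

theorem hasDerivAt_comp_add_angle (h : HasFDerivAt w w' (b + (s, 0))) :
    HasDerivAt (fun s : ℝ => w (b + (s, 0))) (w' (1, 0)) s :=
  h.comp_hasDerivAt s (((hasDerivAt_id s).prodMk (hasDerivAt_const s 0)).const_add b)

theorem hasDerivAt_comp_add_time (h : HasFDerivAt w w' (b + (0, s))) :
    HasDerivAt (fun s : ℝ => w (b + (0, s))) (w' (0, 1)) s :=
  h.comp_hasDerivAt s (((hasDerivAt_const s 0).prodMk (hasDerivAt_id s)).const_add b)

end Line

namespace IsTorusSolution

variable {n : ℕ} {g : Vec n → Vec n} {T ρ : ℝ} {v : ℝ → ℝ → Vec n}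

theorem torusPeriodic (hv : IsTorusSolution g T ρ v) : TorusPeriodic ρ (Function.uncurry v) where
  angle b := by simpa [Function.uncurry] using hv.periodic b.1 b.2
  time b := by simpa [Function.uncurry] using hv.bc b.1 b.2

theorem dtau_eq (hv : IsTorusSolution g T ρ v) (φ τ : ℝ) :
    dtau v φ τ = fderiv ℝ (Function.uncurry v) (φ, τ) (0, 1) := by
  have := hasDerivAt_comp_add_time (b := (φ, 0)) (s := τ)
    (hv.smooth.differentiable two_ne_zero _).hasFDerivAt
  simp only [Prod.mk_add_mk, add_zero, zero_add] at this
  exact this.deriv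

theorem dphi_eq (hv : IsTorusSolution g T ρ v) (φ τ : ℝ) :
    dphi v φ τ = fderiv ℝ (Function.uncurry v) (φ, τ) (1, 0) := by
  have := hasDerivAt_comp_add_angle (b := (0, τ)) (s := φ)
    (hv.smooth.differentiable two_ne_zero _).hasFDerivAt
  simp only [Prod.mk_add_mk, add_zero, zero_add] at this
  exact this.deriv

theorem fderiv_time (hv : IsTorusSolution g T ρ v) (b : ℝ × ℝ) :
    fderiv ℝ (Function.uncurry v) b (0, 1) = T • g (v b.1 b.2) :=
  (hv.dtau_eq b.1 b.2).symm.trans (hv.ode b.1 b.2).deriv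

theorem hasDerivAt_time (hv : IsTorusSolution g T ρ v) (b : ℝ × ℝ) (s : ℝ) :
    HasDerivAt (fun s : ℝ => Function.uncurry v (b + (0, s)))
      (T • g (Function.uncurry v (b + (0, s)))) s := by
  have := hasDerivAt_comp_add_time (hv.smooth.differentiable two_ne_zero (b + (0, s))).hasFDerivAt
  rwa [hv.fderiv_time] at this

theorem differentiable_fderiv (hv : IsTorusSolution g T ρ v) :
    Differentiable ℝ (fderiv ℝ (Function.uncurry v)) :=
  (hv.smooth.fderiv_right (m := 1) (by norm_num)).differentiable one_ne_zero

theorem fderiv_fderiv_time (hv : IsTorusSolution g T ρ v) (hg : Differentiable ℝ g)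
    (b c : ℝ × ℝ) :
    fderiv ℝ (fderiv ℝ (Function.uncurry v)) b (0, 1) c =
      T • fderiv ℝ g (Function.uncurry v b) (fderiv ℝ (Function.uncurry v) b c) := by
  set u := Function.uncurry v
  have fderiv_of_fderiv : HasFDerivAt (fun b => fderiv ℝ u b (0, 1))
      ((fderiv ℝ (fderiv ℝ u) b).flip (0, 1)) b := by
    simpa using (hv.differentiable_fderiv b).hasFDerivAt.clm_apply (hasFDerivAt_const (0, 1) b)
  have fderiv_of_field : HasFDerivAt (fun b => T • g (u b))
      (T • (fderiv ℝ g (u b)).comp (fderiv ℝ u b)) b :=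
    ((hg _).hasFDerivAt.comp b (hv.smooth.differentiable two_ne_zero b).hasFDerivAt).const_smul T
  have symmetric : IsSymmSndFDerivAt ℝ u b := hv.smooth.contDiffAt.isSymmSndFDerivAt (by simp)
  rw [symmetric.eq]
  exact DFunLike.congr_fun (fderiv_of_fderiv.unique
    (fderiv_of_field.congr_of_eventuallyEq (.of_forall hv.fderiv_time))) c

theorem hasDerivAt_tangent (hv : IsTorusSolution g T ρ v) (hg : Differentiable ℝ g)
    (c b : ℝ × ℝ) (s : ℝ) :
    HasDerivAt (fun s : ℝ => fderiv ℝ (Function.uncurry v) (b + (0, s)) c)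
      (T • fderiv ℝ g (Function.uncurry v (b + (0, s)))
        (fderiv ℝ (Function.uncurry v) (b + (0, s)) c)) s := by
  rw [← hv.fderiv_fderiv_time hg]
  simpa using (hasDerivAt_comp_add_time
    (hv.differentiable_fderiv (b + (0, s))).hasFDerivAt).clm_apply (hasDerivAt_const s c)

end IsTorusSolution

theorem hasDerivAt_of_forall_Icc_int {F : Type*} [NormedAddCommGroup F] [NormedSpace ℝ F]
    {u u' : ℝ → F}
    (h : ∀ (k : ℤ), ∀ s ∈ Icc (k : ℝ) (k + 1), HasDerivWithinAt u (u' s) (Icc (k : ℝ) (k + 1)) s)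
    (s : ℝ) : HasDerivAt u (u' s) s := by
  have right := h ⌊s⌋ s ⟨Int.floor_le s, (Int.lt_floor_add_one s).le⟩
  have ceil_lt : ((⌈s⌉ - 1 : ℤ) : ℝ) < s := by push_cast; linarith [Int.ceil_lt_add_one s]
  have left := h (⌈s⌉ - 1) s ⟨ceil_lt.le, by push_cast; linarith [Int.le_ceil s]⟩
  refine (left.union right).hasDerivAt ?_
  refine mem_of_superset (Ioo_mem_nhds ceil_lt (Int.lt_floor_add_one s)) fun r hr => ?_
  rcases le_total r s with hrs | hrs
  · exact Or.inl ⟨hr.1.le, by push_cast; linarith [Int.le_ceil s]⟩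
  · exact Or.inr ⟨(Int.floor_le s).trans hrs, hr.2.le⟩

theorem TorusPeriodic.hasDerivAt_time_of_Icc {F : Type*} [NormedAddCommGroup F] [NormedSpace ℝ F]
    {ρ : ℝ} {w w' : ℝ × ℝ → F} (hw : TorusPeriodic ρ w) (hw' : TorusPeriodic ρ w')
    (hd : ∀ φ, ∀ τ ∈ Icc (0 : ℝ) 1,
      HasDerivWithinAt (fun s => w (φ, s)) (w' (φ, τ)) (Icc 0 1) τ) (b : ℝ × ℝ) (s : ℝ) :
    HasDerivAt (fun s : ℝ => w (b + (0, s))) (w' (b + (0, s))) s := by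
  have shift : ∀ {u : ℝ × ℝ → F}, TorusPeriodic ρ u → ∀ (φ s : ℝ) (k : ℤ),
      u (φ, s) = u (φ + k * ρ, s - k) := fun hu φ s k => by
    simpa using hu.add_intCast_time (φ, s - k) k
  have on_fibre : ∀ φ τ, HasDerivAt (fun s => w (φ, s)) (w' (φ, τ)) τ := fun φ =>
    hasDerivAt_of_forall_Icc_int fun k s hs => by
      have := (hd (φ + k * ρ) (s - k) ⟨by linarith [hs.1], by linarith [hs.2]⟩).scomp s
        ((hasDerivAt_id s).sub_const (k : ℝ)).hasDerivWithinAt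
        (show MapsTo (fun r : ℝ => r - k) (Icc (k : ℝ) (k + 1)) (Icc 0 1) from
          fun r hr => ⟨by linarith [hr.1], by linarith [hr.2]⟩)
      rw [one_smul, ← shift hw'] at this
      exact this.congr_of_mem (fun r _ => shift hw φ r k) hs
  simpa [Prod.add_def] using (on_fibre b.1 (b.2 + s)).comp_const_add b.2 s

theorem intervalIntegrable_of_continuousOn_strip {G : ℝ → ℝ → ℝ}
    (hG : ContinuousOn (Function.uncurry G) (univ ×ˢ Icc 0 1)) (φ : ℝ) :
    IntervalIntegrable (G φ) MeasureTheory.volume 0 1 :=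
  ContinuousOn.intervalIntegrable_of_Icc zero_le_one <|
    hG.comp (Continuous.prodMk_right φ).continuousOn fun _ hτ => ⟨mem_univ _, hτ⟩

theorem continuous_integral_of_continuousOn_strip {G : ℝ → ℝ → ℝ}
    (hG : ContinuousOn (Function.uncurry G) (univ ×ˢ Icc 0 1)) :
    Continuous fun φ => ∫ τ in (0 : ℝ)..1, G φ τ := by
  have extended : Continuous (Function.uncurry fun φ τ : ℝ => G φ (projIcc 0 1 zero_le_one τ)) :=
    hG.comp_continuous (f := fun b : ℝ × ℝ => (b.1, (projIcc (0 : ℝ) 1 zero_le_one b.2 : ℝ)))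
      (by fun_prop) fun b => ⟨mem_univ _, Subtype.coe_prop _⟩
  refine (intervalIntegral.continuous_parametric_intervalIntegral_of_continuous'
    (μ := MeasureTheory.volume) extended 0 1).congr fun φ =>
      intervalIntegral.integral_congr fun τ hτ => ?_
  rw [uIcc_of_le zero_le_one] at hτ
  exact congrArg (G φ) (congrArg Subtype.val (projIcc_of_mem zero_le_one hτ))

theorem integral_comp_add_sub_eq_zero {m : ℝ → ℝ} (hm : Continuous m)
    (periodic : Function.Periodic m 1) (ρ : ℝ) : ∫ φ in (0 : ℝ)..1, (m (φ + ρ) - m φ) = 0 := by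
  have translate := periodic.intervalIntegral_add_eq ρ 0
  rw [zero_add, add_comm ρ] at translate
  rw [intervalIntegral.integral_sub (f := fun φ => m (φ + ρ))
    ((hm.comp (continuous_add_const ρ)).intervalIntegrable 0 1) (hm.intervalIntegrable 0 1),
    intervalIntegral.integral_comp_add_right, zero_add, translate, sub_self]

section Adjoint

variable {n q : ℕ} {f : Vec n → Vec q → Vec n} {p : Vec q} {T ρ : ℝ} {v : ℝ → ℝ → Vec n}
  {h : (ℝ → ℝ → Vec n) → Vec q → Fin 2 → ℝ} {Dv : Fin 2 → ℝ → ℝ → Vec n} {Dp : Fin 2 → Vec q}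
  {ηρ ηT : ℝ} {lde : ℝ → ℝ → Vec n} {lbc : ℝ → Vec n} {lps : Fin 2 → ℝ} {ηp : Vec q}

theorem IsAdjointSolution.torusPeriodic
    (hl : IsAdjointSolution f p T ρ v Dv Dp ηρ ηT lde lbc lps ηp) :
    TorusPeriodic ρ (Function.uncurry lde) where
  angle b := by simpa [Function.uncurry] using hl.periodic b.1 b.2
  time b := by simpa [Function.uncurry] using hl.shift b.1 b.2

theorem IsAdjointSolution.sum_multiplier_integral_inner
    (hl : IsAdjointSolution f p T ρ v Dv Dp ηρ ηT lde lbc lps ηp) {φ : ℝ} {y : ℝ → Vec n}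
    (hy : ∀ τ, HasDerivAt y (T • fderiv ℝ (fun x => f x p) (v φ τ) (y τ)) τ)
    (integrable : ∀ i, IntervalIntegrable (fun τ => inner ℝ (Dv i φ τ) (y τ))
      MeasureTheory.volume 0 1) :
    ∑ i, lps i * ∫ τ in (0 : ℝ)..1, inner ℝ (Dv i φ τ) (y τ) =
      inner ℝ (lde φ 1) (y 1) - inner ℝ (lde φ 0) (y 0) := by
  have deriv_inner : ∀ τ ∈ Icc (0 : ℝ) 1, HasDerivWithinAt (fun s => inner ℝ (lde φ s) (y s))
      (∑ i, lps i * inner ℝ (Dv i φ τ) (y τ)) (Icc 0 1) τ := fun τ hτ => by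
    refine ((hl.var_v φ τ hτ).inner ℝ (hy τ).hasDerivWithinAt).congr_deriv ?_
    rw [inner_add_left, inner_neg_left, inner_smul_left, inner_smul_right,
      ContinuousLinearMap.adjoint_inner_left, sum_inner]
    simp [inner_smul_left]
  have scaled := fun i => (integrable i).const_mul (lps i)
  have := intervalIntegral.integral_eq_sub_of_hasDerivAt_of_le (zero_le_one' ℝ)
    (fun τ hτ => (deriv_inner τ hτ).continuousWithinAt)
    (fun τ hτ => (deriv_inner τ (Ioo_subset_Icc_self hτ)).hasDerivAt (Icc_mem_nhds hτ.1 hτ.2))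
    ((IntervalIntegrable.sum Finset.univ fun i _ => scaled i).congr fun τ _ => by simp)
  rw [← this, intervalIntegral.integral_finsetSum fun i _ => scaled i]
  simp only [intervalIntegral.integral_const_mul]

namespace IsPhaseCondition

theorem sum_multiplier_pairing_eq_zero (hh : IsPhaseCondition h v p Dv Dp)
    (hg : Differentiable ℝ (fun x => f x p)) (hv : IsTorusSolution (fun x => f x p) T ρ v)
    (hl : IsAdjointSolution f p T ρ v Dv Dp ηρ ηT lde lbc lps ηp) (c : ℝ × ℝ) :
    ∑ i, lps i * pairing (Dv i) (fun φ τ => fderiv ℝ (Function.uncurry v) (φ, τ) c) = 0 := by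
  set y : ℝ → ℝ → Vec n := fun φ τ => fderiv ℝ (Function.uncurry v) (φ, τ) c
  set m : ℝ → ℝ := fun φ => inner ℝ (lde φ 0) (y φ 0)
  have y_continuous : Continuous (Function.uncurry y) :=
    (hv.smooth.continuous_fderiv two_ne_zero).clm_apply continuous_const
  have y_deriv : ∀ φ τ, HasDerivAt (y φ)
      (T • fderiv ℝ (fun x => f x p) (v φ τ) (y φ τ)) τ := fun φ τ => by
    simpa [y, Function.uncurry] using hv.hasDerivAt_tangent hg c (φ, 0) τ
  have strip : ∀ i, ContinuousOn (Function.uncurry fun φ τ => inner ℝ (Dv i φ τ) (y φ τ))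
      (univ ×ˢ Icc 0 1) := fun i => (hh.continuousOn i).inner y_continuous.continuousOn
  have y_periodic : TorusPeriodic ρ (Function.uncurry y) :=
    hv.torusPeriodic.fderiv.comp fun L => L c
  have m_periodic : TorusPeriodic ρ
      (fun b : ℝ × ℝ => inner ℝ (Function.uncurry lde b) (Function.uncurry y b)) :=
    ⟨fun b => by rw [hl.torusPeriodic.angle, y_periodic.angle],
      fun b => by rw [hl.torusPeriodic.time, y_periodic.time]⟩
  have fibre : ∀ φ, ∑ i, lps i * ∫ τ in (0 : ℝ)..1, inner ℝ (Dv i φ τ) (y φ τ) =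
      m (φ + ρ) - m φ := fun φ => by
    have end_value : inner ℝ (lde φ 1) (y φ 1) = m (φ + ρ) := by
      simpa using m_periodic.time (φ, 0)
    rw [hl.sum_multiplier_integral_inner (y_deriv φ) fun i =>
      intervalIntegrable_of_continuousOn_strip (strip i) φ, end_value]
  calc ∑ i, lps i * pairing (Dv i) y
      = ∫ φ in (0 : ℝ)..1, ∑ i, lps i * ∫ τ in (0 : ℝ)..1, inner ℝ (Dv i φ τ) (y φ τ) := by
        rw [intervalIntegral.integral_finsetSum fun i _ =>
          ((continuous_integral_of_continuousOn_strip (strip i)).const_mul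
            (lps i)).intervalIntegrable 0 1]
        simp only [intervalIntegral.integral_const_mul, pairing]
    _ = ∫ φ in (0 : ℝ)..1, (m (φ + ρ) - m φ) := by simp only [fibre]
    _ = 0 := integral_comp_add_sub_eq_zero
        ((hl.continuous.comp (Continuous.prodMk_left 0)).inner
          (y_continuous.comp (Continuous.prodMk_left 0)))
        (fun φ => by simpa using m_periodic.angle (φ, 0)) ρ

theorem multiplier_eq_zero (hh : IsPhaseCondition h v p Dv Dp)
    (hg : Differentiable ℝ (fun x => f x p)) (hv : IsTorusSolution (fun x => f x p) T ρ v)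
    (hl : IsAdjointSolution f p T ρ v Dv Dp ηρ ηT lde lbc lps ηp) : lps = 0 := by
  refine Matrix.eq_zero_of_vecMul_eq_zero hh.nondegenerate (funext fun j => ?_)
  fin_cases j
  · simpa [Matrix.vecMul, dotProduct, ← hv.dtau_eq] using
      hh.sum_multiplier_pairing_eq_zero hg hv hl (0, 1)
  · simpa [Matrix.vecMul, dotProduct, ← hv.dphi_eq] using
      hh.sum_multiplier_pairing_eq_zero hg hv hl (1, 0)

theorem hasDerivAt_adjoint (hh : IsPhaseCondition h v p Dv Dp)
    (hg : Differentiable ℝ (fun x => f x p)) (hv : IsTorusSolution (fun x => f x p) T ρ v)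
    (hl : IsAdjointSolution f p T ρ v Dv Dp ηρ ηT lde lbc lps ηp) (b : ℝ × ℝ) (s : ℝ) :
    HasDerivAt (fun s : ℝ => Function.uncurry lde (b + (0, s)))
      (-(T • ContinuousLinearMap.adjoint
        (fderiv ℝ (fun x => f x p) (Function.uncurry v (b + (0, s))))
        (Function.uncurry lde (b + (0, s))))) s := by
  have adjoint_periodic : TorusPeriodic ρ fun b => -(T • ContinuousLinearMap.adjoint
      (fderiv ℝ (fun x => f x p) (Function.uncurry v b)) (Function.uncurry lde b)) :=
    ⟨fun b => by simp only [hv.torusPeriodic.angle, hl.torusPeriodic.angle],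
      fun b => by simp only [hv.torusPeriodic.time, hl.torusPeriodic.time]⟩
  refine hl.torusPeriodic.hasDerivAt_time_of_Icc adjoint_periodic (fun φ τ hτ => ?_) b s
  simpa [hh.multiplier_eq_zero hg hv hl, Function.uncurry] using hl.var_v φ τ hτ

/-- `⟪λ, ∂v⟫` is invariant under the flow, hence under the irrational rotation by `ρ`. -/
theorem inner_adjoint_tangent_eq (hh : IsPhaseCondition h v p Dv Dp) (hρ : Irrational ρ)
    (hg : Differentiable ℝ (fun x => f x p)) (hv : IsTorusSolution (fun x => f x p) T ρ v)
    (hl : IsAdjointSolution f p T ρ v Dv Dp ηρ ηT lde lbc lps ηp) (c b : ℝ × ℝ) :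
    inner ℝ (Function.uncurry lde b) (fderiv ℝ (Function.uncurry v) b c) =
      inner ℝ (Function.uncurry lde 0) (fderiv ℝ (Function.uncurry v) 0 c) := by
  set M : ℝ × ℝ → ℝ := fun b =>
    inner ℝ (Function.uncurry lde b) (fderiv ℝ (Function.uncurry v) b c) with hM
  have M_periodic : TorusPeriodic ρ M :=
    ⟨fun b => by simp only [hM, hv.torusPeriodic.fderiv.angle, hl.torusPeriodic.angle],
      fun b => by simp only [hM, hv.torusPeriodic.fderiv.time, hl.torusPeriodic.time]⟩
  have M_continuous : Continuous M := hl.continuous.inner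
    ((hv.smooth.continuous_fderiv two_ne_zero).clm_apply continuous_const)
  have M_deriv : ∀ b (s : ℝ), HasDerivAt (fun s : ℝ => M (b + (0, s))) 0 s := fun b s => by
    refine ((hh.hasDerivAt_adjoint hg hv hl b s).inner ℝ
      (hv.hasDerivAt_tangent hg c b s)).congr_deriv ?_
    rw [inner_neg_left, inner_smul_left, inner_smul_right,
      ContinuousLinearMap.adjoint_inner_left]
    simp
  have flow_invariant : ∀ b (s : ℝ), M (b + (0, s)) = M b := fun b s => by
    simpa [Prod.mk_zero_zero] using is_const_of_deriv_eq_zero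
      (fun s => (M_deriv b s).differentiableAt) (fun s => (M_deriv b s).deriv) s 0
  have rotation_invariant : ∀ φ, M (φ, 0) = M (0, 0) :=
    eq_const_of_irrational_periods (m := fun φ => M (φ, 0))
      (M_continuous.comp (Continuous.prodMk_left 0)) hρ
      (fun φ => by simpa using M_periodic.angle (φ, 0))
      fun φ => by
        have := M_periodic.time (φ, 0)
        rw [flow_invariant] at this
        simpa using this.symm
  calc M b = M ((b.1, 0) + (0, b.2)) := by simp
    _ = M 0 := (flow_invariant _ _).trans (rotation_invariant _)

theorem inner_adjoint_time (hh : IsPhaseCondition h v p Dv Dp) (hT : 0 < T) (hρ : Irrational ρ)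
    (hg : Differentiable ℝ (fun x => f x p)) (hv : IsTorusSolution (fun x => f x p) T ρ v)
    (hl : IsAdjointSolution f p T ρ v Dv Dp ηρ ηT lde lbc lps ηp) (b : ℝ × ℝ) :
    inner ℝ (Function.uncurry lde b) (fderiv ℝ (Function.uncurry v) b (0, 1)) = T * ηT := by
  have const := hh.inner_adjoint_tangent_eq hρ hg hv hl (0, 1)
  rw [const]
  set k := inner ℝ (Function.uncurry lde 0) (fderiv ℝ (Function.uncurry v) 0 (0, 1))
  have integrand : ∀ φ τ, inner ℝ (lde φ τ) (f (v φ τ) p) = k / T := fun φ τ => by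
    rw [eq_div_iff hT.ne', ← const (φ, τ), hv.fderiv_time, inner_smul_right, mul_comm]
    rfl
  have normalization : -(k / T) + ηT = 0 := by
    simpa only [pairing, integrand, intervalIntegral.integral_const, sub_zero, one_smul]
      using hl.var_T
  rw [← neg_add_eq_zero.1 normalization, mul_div_cancel₀ k hT.ne']

theorem inner_adjoint_angle (hh : IsPhaseCondition h v p Dv Dp) (hρ : Irrational ρ)
    (hg : Differentiable ℝ (fun x => f x p)) (hv : IsTorusSolution (fun x => f x p) T ρ v)
    (hl : IsAdjointSolution f p T ρ v Dv Dp ηρ ηT lde lbc lps ηp) (b : ℝ × ℝ) :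
    inner ℝ (Function.uncurry lde b) (fderiv ℝ (Function.uncurry v) b (1, 0)) = -ηρ := by
  have const := hh.inner_adjoint_tangent_eq hρ hg hv hl (1, 0)
  rw [const]
  have lbc_eq : ∀ φ, lbc φ = lde (φ + ρ) 0 := fun φ => by
    rw [← sub_eq_zero.1 (hl.var_v1 φ), ← hl.shift, zero_add]
  have integrand : ∀ φ, inner ℝ (lbc φ) (dphi v (φ + ρ) 0) =
      inner ℝ (Function.uncurry lde 0) (fderiv ℝ (Function.uncurry v) 0 (1, 0)) := fun φ => by
    rw [lbc_eq, hv.dphi_eq, ← const (φ + ρ, 0)]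
    rfl
  have normalization := hl.var_ρ
  simp only [integrand, intervalIntegral.integral_const, sub_zero, one_smul] at normalization
  exact eq_neg_of_add_eq_zero_left normalization

end IsPhaseCondition

end Adjoint

/-- A family of functionals `Λ` on a torus with tangent maps `D`, dual to the tangent vectors and
solving the adjoint of the variational equation `y' = T A y`. -/
structure AdjointCoframe {X : Type*} [NormedAddCommGroup X] [NormedSpace ℝ X] (T ρ : ℝ)
    (D : ℝ × ℝ → ℝ × ℝ →L[ℝ] X) (A : ℝ × ℝ → X →L[ℝ] X) (Λ : ℝ × ℝ → X →L[ℝ] ℝ × ℝ)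
    (K : ℝ) : Prop where
  T_pos : 0 < T
  one_le : 1 ≤ K
  continuous : Continuous fun q : (ℝ × ℝ) × X => Λ q.1 q.2
  periodic : TorusPeriodic ρ Λ
  norm_le : ∀ b, ‖Λ b‖ ≤ K
  hasDerivAt : ∀ (b : ℝ × ℝ) (y : ℝ → X) (y' : X) (s : ℝ), HasDerivAt y y' s →
    HasDerivAt (fun s : ℝ => Λ (b + (0, s)) (y s))
      (Λ (b + (0, s)) (y' - T • A (b + (0, s)) (y s))) s
  tangent : ∀ b c, Λ b (D b c) = c
  A_norm : ∀ b, ‖A b‖ ≤ K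
  A_lip : ∀ b b', ‖A b' - A b‖ ≤ K * ‖b' - b‖
  A_periodic : TorusPeriodic ρ A
  A_differentiable : Differentiable ℝ A
  D_norm : ∀ b, ‖D b‖ ≤ K
  D_lip : ∀ b b', ‖D b' - D b‖ ≤ K * ‖b' - b‖

/-- `y` solves the variational equation along the torus solution through `b`. -/
def IsVariational {X : Type*} [NormedAddCommGroup X] [NormedSpace ℝ X] (T : ℝ)
    (A : ℝ × ℝ → X →L[ℝ] X) (b : ℝ × ℝ) (y : ℝ → X) : Prop :=
  ∀ s, HasDerivAt y (T • A (b + (0, s)) (y s)) s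

theorem TorusPeriodic.apply_section {F : Type*} {ρ : ℝ} {w : ℝ × ℝ → F} (h : TorusPeriodic ρ w)
    (b : ℝ × ℝ) (r : ℝ) :
    w ((b.1 + ⌊b.2⌋ * ρ, 0) + (0, r)) = w (b + (0, r - Int.fract b.2)) := by
  calc w ((b.1 + ⌊b.2⌋ * ρ, 0) + (0, r)) = w ((b.1, r) + (⌊b.2⌋ * ρ, 0)) := by simp
    _ = w ((b.1, r) + (0, (⌊b.2⌋ : ℝ))) := (h.add_intCast_time _ _).symm
    _ = w (b + (0, r - Int.fract b.2)) := by
      congr 1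
      ext
      · simp
      · simp only [Prod.snd_add, ← Int.self_sub_fract]
        ring

theorem IsVariational.section {X : Type*} [NormedAddCommGroup X] [NormedSpace ℝ X] {T ρ : ℝ}
    {A : ℝ × ℝ → X →L[ℝ] X} {b : ℝ × ℝ} {y : ℝ → X} (hy : IsVariational T A b y)
    (hA : TorusPeriodic ρ A) :
    IsVariational T A (b.1 + ⌊b.2⌋ * ρ, 0) (fun r => y (r - Int.fract b.2)) := fun r => by
  rw [hA.apply_section]
  exact (hy (r - Int.fract b.2)).comp_sub_const r _

theorem integrableOn_exp_neg_div {τ : ℝ} (hτ : 0 < τ) :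
    MeasureTheory.IntegrableOn (fun s => Real.exp (-s / τ)) (Ioi (0 : ℝ)) := by
  simpa [neg_div, div_eq_inv_mul] using exp_neg_integrableOn_Ioi 0 (inv_pos.2 hτ)

theorem integral_exp_neg_div {τ : ℝ} (hτ : 0 < τ) : ∫ s in Ioi (0 : ℝ), Real.exp (-s / τ) = τ := by
  simpa [neg_div, div_eq_inv_mul] using integral_exp_mul_Ioi (neg_lt_zero.2 (inv_pos.2 hτ)) 0

theorem tendsto_exp_neg_div_atTop {τ : ℝ} (hτ : 0 < τ) :
    Tendsto (fun s => Real.exp (-s / τ)) atTop (𝓝 0) :=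
  Real.tendsto_exp_atBot.comp (tendsto_neg_atTop_atBot.atBot_div_const hτ)

namespace AdjointCoframe

variable {X : Type*} [NormedAddCommGroup X] [NormedSpace ℝ X] {T ρ : ℝ}
  {D : ℝ × ℝ → ℝ × ℝ →L[ℝ] X} {A : ℝ × ℝ → X →L[ℝ] X} {Λ : ℝ × ℝ → X →L[ℝ] ℝ × ℝ} {K : ℝ}

theorem pos (F : AdjointCoframe T ρ D A Λ K) : 0 < K := zero_lt_one.trans_le F.one_le

theorem norm_apply_le (F : AdjointCoframe T ρ D A Λ K) (b : ℝ × ℝ) (y : X) :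
    ‖Λ b y‖ ≤ K * ‖y‖ :=
  (Λ b).le_of_opNorm_le (F.norm_le b) y

theorem norm_smul_A_apply_le (F : AdjointCoframe T ρ D A Λ K) (b : ℝ × ℝ) (y : X) :
    ‖T • A b y‖ ≤ T * K * ‖y‖ := by
  rw [norm_smul, Real.norm_of_nonneg F.T_pos.le, mul_assoc]
  gcongr
  · exact F.T_pos.le
  · exact (A b).le_of_opNorm_le (F.A_norm b) y

theorem apply_variational (F : AdjointCoframe T ρ D A Λ K) {b : ℝ × ℝ} {y : ℝ → X}
    (hy : IsVariational T A b y) (s : ℝ) : Λ (b + (0, s)) (y s) = Λ b (y 0) := by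
  have deriv_zero : ∀ s, HasDerivAt (fun s : ℝ => Λ (b + (0, s)) (y s)) 0 s := fun s => by
    simpa using F.hasDerivAt b y _ s (hy s)
  simpa [Prod.mk_zero_zero] using is_const_of_deriv_eq_zero
    (fun s => (deriv_zero s).differentiableAt) (fun s => (deriv_zero s).deriv) s 0

theorem variational_unique (F : AdjointCoframe T ρ D A Λ K) {b : ℝ × ℝ} {y z : ℝ → X}
    (hy : IsVariational T A b y) (hz : IsVariational T A b z) {s : ℝ} (h : y s = z s) :
    y = z := by
  have hκ : 0 ≤ T * K := mul_nonneg F.T_pos.le F.pos.le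
  refine ODE_solution_unique_univ (v := fun s z => T • A (b + (0, s)) z) (s := fun _ => univ)
    (K := (T * K).toNNReal) (fun t => LipschitzOnWith.of_dist_le_mul fun x _ w _ => ?_)
    (fun t => ⟨hy t, mem_univ _⟩) (fun t => ⟨hz t, mem_univ _⟩) h
  rw [dist_eq_norm, dist_eq_norm, ← smul_sub, ← map_sub, Real.coe_toNNReal _ hκ]
  exact F.norm_smul_A_apply_le _ _

theorem exists_unit_time_bound (F : AdjointCoframe T ρ D A Λ K) :
    ∃ G > 0, ∀ (b : ℝ × ℝ) (y : ℝ → X), IsVariational T A b y → ∀ s r, |r| ≤ 1 →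
      ‖y (s + r)‖ ≤ G * ‖y s‖ := by
  have hκ : 0 < T * K := mul_pos F.T_pos F.pos
  refine ⟨Real.exp (T * K * 1) * (1 + 1 / (T * K)), by positivity, fun b y hy s r hr => ?_⟩
  have deriv : ∀ t, HasDerivAt (fun t => y (s + t * r))
      ((1 * r) • T • A (b + (0, s + t * r)) (y (s + t * r))) t := fun t =>
    (hy (s + t * r)).scomp t (((hasDerivAt_id t).mul_const r).const_add s)
  have bound := norm_le_exp_mul_of_norm_deriv_le (u := fun t => y (s + t * r)) (S := 1) hκ
    (norm_nonneg (y s)) le_rfl (fun t _ => (deriv t).hasDerivWithinAt) (by simp) fun t _ => by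
      rw [one_mul, norm_smul, Real.norm_eq_abs, add_zero]
      exact (mul_le_of_le_one_left (norm_nonneg _) hr).trans (F.norm_smul_A_apply_le _ _)
  simpa using bound 1 (right_mem_Icc.2 zero_le_one)

theorem exists_decay (F : AdjointCoframe T ρ D A Λ K) {τtr Ctr : ℝ} (hτ : 0 < τtr)
    (hC : 0 ≤ Ctr)
    (hdec : ∀ (φ : ℝ) (y : ℝ → X), IsVariational T A (φ, 0) y → Λ (φ, 0) (y 0) = 0 → ∀ k : ℕ,
      ‖y k‖ ≤ Ctr * Real.exp (-k / τtr) * ‖y 0‖) :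
    ∃ C ≥ 0, ∀ (b : ℝ × ℝ) (y : ℝ → X), IsVariational T A b y → Λ b (y 0) = 0 → ∀ s ≥ 0,
      ‖y s‖ ≤ C * Real.exp (-s / τtr) * ‖y 0‖ := by
  obtain ⟨G, hG, unit_time⟩ := F.exists_unit_time_bound
  refine ⟨G * (Ctr * Real.exp (1 / τtr) * G), by positivity, fun b y hy hy0 s hs => ?_⟩
  set u := Int.fract b.2
  have hu0 : 0 ≤ u := Int.fract_nonneg _
  have hu1 : u < 1 := Int.fract_lt_one _
  set η : ℝ → X := fun r => y (r - u) with hη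
  have hη_var : IsVariational T A (b.1 + ⌊b.2⌋ * ρ, 0) η := hy.section F.A_periodic
  have hη_ker : Λ (b.1 + ⌊b.2⌋ * ρ, 0) (η 0) = 0 := by
    have := F.periodic.apply_section b 0
    rw [Prod.mk_zero_zero, add_zero] at this
    rw [this, hη, F.apply_variational hy, hy0]
  have hη0 : ‖η 0‖ ≤ G * ‖y 0‖ := by
    simpa [hη] using unit_time b y hy 0 (-u) (by rw [abs_neg, abs_of_nonneg hu0]; exact hu1.le)
  set j := ⌊s + u⌋₊
  have hj : (j : ℝ) ≤ s + u := Nat.floor_le (by positivity)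
  have hj' : s + u < j + 1 := Nat.lt_floor_add_one _
  have exp_le : Real.exp (-j / τtr) ≤ Real.exp (1 / τtr) * Real.exp (-s / τtr) := by
    rw [← Real.exp_add, ← add_div]
    gcongr
    linarith
  calc ‖y s‖ = ‖η (j + (s + u - j))‖ := by simp [hη]
    _ ≤ G * ‖η j‖ := unit_time _ η hη_var j _ (abs_le.2 ⟨by linarith, by linarith⟩)
    _ ≤ G * (Ctr * (Real.exp (1 / τtr) * Real.exp (-s / τtr)) * (G * ‖y 0‖)) := by
      gcongr
      exact (hdec _ η hη_var hη_ker j).trans (by gcongr)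
    _ = G * (Ctr * Real.exp (1 / τtr) * G) * Real.exp (-s / τtr) * ‖y 0‖ := by ring

theorem norm_time_sub_le (F : AdjointCoframe T ρ D A Λ K) (b : ℝ × ℝ) (s : ℝ) (y : X) :
    ‖Λ (b + (0, s)) y - Λ b y‖ ≤ K * (T * K) * |s| * ‖y‖ := by
  have := convex_univ.norm_image_sub_le_of_norm_hasDerivWithin_le (𝕜 := ℝ)
    (f := fun s : ℝ => Λ (b + (0, s)) y) (C := K * (T * K * ‖y‖))
    (fun s _ => (F.hasDerivAt b (fun _ => y) 0 s (hasDerivAt_const s y)).hasDerivWithinAt)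
    (fun s _ => (F.norm_apply_le _ _).trans (by
      rw [zero_sub, norm_neg]
      gcongr
      · exact F.pos.le
      · exact F.norm_smul_A_apply_le _ _)) (mem_univ 0) (mem_univ s)
  rw [Prod.mk_zero_zero, add_zero, sub_zero, Real.norm_eq_abs] at this
  exact this.trans_eq (by ring)

section Increment

variable {τtr c : ℝ} {b : ℝ × ℝ} {y : ℝ → X}

/-- For a decaying variational solution `y` along `b`, the change of `Λ · (y 0)` between `b` and
`b + (h, 0)` is the integral of this function over all positive times `s`. -/
def angleIntegrand (T : ℝ) (A : ℝ × ℝ → X →L[ℝ] X) (Λ : ℝ × ℝ → X →L[ℝ] ℝ × ℝ) (b : ℝ × ℝ)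
    (y : ℝ → X) (h s : ℝ) : ℝ × ℝ :=
  Λ (b + (h, 0) + (0, s)) (T • (A (b + (h, 0) + (0, s)) - A (b + (0, s))) (y s))

theorem norm_angleIntegrand_le (F : AdjointCoframe T ρ D A Λ K)
    (hdec : ∀ s ≥ 0, ‖y s‖ ≤ c * Real.exp (-s / τtr)) (h : ℝ) {s : ℝ} (hs : 0 ≤ s) :
    ‖angleIntegrand T A Λ b y h s‖ ≤ |h| * (K * (T * (K * c)) * Real.exp (-s / τtr)) := by
  have hT := F.T_pos
  have hK := F.pos
  have A_sub : ‖A (b + (h, 0) + (0, s)) - A (b + (0, s))‖ ≤ K * |h| := by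
    refine (F.A_lip _ _).trans_eq ?_
    rw [add_right_comm, add_sub_cancel_left, Prod.norm_def]
    simp
  calc ‖angleIntegrand T A Λ b y h s‖
      ≤ K * ‖T • (A (b + (h, 0) + (0, s)) - A (b + (0, s))) (y s)‖ := F.norm_apply_le _ _
    _ ≤ K * (T * (K * |h| * (c * Real.exp (-s / τtr)))) := by
      rw [norm_smul, Real.norm_of_nonneg hT.le]
      gcongr
      exact ((A _ - A _).le_of_opNorm_le A_sub _).trans (by gcongr; exact hdec s hs)
    _ = _ := by ring

theorem continuous_angleIntegrand (F : AdjointCoframe T ρ D A Λ K) (hy : IsVariational T A b y)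
    (h : ℝ) : Continuous (angleIntegrand T A Λ b y h) := by
  have hy_cont : Continuous y := continuous_iff_continuousAt.2 fun s => (hy s).continuousAt
  have hA := F.A_differentiable.continuous
  exact F.continuous.comp (f := fun s : ℝ => (b + (h, 0) + (0, s),
    T • (A (b + (h, 0) + (0, s)) - A (b + (0, s))) (y s))) (by fun_prop)

theorem ae_norm_angleIntegrand_le (F : AdjointCoframe T ρ D A Λ K)
    (hdec : ∀ s ≥ 0, ‖y s‖ ≤ c * Real.exp (-s / τtr)) (h : ℝ) :
    ∀ᵐ s ∂MeasureTheory.volume.restrict (Ioi (0 : ℝ)),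
      ‖angleIntegrand T A Λ b y h s‖ ≤ |h| * (K * (T * (K * c)) * Real.exp (-s / τtr)) := by
  rw [MeasureTheory.ae_restrict_iff' measurableSet_Ioi]
  exact .of_forall fun s hs => F.norm_angleIntegrand_le hdec h (le_of_lt hs)

theorem tendsto_apply_variational (F : AdjointCoframe T ρ D A Λ K) (hτ : 0 < τtr)
    (hdec : ∀ s ≥ 0, ‖y s‖ ≤ c * Real.exp (-s / τtr)) (b : ℝ × ℝ) :
    Tendsto (fun s : ℝ => Λ (b + (0, s)) (y s)) atTop (𝓝 0) := by
  have bound_tendsto : Tendsto (fun s => K * (c * Real.exp (-s / τtr))) atTop (𝓝 0) := by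
    simpa using ((tendsto_exp_neg_div_atTop hτ).const_mul c).const_mul K
  refine squeeze_zero_norm' ?_ bound_tendsto
  filter_upwards [eventually_ge_atTop 0] with s hs
  exact (F.norm_apply_le _ _).trans (mul_le_mul_of_nonneg_left (hdec s hs) F.pos.le)

theorem apply_angle_eq_integral (F : AdjointCoframe T ρ D A Λ K) (hτ : 0 < τtr)
    (hy : IsVariational T A b y) (hdec : ∀ s ≥ 0, ‖y s‖ ≤ c * Real.exp (-s / τtr)) (h : ℝ) :
    Λ (b + (h, 0)) (y 0) = ∫ s in Ioi (0 : ℝ), angleIntegrand T A Λ b y h s := by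
  have integrable : MeasureTheory.IntegrableOn (angleIntegrand T A Λ b y h) (Ioi 0) :=
    (((integrableOn_exp_neg_div hτ).const_mul _).const_mul |h|).mono'
      (F.continuous_angleIntegrand hy h).aestronglyMeasurable (F.ae_norm_angleIntegrand_le hdec h)
  have deriv : ∀ s ∈ Ici (0 : ℝ), HasDerivAt (fun s : ℝ => -Λ (b + (h, 0) + (0, s)) (y s))
      (angleIntegrand T A Λ b y h s) s := fun s _ => by
    refine (F.hasDerivAt (b + (h, 0)) y _ s (hy s)).neg.congr_deriv ?_
    rw [angleIntegrand, ← map_neg, sub_apply, smul_sub, neg_sub]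
  have := MeasureTheory.integral_Ioi_of_hasDerivAt_of_tendsto' deriv integrable
    (by simpa using (F.tendsto_apply_variational hτ hdec (b + (h, 0))).neg)
  rw [this, Prod.mk_zero_zero, add_zero, sub_neg_eq_add, zero_add]

theorem norm_apply_angle_le (F : AdjointCoframe T ρ D A Λ K) (hτ : 0 < τtr)
    (hy : IsVariational T A b y) (hdec : ∀ s ≥ 0, ‖y s‖ ≤ c * Real.exp (-s / τtr)) (h : ℝ) :
    ‖Λ (b + (h, 0)) (y 0)‖ ≤ K * (T * (K * c)) * τtr * |h| := by
  rw [F.apply_angle_eq_integral hτ hy hdec h]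
  refine (MeasureTheory.norm_integral_le_of_norm_le
    (((integrableOn_exp_neg_div hτ).const_mul _).const_mul |h|)
    (F.ae_norm_angleIntegrand_le hdec h)).trans_eq ?_
  rw [MeasureTheory.integral_const_mul, MeasureTheory.integral_const_mul, integral_exp_neg_div hτ,
    mul_comm]

theorem tendsto_inv_smul_angleIntegrand (F : AdjointCoframe T ρ D A Λ K) (b : ℝ × ℝ)
    (y : ℝ → X) (s : ℝ) :
    Tendsto (fun h : ℝ => h⁻¹ • angleIntegrand T A Λ b y h s) (𝓝[≠] 0)
      (𝓝 (Λ (b + (0, s)) (T • fderiv ℝ A (b + (0, s)) (1, 0) (y s)))) := by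
  have A_deriv : HasDerivAt (fun h : ℝ => A (b + (0, s) + (h, 0)) (y s))
      (fderiv ℝ A (b + (0, s)) (1, 0) (y s)) 0 := by
    simpa [Prod.mk_zero_zero] using (hasDerivAt_comp_add_angle (b := b + (0, s)) (s := 0)
      (F.A_differentiable _).hasFDerivAt).clm_apply (hasDerivAt_const 0 (y s))
  have base : Tendsto (fun h : ℝ => b + (h, 0) + (0, s)) (𝓝[≠] 0) (𝓝 (b + (0, s))) := by
    have : Continuous fun h : ℝ => b + (h, 0) + (0, s) := by fun_prop
    simpa [Prod.mk_zero_zero] using (this.tendsto 0).mono_left nhdsWithin_le_nhds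
  refine ((F.continuous.tendsto _).comp (base.prodMk_nhds
    ((hasDerivAt_iff_tendsto_slope.1 A_deriv).const_smul T))).congr fun h => ?_
  simp only [Function.comp, angleIntegrand, slope_def_module, sub_zero, Prod.mk_zero_zero,
    add_zero, sub_apply, map_smul, smul_comm T, add_right_comm b (h, 0)]

theorem exists_hasDerivAt_angle (F : AdjointCoframe T ρ D A Λ K) (hτ : 0 < τtr)
    (hy : IsVariational T A b y) (hy0 : Λ b (y 0) = 0)
    (hdec : ∀ s ≥ 0, ‖y s‖ ≤ c * Real.exp (-s / τtr)) :
    ∃ e, HasDerivAt (fun h : ℝ => Λ (b + (h, 0)) (y 0)) e 0 := by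
  refine ⟨∫ s in Ioi (0 : ℝ), Λ (b + (0, s)) (T • fderiv ℝ A (b + (0, s)) (1, 0) (y s)), ?_⟩
  have slope_eq : ∀ h : ℝ, slope (fun h : ℝ => Λ (b + (h, 0)) (y 0)) 0 h =
      ∫ s in Ioi (0 : ℝ), h⁻¹ • angleIntegrand T A Λ b y h s := fun h => by
    rw [slope_def_module, sub_zero, Prod.mk_zero_zero, add_zero, hy0, sub_zero,
      F.apply_angle_eq_integral hτ hy hdec h, MeasureTheory.integral_smul]
  rw [hasDerivAt_iff_tendsto_slope, tendsto_congr slope_eq]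
  refine MeasureTheory.tendsto_integral_filter_of_dominated_convergence
    (fun s => K * (T * (K * c)) * Real.exp (-s / τtr))
    (.of_forall fun h => ((F.continuous_angleIntegrand hy h).const_smul h⁻¹).aestronglyMeasurable)
    ?_ ((integrableOn_exp_neg_div hτ).const_mul _)
    (.of_forall fun s => F.tendsto_inv_smul_angleIntegrand b y s)
  filter_upwards [self_mem_nhdsWithin] with h (hh : h ≠ 0)
  filter_upwards [F.ae_norm_angleIntegrand_le hdec h] with s hs
  rwa [norm_smul, norm_inv, Real.norm_eq_abs, inv_mul_le_iff₀ (abs_pos.2 hh)]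

end Increment

end AdjointCoframe

section PartialDerivatives

variable {G : Type*} [NormedAddCommGroup G] [NormedSpace ℝ G] {w wt : ℝ × ℝ → G} {b : ℝ × ℝ}

theorem isLittleO_time_sub (hw : ∀ (c : ℝ × ℝ) (s : ℝ),
      HasDerivAt (fun s : ℝ => w (c + (0, s))) (wt (c + (0, s))) s) (hwt : ContinuousAt wt b) :
    (fun c : ℝ × ℝ => w (b + c) - w (b + (c.1, 0)) - c.2 • wt b) =o[𝓝 0] fun c => c := by
  rw [Asymptotics.isLittleO_iff]
  intro ε hε
  obtain ⟨δ, hδ, wt_close⟩ := Metric.continuousAt_iff.1 hwt ε hε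
  filter_upwards [Metric.ball_mem_nhds 0 hδ] with c hc
  rw [mem_ball_zero_iff] at hc
  have deriv_close : ∀ s ∈ Metric.ball (0 : ℝ) δ,
      ‖wt (b + (c.1, 0) + (0, s)) - (1 : ℝ) • wt b‖ ≤ ε := fun s hs => by
    rw [one_smul, ← dist_eq_norm]
    refine (wt_close ?_).le
    rw [add_assoc, dist_self_add_left]
    simpa [Prod.norm_def] using ⟨(norm_fst_le c).trans_lt hc, mem_ball_zero_iff.1 hs⟩
  have increment := (convex_ball (0 : ℝ) δ).norm_image_sub_le_of_norm_hasDerivWithin_le (𝕜 := ℝ)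
    (f := fun s : ℝ => w (b + (c.1, 0) + (0, s)) - s • wt b)
    (fun s _ => ((hw _ s).sub ((hasDerivAt_id s).smul_const (wt b))).hasDerivWithinAt)
    deriv_close (Metric.mem_ball_self hδ) (mem_ball_zero_iff.2 ((norm_snd_le c).trans_lt hc))
  simp only [add_assoc, Prod.mk_add_mk, add_zero, zero_add, zero_smul, sub_zero] at increment
  rw [sub_right_comm]
  exact increment.trans (by gcongr; exact norm_snd_le c)

theorem hasFDerivAt_of_hasDerivAt_angle_time {e : G}
    (he : HasDerivAt (fun h : ℝ => w (b + (h, 0))) e 0)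
    (hw : ∀ (c : ℝ × ℝ) (s : ℝ), HasDerivAt (fun s : ℝ => w (c + (0, s))) (wt (c + (0, s))) s)
    (hwt : ContinuousAt wt b) :
    HasFDerivAt w ((ContinuousLinearMap.fst ℝ ℝ ℝ).smulRight e
      + (ContinuousLinearMap.snd ℝ ℝ ℝ).smulRight (wt b)) b := by
  have angle : (fun c : ℝ × ℝ => w (b + (c.1, 0)) - w b - c.1 • e) =o[𝓝 0] fun c => c := by
    have := hasDerivAt_iff_isLittleO_nhds_zero.1 he
    simp only [zero_add, Prod.mk_zero_zero, add_zero] at this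
    exact (this.comp_tendsto (continuous_fst.tendsto (0 : ℝ × ℝ))).trans_isBigO
      (Asymptotics.isBigO_of_le _ norm_fst_le)
  rw [hasFDerivAt_iff_isLittleO_nhds_zero]
  refine (angle.add (isLittleO_time_sub hw hwt)).congr_left fun c => ?_
  simp only [add_apply, ContinuousLinearMap.smulRight_apply, ContinuousLinearMap.coe_fst',
    ContinuousLinearMap.coe_snd']
  abel

end PartialDerivatives

/-- Every vector in a kernel of the coframe `Λ` is the initial value of a variational solution that
decays with time constant `τtr`. -/
def HasDecayingKernel {X : Type*} [NormedAddCommGroup X] [NormedSpace ℝ X] (T τtr : ℝ)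
    (A : ℝ × ℝ → X →L[ℝ] X) (Λ : ℝ × ℝ → X →L[ℝ] ℝ × ℝ) (C : ℝ) : Prop :=
  ∀ b y₀, Λ b y₀ = 0 → ∃ y : ℝ → X, y 0 = y₀ ∧ IsVariational T A b y ∧
    ∀ s ≥ 0, ‖y s‖ ≤ C * ‖y₀‖ * Real.exp (-s / τtr)

namespace AdjointCoframe

section DecayingKernel

variable {X : Type*} [NormedAddCommGroup X] [NormedSpace ℝ X] {T ρ τtr C : ℝ}
  {D : ℝ × ℝ → ℝ × ℝ →L[ℝ] X} {A : ℝ × ℝ → X →L[ℝ] X} {Λ : ℝ × ℝ → X →L[ℝ] ℝ × ℝ} {K : ℝ}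

theorem exists_norm_angle_sub_le (F : AdjointCoframe T ρ D A Λ K) (hτ : 0 < τtr) (hC : 0 ≤ C)
    (hex : HasDecayingKernel T τtr A Λ C) :
    ∃ L ≥ 0, ∀ (b : ℝ × ℝ) (h : ℝ) (y : X), ‖Λ (b + (h, 0)) y - Λ b y‖ ≤ L * |h| * ‖y‖ := by
  have hT := F.T_pos
  have hK := F.pos
  refine ⟨K * (T * (K * (C * (1 + K * K)))) * τtr + K * (K * K), by positivity, fun b h y => ?_⟩
  set c := Λ b y with hc
  have norm_c : ‖c‖ ≤ K * ‖y‖ := F.norm_apply_le b y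
  have norm_normal : ‖y - D b c‖ ≤ (1 + K * K) * ‖y‖ :=
    calc ‖y - D b c‖ ≤ ‖y‖ + K * (K * ‖y‖) :=
          norm_sub_le_of_le le_rfl (((D b).le_of_opNorm_le (F.D_norm b) c).trans (by gcongr))
      _ = (1 + K * K) * ‖y‖ := by ring
  obtain ⟨z, hz0, hz, hzdec⟩ := hex b (y - D b c) (by rw [map_sub, F.tangent, hc, sub_self])
  have normal_part : ‖Λ (b + (h, 0)) (y - D b c)‖ ≤
      K * (T * (K * (C * ((1 + K * K) * ‖y‖)))) * τtr * |h| :=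
    hz0 ▸ (F.norm_apply_angle_le hτ hz hzdec h).trans (by gcongr)
  have tangential_part : ‖Λ (b + (h, 0)) ((D b - D (b + (h, 0))) c)‖ ≤
      K * (K * |h| * (K * ‖y‖)) := by
    have D_sub : ‖D b - D (b + (h, 0))‖ ≤ K * |h| := by
      rw [norm_sub_rev]
      refine (F.D_lip _ _).trans_eq ?_
      rw [add_sub_cancel_left, Prod.norm_def]
      simp
    exact (F.norm_apply_le _ _).trans
      (by gcongr; exact (ContinuousLinearMap.le_of_opNorm_le _ D_sub c).trans (by gcongr))
  calc ‖Λ (b + (h, 0)) y - c‖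
      = ‖Λ (b + (h, 0)) (y - D b c) + Λ (b + (h, 0)) ((D b - D (b + (h, 0))) c)‖ := by
        rw [sub_apply, map_sub, map_sub, F.tangent, sub_add_sub_cancel]
    _ ≤ K * (T * (K * (C * ((1 + K * K) * ‖y‖)))) * τtr * |h| + K * (K * |h| * (K * ‖y‖)) :=
        norm_add_le_of_le normal_part tangential_part
    _ = _ := by ring

theorem exists_lipschitz (F : AdjointCoframe T ρ D A Λ K) (hτ : 0 < τtr) (hC : 0 ≤ C)
    (hex : HasDecayingKernel T τtr A Λ C) :
    ∃ L ≥ 0, ∀ b b', ‖Λ b' - Λ b‖ ≤ L * ‖b' - b‖ := by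
  have hT := F.T_pos
  have hK := F.pos
  obtain ⟨L, hL, angle_lip⟩ := F.exists_norm_angle_sub_le hτ hC hex
  refine ⟨K * (T * K) + L, by positivity, fun b b' =>
    ContinuousLinearMap.opNorm_le_bound _ (by positivity) fun y => ?_⟩
  obtain ⟨⟨h, s⟩, rfl⟩ : ∃ c, b' = b + c := ⟨b' - b, (add_sub_cancel b b').symm⟩
  rw [add_sub_cancel_left]
  have hs : |s| ≤ ‖(h, s)‖ := norm_snd_le (h, s)
  have hh : |h| ≤ ‖(h, s)‖ := norm_fst_le (h, s)
  calc ‖(Λ (b + (h, s)) - Λ b) y‖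
      = ‖(Λ (b + (h, 0) + (0, s)) y - Λ (b + (h, 0)) y) + (Λ (b + (h, 0)) y - Λ b y)‖ := by
        simp [add_assoc]
    _ ≤ K * (T * K) * |s| * ‖y‖ + L * |h| * ‖y‖ :=
        norm_add_le_of_le (F.norm_time_sub_le _ s y) (angle_lip b h y)
    _ ≤ K * (T * K) * ‖(h, s)‖ * ‖y‖ + L * ‖(h, s)‖ * ‖y‖ := by gcongr
    _ = (K * (T * K) + L) * ‖(h, s)‖ * ‖y‖ := by ring

theorem exists_hasFDerivAt (F : AdjointCoframe T ρ D A Λ K) (hτ : 0 < τtr)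
    (hex : HasDecayingKernel T τtr A Λ C) {b : ℝ × ℝ} {y₀ : X} (hy₀ : Λ b y₀ = 0) :
    ∃ L : ℝ × ℝ →L[ℝ] ℝ × ℝ, HasFDerivAt (fun b' => Λ b' y₀) L b ∧
      L (0, 1) = -(T • Λ b (A b y₀)) := by
  obtain ⟨y, rfl, hy, hdec⟩ := hex b y₀ hy₀
  obtain ⟨e, he⟩ := F.exists_hasDerivAt_angle hτ hy hy₀ hdec
  have time_deriv : ∀ (c : ℝ × ℝ) (s : ℝ), HasDerivAt (fun s : ℝ => Λ (c + (0, s)) (y 0))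
      (-(T • Λ (c + (0, s)) (A (c + (0, s)) (y 0)))) s := fun c s => by
    simpa using F.hasDerivAt c (fun _ => y 0) 0 s (hasDerivAt_const s _)
  have A_cont : Continuous fun c => A c (y 0) :=
    F.A_differentiable.continuous.clm_apply continuous_const
  exact ⟨_, hasFDerivAt_of_hasDerivAt_angle_time he time_deriv
    ((F.continuous.comp (continuous_id.prodMk A_cont)).const_smul T).neg.continuousAt, by simp⟩

end DecayingKernel

end AdjointCoframe

section Stability

variable {n : ℕ} {g : Vec n → Vec n} {T ρ τtr Ctr K : ℝ} {v : ℝ → ℝ → Vec n}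
  {V qtg : ℝ → ℝ → Vec n →L[ℝ] Vec n} {D : ℝ × ℝ → ℝ × ℝ →L[ℝ] Vec n}
  {Λ : ℝ × ℝ → Vec n →L[ℝ] ℝ × ℝ}

theorem IsVariationalSolution.isVariational (hV : IsVariationalSolution g T v V) (b : ℝ × ℝ)
    (ξ : Vec n) :
    IsVariational T (fun b => fderiv ℝ g (Function.uncurry v b)) b
      (fun s => V b.1 (b.2 + s) ξ) := fun s => by
  have := (HasDerivAt.comp_const_add b.2 s (hV.ode b.1 (b.2 + s))).clm_apply (hasDerivAt_const s ξ)
  simpa [Function.uncurry_def] using this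

namespace AdjointCoframe

theorem exists_variational
    (F : AdjointCoframe T ρ D (fun b => fderiv ℝ g (Function.uncurry v b)) Λ K)
    (hV : IsVariationalSolution g T v V) (b : ℝ × ℝ) (y₀ : Vec n) :
    ∃ y, y 0 = y₀ ∧ IsVariational T (fun b => fderiv ℝ g (Function.uncurry v b)) b y := by
  have V_injective : Function.Injective (V b.1 b.2 : Vec n →ₗ[ℝ] Vec n) := by
    rw [injective_iff_map_eq_zero]
    intro ξ hξ
    have zero_variational :
        IsVariational T (fun b => fderiv ℝ g (Function.uncurry v b)) b fun _ => 0 := fun s => by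
      simpa using hasDerivAt_const s (0 : Vec n)
    have := F.variational_unique (hV.isVariational b ξ) zero_variational (s := 0)
      (by rw [add_zero]; exact hξ)
    simpa [hV.init] using congrFun this (-b.2)
  obtain ⟨ξ, rfl⟩ := LinearMap.injective_iff_surjective.1 V_injective y₀
  exact ⟨_, by simp, hV.isVariational b ξ⟩

theorem apply_transversal_eq_zero
    (F : AdjointCoframe T ρ D (fun b => fderiv ℝ g (Function.uncurry v b)) Λ K) (hτ : 0 < τtr)
    (hV : IsVariationalSolution g T v V)
    (hdec : ∀ (k : ℕ) (φ : ℝ),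
      ‖V φ k ∘L (ContinuousLinearMap.id ℝ (Vec n) - qtg φ 0)‖ ≤ Ctr * Real.exp (-k / τtr))
    (φ : ℝ) (ξ : Vec n) : Λ (φ, 0) (ξ - qtg φ 0 ξ) = 0 := by
  have bound : ∀ k : ℕ, ‖Λ (φ, 0) (ξ - qtg φ 0 ξ)‖ ≤
      K * (Ctr * Real.exp (-k / τtr) * ‖ξ‖) := fun k => by
    have invariance := F.apply_variational (hV.isVariational (φ, 0) (ξ - qtg φ 0 ξ)) k
    simp only [zero_add, hV.init, ContinuousLinearMap.id_apply] at invariance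
    rw [← invariance]
    refine (F.norm_apply_le _ _).trans (mul_le_mul_of_nonneg_left ?_ F.pos.le)
    exact ContinuousLinearMap.le_of_opNorm_le _ (hdec k φ) ξ
  have bound_tendsto :
      Tendsto (fun k : ℕ => K * (Ctr * Real.exp (-k / τtr) * ‖ξ‖)) atTop (𝓝 0) := by
    simpa using ((((tendsto_exp_neg_div_atTop hτ).comp
      tendsto_natCast_atTop_atTop).const_mul Ctr).mul_const ‖ξ‖).const_mul K
  exact norm_le_zero_iff.1 (ge_of_tendsto' bound_tendsto bound)

theorem tangentProjection_eq_zero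
    (F : AdjointCoframe T ρ (fderiv ℝ (Function.uncurry v))
      (fun b => fderiv ℝ g (Function.uncurry v b)) Λ K)
    (hτ : 0 < τtr) (hv : IsTorusSolution g T ρ v) (hV : IsVariationalSolution g T v V)
    (hN : IsNormallyHyperbolic ρ v V qtg)
    (hdec : ∀ (k : ℕ) (φ : ℝ),
      ‖V φ k ∘L (ContinuousLinearMap.id ℝ (Vec n) - qtg φ 0)‖ ≤ Ctr * Real.exp (-k / τtr))
    {φ : ℝ} {y : Vec n} (hy : Λ (φ, 0) y = 0) : qtg φ 0 y = 0 := by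
  have mem_span : qtg φ 0 y ∈ Submodule.span ℝ {dtau v φ 0, dphi v φ 0} :=
    hN.range_eq φ 0 ▸ ⟨y, rfl⟩
  obtain ⟨c, hc⟩ : ∃ c, fderiv ℝ (Function.uncurry v) (φ, 0) c = qtg φ 0 y := by
    rw [hv.dtau_eq, hv.dphi_eq] at mem_span
    obtain ⟨α, β, h⟩ := Submodule.mem_span_pair.1 mem_span
    exact ⟨α • (0, 1) + β • (1, 0), by rw [map_add, map_smul, map_smul, h]⟩
  have coords_zero := F.apply_transversal_eq_zero hτ hV hdec φ y
  rw [map_sub, hy, zero_sub, neg_eq_zero, ← hc, F.tangent] at coords_zero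
  rw [← hc, coords_zero, map_zero]

theorem exists_hasDecayingKernel
    (F : AdjointCoframe T ρ (fderiv ℝ (Function.uncurry v))
      (fun b => fderiv ℝ g (Function.uncurry v b)) Λ K)
    (hv : IsTorusSolution g T ρ v) (hst : IsTransversallyStable g T ρ v τtr) :
    ∃ C ≥ 0, HasDecayingKernel T τtr (fun b => fderiv ℝ g (Function.uncurry v b)) Λ C := by
  obtain ⟨hτ, V, qtg, hV, hN, Ctr, hCtr, hdec⟩ := hst
  obtain ⟨C, hC, decay⟩ := F.exists_decay hτ hCtr.le fun φ y hy hy0 k => by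
    have y_eq : y = fun s => V φ (0 + s) (y 0) :=
      F.variational_unique hy (hV.isVariational (φ, 0) (y 0)) (s := 0) (by simp [hV.init])
    calc ‖y k‖ = ‖(V φ k ∘L (ContinuousLinearMap.id ℝ (Vec n) - qtg φ 0)) (y 0)‖ := by
          simpa [F.tangentProjection_eq_zero hτ hv hV hN hdec hy0] using
            congrArg norm (congrFun y_eq k)
      _ ≤ _ := ContinuousLinearMap.le_of_opNorm_le _ (hdec k φ) (y 0)
  refine ⟨C, hC, fun b y₀ hy₀ => ?_⟩
  obtain ⟨y, rfl, hy⟩ := F.exists_variational hV b y₀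
  exact ⟨y, rfl, hy, fun s hs => mul_right_comm C _ _ ▸ decay b y hy hy₀ s hs⟩

end AdjointCoframe

end Stability

theorem exists_cutoff {n : ℕ} {g : Vec n → Vec n} (hg : ContDiff ℝ 2 g) {R : ℝ} (hR : 0 < R) :
    ∃ gt : Vec n → Vec n, ContDiff ℝ 2 gt ∧ HasCompactSupport gt ∧ ∀ x, ‖x‖ ≤ R → gt x = g x := by
  let χ : ContDiffBump (0 : Vec n) := ⟨R, R + 1, hR, lt_add_one R⟩
  refine ⟨fun x => χ x • g x, χ.contDiff.smul hg, χ.hasCompactSupport.smul_right, fun x hx => ?_⟩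
  simp only [χ.one_of_mem_closedBall (mem_closedBall_zero_iff.2 hx), one_smul]

theorem exists_norm_lipschitz_taylor_bound {n : ℕ} {g : Vec n → Vec n} (hg : ContDiff ℝ 2 g)
    (hc : HasCompactSupport g) :
    ∃ C ≥ 0, (∀ x, ‖g x‖ ≤ C) ∧ (∀ x y, ‖g x - g y‖ ≤ C * ‖x - y‖) ∧
      ∀ x y, ‖g y - g x - fderiv ℝ g x (y - x)‖ ≤ C * ‖y - x‖ ^ 2 := by
  obtain ⟨B, hB⟩ := hg.continuous.bounded_above_of_compact_support hc
  obtain ⟨L, hL⟩ := ContDiff.lipschitzWith_of_hasCompactSupport hc hg two_ne_zero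
  obtain ⟨L', hL'⟩ := ContDiff.lipschitzWith_of_hasCompactSupport (hc.fderiv (𝕜 := ℝ))
    (hg.fderiv_right (m := 1) (by norm_num)) one_ne_zero
  have hB0 : 0 ≤ B := (norm_nonneg _).trans (hB 0)
  refine ⟨B + L + L', by positivity, fun x => (hB x).trans ?_, fun x y => ?_, fun x y => ?_⟩
  · linarith [L.coe_nonneg, L'.coe_nonneg]
  · exact (hL.norm_sub_le x y).trans (by gcongr; linarith [L'.coe_nonneg])
  · exact (norm_taylor_le_of_lipschitz_fderiv (hg.differentiable two_ne_zero) L'.coe_nonneg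
      (fun x y => hL'.norm_sub_le y x) x y).trans (by gcongr; linarith [L.coe_nonneg])

theorem exists_bounded_lipschitz_extension {n : ℕ} {g : Vec n → Vec n} (hg : ContDiff ℝ 2 g)
    {ι : Type*} {v : ι → Vec n} {R : ℝ} (hv : ∀ b, ‖v b‖ ≤ R) :
    ∃ (gt : Vec n → Vec n) (C : ℝ), 0 ≤ C ∧ (∀ b x, ‖x - v b‖ ≤ 1 → gt x = g x) ∧
      (∀ x, ‖gt x‖ ≤ C) ∧ (∀ x y, ‖gt x - gt y‖ ≤ C * ‖x - y‖) ∧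
      ∀ b x, ‖gt x - gt (v b) - fderiv ℝ g (v b) (x - v b)‖ ≤ C * ‖x - v b‖ ^ 2 := by
  obtain ⟨gt, gt_smooth, gt_support, gt_eq⟩ := exists_cutoff hg (R := |R| + 1) (by positivity)
  obtain ⟨C, hC, bound, lip, taylor⟩ := exists_norm_lipschitz_taylor_bound gt_smooth gt_support
  have agree : ∀ b x, ‖x - v b‖ ≤ 1 → gt x = g x := fun b x hx => gt_eq x <|
    calc ‖x‖ = ‖v b + (x - v b)‖ := by rw [add_sub_cancel]
      _ ≤ |R| + 1 := norm_add_le_of_le ((hv b).trans (le_abs_self R)) hx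
  have fderiv_eq : ∀ b, fderiv ℝ gt (v b) = fderiv ℝ g (v b) := fun b => by
    refine Filter.EventuallyEq.fderiv_eq ?_
    filter_upwards [Metric.closedBall_mem_nhds (v b) one_pos] with x hx
    exact agree b x (mem_closedBall_iff_norm.1 hx)
  exact ⟨gt, C, hC, agree, bound, lip, fun b x => fderiv_eq b ▸ taylor (v b) x⟩

/-- The functionals `(-λ_ρᵀ, λ_Tᵀ / T)` given by the two adjoint solutions; they read off the first
order change of the phases `(φ, σ)` under a displacement. -/
noncomputable def adjointCoframe {n : ℕ} (T : ℝ) (lT lρ : ℝ → ℝ → Vec n) (b : ℝ × ℝ) :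
    Vec n →L[ℝ] ℝ × ℝ :=
  (-(innerSL ℝ (lρ b.1 b.2))).prod (T⁻¹ • innerSL ℝ (lT b.1 b.2))

section AdjointCoframe

variable {n q : ℕ} {f : Vec n → Vec q → Vec n} {p : Vec q} {T ρ τtr : ℝ} {v : ℝ → ℝ → Vec n}
  {h : (ℝ → ℝ → Vec n) → Vec q → Fin 2 → ℝ} {Dv : Fin 2 → ℝ → ℝ → Vec n} {Dp : Fin 2 → Vec q}
  {lT lρ : ℝ → ℝ → Vec n}

theorem adjointCoframe_apply (T : ℝ) (lT lρ : ℝ → ℝ → Vec n) (b : ℝ × ℝ) (y : Vec n) :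
    adjointCoframe T lT lρ b y = (-inner ℝ (lρ b.1 b.2) y, inner ℝ (lT b.1 b.2) y / T) := by
  simp [adjointCoframe, div_eq_inv_mul]

theorem continuous_adjointCoframe (hT : Continuous (Function.uncurry lT))
    (hρ : Continuous (Function.uncurry lρ)) : Continuous (adjointCoframe T lT lρ) := by
  have prod := (((innerSL ℝ).continuous.comp hρ).neg).prodMk
    (((innerSL ℝ).continuous.comp hT).const_smul T⁻¹)
  exact (ContinuousLinearMap.prodₗᵢ ℝ).continuous.comp prod

theorem torusPeriodic_adjointCoframe (hT : TorusPeriodic ρ (Function.uncurry lT))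
    (hρ : TorusPeriodic ρ (Function.uncurry lρ)) : TorusPeriodic ρ (adjointCoframe T lT lρ) where
  angle b := by
    have := hT.angle b
    have := hρ.angle b
    simp_all only [Function.uncurry_def, adjointCoframe]
  time b := by
    have := hT.time b
    have := hρ.time b
    simp_all only [Function.uncurry_def, adjointCoframe]

theorem hasDerivAt_inner_adjoint {l : ℝ × ℝ → Vec n} {A : ℝ × ℝ → Vec n →L[ℝ] Vec n}
    (hl : ∀ (b : ℝ × ℝ) (s : ℝ), HasDerivAt (fun s : ℝ => l (b + (0, s)))
      (-(T • ContinuousLinearMap.adjoint (A (b + (0, s))) (l (b + (0, s))))) s)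
    (b : ℝ × ℝ) {y : ℝ → Vec n} {y' : Vec n} {s : ℝ} (hy : HasDerivAt y y' s) :
    HasDerivAt (fun s : ℝ => inner ℝ (l (b + (0, s))) (y s))
      (inner ℝ (l (b + (0, s))) (y' - T • A (b + (0, s)) (y s))) s := by
  refine ((hl b s).inner ℝ hy).congr_deriv ?_
  rw [inner_neg_left, inner_smul_left, ContinuousLinearMap.adjoint_inner_left, inner_sub_right,
    inner_smul_right]
  simp [sub_eq_add_neg]

namespace IsPhaseCondition

variable {lbcT lbcρ : ℝ → Vec n} {lpsT lpsρ : Fin 2 → ℝ} {ηpT ηpρ : Vec q}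

theorem hasDerivAt_adjointCoframe (hh : IsPhaseCondition h v p Dv Dp)
    (hg : Differentiable ℝ (fun x => f x p)) (hv : IsTorusSolution (fun x => f x p) T ρ v)
    (hlT : IsAdjointSolution f p T ρ v Dv Dp 0 1 lT lbcT lpsT ηpT)
    (hlρ : IsAdjointSolution f p T ρ v Dv Dp 1 0 lρ lbcρ lpsρ ηpρ)
    (b : ℝ × ℝ) (y : ℝ → Vec n) (y' : Vec n) (s : ℝ) (hy : HasDerivAt y y' s) :
    HasDerivAt (fun s : ℝ => adjointCoframe T lT lρ (b + (0, s)) (y s))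
      (adjointCoframe T lT lρ (b + (0, s)) (y' - T •
        fderiv ℝ (fun x => f x p) (Function.uncurry v (b + (0, s))) (y s))) s := by
  simp only [adjointCoframe_apply]
  exact (hasDerivAt_inner_adjoint (A := fun b => fderiv ℝ _ (Function.uncurry v b))
      (hh.hasDerivAt_adjoint hg hv hlρ) b hy).neg.prodMk
    ((hasDerivAt_inner_adjoint (A := fun b => fderiv ℝ _ (Function.uncurry v b))
      (hh.hasDerivAt_adjoint hg hv hlT) b hy).div_const T)

theorem adjointCoframe_tangent (hh : IsPhaseCondition h v p Dv Dp) (hT : 0 < T)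
    (hρ : Irrational ρ) (hg : Differentiable ℝ (fun x => f x p))
    (hv : IsTorusSolution (fun x => f x p) T ρ v)
    (hlT : IsAdjointSolution f p T ρ v Dv Dp 0 1 lT lbcT lpsT ηpT)
    (hlρ : IsAdjointSolution f p T ρ v Dv Dp 1 0 lρ lbcρ lpsρ ηpρ) (b c : ℝ × ℝ) :
    adjointCoframe T lT lρ b (fderiv ℝ (Function.uncurry v) b c) = c := by
  have angle_vector :
      adjointCoframe T lT lρ b (fderiv ℝ (Function.uncurry v) b (1, 0)) = (1, 0) := by
    have inner_T := hh.inner_adjoint_angle hρ hg hv hlT b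
    have inner_ρ := hh.inner_adjoint_angle hρ hg hv hlρ b
    simp only [Function.uncurry_def] at inner_T inner_ρ ⊢
    simp [adjointCoframe_apply, inner_T, inner_ρ]
  have time_vector :
      adjointCoframe T lT lρ b (fderiv ℝ (Function.uncurry v) b (0, 1)) = (0, 1) := by
    have inner_T := hh.inner_adjoint_time hT hρ hg hv hlT b
    have inner_ρ := hh.inner_adjoint_time hT hρ hg hv hlρ b
    simp only [Function.uncurry_def] at inner_T inner_ρ ⊢
    simp [adjointCoframe_apply, inner_T, inner_ρ, hT.ne']
  have c_eq : c = c.1 • (1, 0) + c.2 • (0, 1) := by ext <;> simp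
  rw [c_eq, map_add, map_add, map_smul, map_smul, map_smul, map_smul, angle_vector, time_vector]

theorem exists_adjointCoframe (hh : IsPhaseCondition h v p Dv Dp)
    (hg : ContDiff ℝ 2 (fun x => f x p)) (hT : 0 < T) (hρ : Irrational ρ)
    (hv : IsTorusSolution (fun x => f x p) T ρ v)
    (hlT : IsAdjointFunction f p T ρ v Dv Dp 0 1 lT)
    (hlρ : IsAdjointFunction f p T ρ v Dv Dp 1 0 lρ) :
    ∃ K, AdjointCoframe T ρ (fderiv ℝ (Function.uncurry v))
      (fun b => fderiv ℝ (fun x => f x p) (Function.uncurry v b)) (adjointCoframe T lT lρ) K := by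
  obtain ⟨lbcT, lpsT, ηpT, hlT⟩ := hlT
  obtain ⟨lbcρ, lpsρ, ηpρ, hlρ⟩ := hlρ
  have A_smooth : ContDiff ℝ 1 fun b => fderiv ℝ (fun x => f x p) (Function.uncurry v b) :=
    (hg.fderiv_right (m := 1) (by norm_num)).comp (hv.smooth.of_le (by norm_num))
  have A_periodic : TorusPeriodic ρ fun b => fderiv ℝ (fun x => f x p) (Function.uncurry v b) :=
    hv.torusPeriodic.comp _
  have D_smooth : ContDiff ℝ 1 (fderiv ℝ (Function.uncurry v)) :=
    hv.smooth.fderiv_right (by norm_num)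
  have D_periodic := hv.torusPeriodic.fderiv
  have Λ_cont := continuous_adjointCoframe (T := T) hlT.continuous hlρ.continuous
  have Λ_periodic := torusPeriodic_adjointCoframe (T := T) hlT.torusPeriodic hlρ.torusPeriodic
  obtain ⟨CA, hCA, A_norm⟩ := A_periodic.exists_norm_le A_smooth.continuous
  obtain ⟨LA, hLA, A_lip⟩ := A_periodic.exists_lipschitz A_smooth
  obtain ⟨CD, hCD, D_norm⟩ := D_periodic.exists_norm_le D_smooth.continuous
  obtain ⟨LD, hLD, D_lip⟩ := D_periodic.exists_lipschitz D_smooth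
  obtain ⟨CΛ, hCΛ, Λ_norm⟩ := Λ_periodic.exists_norm_le Λ_cont
  refine ⟨1 + CA + LA + CD + LD + CΛ, ?_⟩
  exact {
    T_pos := hT
    one_le := by linarith
    continuous := (Λ_cont.comp continuous_fst).clm_apply continuous_snd
    periodic := Λ_periodic
    norm_le := fun b => (Λ_norm b).trans (by linarith)
    hasDerivAt := hh.hasDerivAt_adjointCoframe (hg.differentiable two_ne_zero) hv hlT hlρ
    tangent := hh.adjointCoframe_tangent hT hρ (hg.differentiable two_ne_zero) hv hlT hlρ
    A_norm := fun b => (A_norm b).trans (by linarith)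
    A_lip := fun b b' => (A_lip b b').trans (by gcongr; linarith)
    A_periodic
    A_differentiable := A_smooth.differentiable one_ne_zero
    D_norm := fun b => (D_norm b).trans (by linarith)
    D_lip := fun b b' => (D_lip b b').trans (by gcongr; linarith) }

end IsPhaseCondition

end AdjointCoframe

theorem PhaseCoframe.mono {E X : Type*} [NormedAddCommGroup E] [NormedSpace ℝ E]
    [NormedAddCommGroup X] [NormedSpace ℝ X] {v : E → X} {Λ : E → X →L[ℝ] E} {K K' : ℝ}
    (F : PhaseCoframe v Λ K) (hK : K ≤ K') : PhaseCoframe v Λ K' where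
  one_le := F.one_le.trans hK
  manifold_lip b b' := (F.manifold_lip b b').trans (by gcongr)
  norm_le b := (F.norm_le b).trans hK
  tangent b b' := (F.tangent b b').trans (by gcongr)
  lip b b' := (F.lip b b').trans (by gcongr)

theorem AdjointCoframe.phaseCoframe {X : Type*} [NormedAddCommGroup X] [NormedSpace ℝ X]
    {T ρ K L : ℝ} {w : ℝ × ℝ → X} {A : ℝ × ℝ → X →L[ℝ] X} {Λ : ℝ × ℝ → X →L[ℝ] ℝ × ℝ}
    (F : AdjointCoframe T ρ (fderiv ℝ w) A Λ K) (hw : Differentiable ℝ w) (hL : 0 ≤ L)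
    (hΛ : ∀ b b', ‖Λ b' - Λ b‖ ≤ L * ‖b' - b‖) : PhaseCoframe w Λ (K * K + L) where
  one_le := by nlinarith [F.one_le]
  manifold_lip b b' := by
    have K_le : K ≤ K * K + L := by nlinarith [F.one_le]
    exact (convex_univ.norm_image_sub_le_of_norm_fderiv_le (𝕜 := ℝ) (fun x _ => hw x)
      (fun x _ => F.D_norm x) (mem_univ b) (mem_univ b')).trans (by gcongr)
  norm_le b := (F.norm_le b).trans (by nlinarith [F.one_le])
  tangent b b' := by
    have hK := F.pos
    calc ‖Λ b (w b' - w b) - (b' - b)‖ = ‖Λ b (w b' - w b - fderiv ℝ w b (b' - b))‖ := by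
          rw [map_sub _ (w b' - w b), F.tangent]
      _ ≤ K * (K * ‖b' - b‖ ^ 2) := (F.norm_apply_le _ _).trans
          (by gcongr; exact norm_taylor_le_of_lipschitz_fderiv hw hK.le F.D_lip b b')
      _ ≤ (K * K + L) * ‖b' - b‖ ^ 2 := by nlinarith [mul_nonneg hL (sq_nonneg ‖b' - b‖)]
  lip b b' := (hΛ b b').trans (by gcongr; nlinarith [F.one_le])

theorem IsPhaseCondition.exists_attractingTorus {n q : ℕ} {f : Vec n → Vec q → Vec n} {p : Vec q}
    {T ρ τtr : ℝ} {v : ℝ → ℝ → Vec n} {h : (ℝ → ℝ → Vec n) → Vec q → Fin 2 → ℝ}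
    {Dv : Fin 2 → ℝ → ℝ → Vec n} {Dp : Fin 2 → Vec q} {lT lρ : ℝ → ℝ → Vec n}
    (hh : IsPhaseCondition h v p Dv Dp) (hg : ContDiff ℝ 2 (fun x => f x p)) (hT : 0 < T)
    (hρ : Irrational ρ) (hv : IsTorusSolution (fun x => f x p) T ρ v)
    (hst : IsTransversallyStable (fun x => f x p) T ρ v τtr)
    (hlT : IsAdjointFunction f p T ρ v Dv Dp 0 1 lT)
    (hlρ : IsAdjointFunction f p T ρ v Dv Dp 1 0 lρ) :
    ∃ (gt : Vec n → Vec n) (B K : ℝ), (∀ x, ‖gt x‖ ≤ B) ∧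
      (∀ (b : ℝ × ℝ) x, ‖x - v b.1 b.2‖ ≤ 1 → gt x = f x p) ∧
      AttractingTorus gt T τtr (fun b => v b.1 b.2)
        (fun b => fderiv ℝ (fun x => f x p) (v b.1 b.2)) (adjointCoframe T lT lρ) K := by
  obtain ⟨κ, F⟩ := hh.exists_adjointCoframe hg hT hρ hv hlT hlρ
  obtain ⟨C, hC, decay⟩ := F.exists_hasDecayingKernel hv hst
  obtain ⟨L, hL, Λ_lip⟩ := F.exists_lipschitz hst.1 hC decay
  obtain ⟨R, -, v_norm⟩ := hv.torusPeriodic.exists_norm_le hv.smooth.continuous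
  obtain ⟨gt, B, hB, agree, gt_norm, gt_lip, gt_taylor⟩ :=
    exists_bounded_lipschitz_extension hg v_norm
  have gt_torus : ∀ b : ℝ × ℝ, gt (v b.1 b.2) = f (v b.1 b.2) p := fun b =>
    agree b _ (by simp [Function.uncurry_def])
  have hκ := F.pos
  have hκκ := mul_pos hκ hκ
  refine ⟨gt, B, κ + κ * κ + L + B + C, gt_norm, agree, ?_⟩
  exact {
    toPhaseCoframe := (F.phaseCoframe (hv.smooth.differentiable two_ne_zero) hL Λ_lip).mono
      (by linarith)
    T_pos := hT
    τ_pos := hst.1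
    ode := fun b s => by rw [gt_torus]; exact hv.hasDerivAt_time b s
    coframe_field := fun b => by
      rw [gt_torus, ← map_smul, ← hv.fderiv_time (v := v), F.tangent]
    g_lip := fun x y => (gt_lip x y).trans (by gcongr; linarith)
    g_taylor := fun b x => (gt_taylor b x).trans
      (mul_le_mul_of_nonneg_right (by linarith) (sq_nonneg _))
    A_norm := fun b => (F.A_norm b).trans (by linarith)
    transversal := fun b y₀ hy₀ => by
      obtain ⟨y, rfl, hy, hdec⟩ := decay b y₀ hy₀
      refine ⟨y, rfl, hy, fun s hs => ⟨(F.apply_variational hy s).trans hy₀, ?_⟩⟩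
      exact (hdec s hs).trans (by rw [mul_right_comm]; gcongr; linarith)
    differentiable := fun b y₀ hy₀ => F.exists_hasFDerivAt hst.1 decay hy₀ }

theorem mainTheorem2 {n q : ℕ} (f : Vec n → Vec q → Vec n)
    (hf : ContDiff ℝ 2 (Function.uncurry f)) (p : Vec q) (T ρ τtr : ℝ) (hT : 0 < T)
    (hρ : Irrational ρ) (v : ℝ → ℝ → Vec n)
    (hv : IsTorusSolution (fun x => f x p) T ρ v)
    (hst : IsTransversallyStable (fun x => f x p) T ρ v τtr)
    (h : (ℝ → ℝ → Vec n) → Vec q → Fin 2 → ℝ)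
    (Dv : Fin 2 → ℝ → ℝ → Vec n) (Dp : Fin 2 → Vec q) (hh : IsPhaseCondition h v p Dv Dp)
    (lT lρ : ℝ → ℝ → Vec n)
    (hlT : IsAdjointFunction f p T ρ v Dv Dp 0 1 lT)
    (hlρ : IsAdjointFunction f p T ρ v Dv Dp 1 0 lρ) :
    -- phase dynamics along perturbed trajectories, uniformly for all `τ ≥ 0`
    (∃ ε₀ > 0, ∃ r > 0, ∃ C > 0, ∀ ε : ℝ, 0 < ε → ε ≤ ε₀ →
      ∀ dode : ℝ → Vec n, ContinuousOn dode (Set.Ici 0) → (∀ τ ≥ 0, ‖dode τ‖ ≤ ε) →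
      ∀ (φ₀ σ₀ : ℝ) (x₀ : Vec n), ‖x₀ - v φ₀ σ₀‖ ≤ ε →
        (∃ x, IsPerturbedTrajectory (fun x => f x p) T dode x₀ x) ∧
        ∀ x, IsPerturbedTrajectory (fun x => f x p) T dode x₀ x →
          ∃ φ σ : ℝ → ℝ,
            IsPhaseDecomposition v lT lρ x φ σ ∧ |φ 0 - φ₀| ≤ r ∧ |σ 0 - σ₀| ≤ r ∧
            DifferentiableOn ℝ φ (Set.Ici 0) ∧ DifferentiableOn ℝ σ (Set.Ici 0) ∧
            (∀ τ ≥ 0,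
              ‖x τ - v (φ τ) (σ τ)‖ ≤ C * ε ∧
              |derivWithin φ (Set.Ici 0) τ - -inner ℝ (lρ (φ τ) (σ τ)) (dode τ)| ≤ C * ε ^ 2 ∧
              |derivWithin σ (Set.Ici 0) τ - (1 + inner ℝ (lT (φ τ) (σ τ)) (dode τ) / T)|
                ≤ C * ε ^ 2) ∧
            ∀ φ' σ' : ℝ → ℝ, IsPhaseDecomposition v lT lρ x φ' σ' →
              |φ' 0 - φ₀| ≤ r → |σ' 0 - σ₀| ≤ r →
              Set.EqOn φ' φ (Set.Ici 0) ∧ Set.EqOn σ' σ (Set.Ici 0)) ∧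
    -- comparison of unforced trajectories
    (∃ d₀ > 0, ∃ C > 0, ∀ (φ₀ σ₀ : ℝ) (d : Vec n), ‖d‖ ≤ d₀ → ∀ τ ≥ 0,
      FlowDefined (fun x => f x p) (T * τ) (v φ₀ σ₀ + d) ∧
      FlowDefined (fun x => f x p) (T * τ)
        (v (φ₀ - inner ℝ (lρ φ₀ σ₀) d) (σ₀ + inner ℝ (lT φ₀ σ₀) d / T)) ∧
      ‖flow (fun x => f x p) (T * τ) (v φ₀ σ₀ + d) -
        flow (fun x => f x p) (T * τ)
          (v (φ₀ - inner ℝ (lρ φ₀ σ₀) d) (σ₀ + inner ℝ (lT φ₀ σ₀) d / T))‖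
        ≤ C * ‖d‖ ^ 2 + C * Real.exp (-τ / τtr)) ∧
    -- the adjoint solutions give the linearization of the asymptotic phases
    (∃ d₀ > 0, ∃ r > 0, ∃ C > 0, ∀ (φ₀ σ₀ : ℝ) (d : Vec n), ‖d‖ ≤ d₀ →
      ∃ φs σs : ℝ, IsAsymptoticPhase (fun x => f x p) T v (v φ₀ σ₀ + d) φs σs ∧
        |φs - φ₀| ≤ r ∧ |σs - σ₀| ≤ r ∧
        |φs - (φ₀ - inner ℝ (lρ φ₀ σ₀) d)| ≤ C * ‖d‖ ^ 2 ∧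
        |σs - (σ₀ + inner ℝ (lT φ₀ σ₀) d / T)| ≤ C * ‖d‖ ^ 2 ∧
        ∀ φ' σ' : ℝ, IsAsymptoticPhase (fun x => f x p) T v (v φ₀ σ₀ + d) φ' σ' →
          |φ' - φ₀| ≤ r → |σ' - σ₀| ≤ r → φ' = φs ∧ σ' = σs) := by
  have hg : ContDiff ℝ 2 (fun x => f x p) := hf.comp (contDiff_id.prodMk contDiff_const)
  have hg_lip := (hg.of_le one_le_two).locallyLipschitz
  have hΛ := adjointCoframe_apply T lT lρ
  obtain ⟨gt, B, K, hB, agree, F⟩ := hh.exists_attractingTorus hg hT hρ hv hst hlT hlρ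
  obtain ⟨ε₀, hε₀, r, hr, C, hC, dynamics⟩ := F.perturbed_phase_dynamics hg_lip hB agree hΛ
  exact ⟨⟨ε₀, hε₀, r, hr, C, hC, fun ε _ => dynamics ε⟩,
    F.flow_comparison hg_lip hB agree hΛ,
    F.asymptotic_phase_linearization hg_lip hB agree hΛ⟩
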